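/- **Language.** A signature consists of a countably infinite set of constants and a countable set of predicate symbols with positive arities. Terms are variables $v_0,v_1,\dots$ or constants; formulas are built from $P(t_1,\dots,t_n)$, $s\equiv t$ and $\bot$ by $\land,\lor,\to,\square,\lozenge,\forall x,\exists x$; $\neg\varphi:=\varphi\to\bot$, $\top:=\neg\bot$. A sentence is a formula without free variables. We write $\varphi(x)$ for a formula with no free variable other than $x$ ($x$ need not occur), and $\varphi(c)$ for the result of replacing its free occurrences of $x$ by the constant $c$. **Logics.** $\mathsf{FOFS}$ is the Hilbert system with the axioms ($\varphi,\psi$ sentences, except where displayed as $\varphi(x)$, $\psi(x)$; $c,c_1,c_2$ constants): all substitution instances (by sentences) of theorems of intuitionistic propositional logic; $\square(\varphi\land\psi)\leftrightarrow(\square\varphi\land\square\psi)$; $\square\top$; $\lozenge(\varphi\lor\psi)\leftrightarrow(\lozenge\varphi\lor\lozenge\psi)$; $\neg\lozenge\bot$; $(\lozenge\varphi\to\square\psi)\to\square(\varphi\to\psi)$; $\lozenge(\varphi\to\psi)\to(\square\varphi\to\lozenge\psi)$; $\forall x\varphi(x)\to\varphi(c)$; $\varphi(c)\to\exists x\varphi(x)$;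 $\forall x(\varphi(x)\to\psi)\to(\exists x\varphi(x)\to\psi)$; $\forall x(\varphi\to\psi(x))\to(\varphi\to\forall x\psi(x))$; $c\equiv c$; $c_1\equiv c_2\to(\varphi(c_1)\to\varphi(c_2))$ for $\varphi(x)$ without modal operators; and the rules: modus ponens; from $\varphi(c)$ infer $\forall x\varphi(x)$, if $c$ does not occur in $\varphi(x)$; from $\varphi\to\psi$ infer $\square\varphi\to\square\psi$ and $\lozenge\varphi\to\lozenge\psi$. Adding axiom schemes (over all sentences $\varphi$) gives: $\mathsf{FOFS\text{-}D}$ by adding $\square\varphi\to\lozenge\varphi$; $\mathsf{FOFS4}$ by adding $\square\varphi\to\square\square\varphi$ and $\lozenge\lozenge\varphi\to\lozenge\varphi$; $\mathsf{FOFS\text{-}D4}$ by adding all three of these; $\mathsf{FOFST}$ by adding $\square\varphi\to\varphi$ and $\varphi\to\lozenge\varphi$; $\mathsf{FOFS\text{-}S4}$ by adding to $\mathsf{FOFST}$ the two schemes of $\mathsf{FOFS4}$. Further, $\mathsf{NI}$ is the scheme $c_1\equiv c_2\to\square(c_1\equiv c_2)$ and $\mathsf{ND}$ the scheme $\lozenge(c_1\equiv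 c_2)\to c_1\equiv c_2$. For a set $\Gamma$ of sentences, $\Gamma\vdash\varphi$ means that $\bigwedge_i\gamma_i\to\varphi$ is a theorem for some finite $\{\gamma_i\}_i\subseteq\Gamma$ (the empty conjunction being $\top$). **Semantics.** A frame is $(W,\preccurlyeq,M,D,\sim)$ where $\preccurlyeq$ is a partial order on $W$ and $M$ a binary relation on $W$ such that (FC1) if $w\mathrel M v\preccurlyeq v'$ then $w\preccurlyeq w'\mathrel M v'$ for some $w'$; (FC2) if $w\preccurlyeq w'$ and $w\mathrel M v$ then $v\preccurlyeq v'$ and $w'\mathrel M v'$ for some $v'$; each $w\in W$ has a domain $D(w)$ with $D(w)\subseteq D(u)$ whenever $w\preccurlyeq u$ or $w\mathrel M u$, and an equivalence relation $\sim_w$ on $D(w)$ with ${\sim_w}\subseteq{\sim_{w'}}$ whenever $w\preccurlyeq w'$. A model adds an interpretation of each constant by one element lying in all $D(w)$, and of each $n$-ary $P$ at each $w$ by a subset of $D(w)^n$ that is invariant under $\sim_w$ and increasing along $\preccurlyeq$. Truth at $w$ under an assignment $g$ of elements of $D(w)$ to the variables: atomic formulas by the interpretation, with $\equiv$ read as $\sim_w$;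 $\land,\lor,\bot$ as usual; $\varphi\to\psi$ iff for all $w'\succcurlyeq w$, truth of $\varphi$ at $w'$ implies that of $\psi$; $\square\varphi$ iff $\varphi$ is true at all $v$ with $w\preccurlyeq w'\mathrel M v$ for some $w'$; $\lozenge\varphi$ iff $\varphi$ is true at some $v$ with $w\mathrel M v$; $\forall x\varphi$ iff for all $w'\succcurlyeq w$ and $a\in D(w')$, $\varphi$ is true at $w'$ under $g[x:=a]$; $\exists x\varphi$ iff $\varphi$ is true at $w$ under $g[x:=a]$ for some $a\in D(w)$. A formula is true at $w$ if it is true at $w$ under all such $g$. For a class $\mathcal C$ of frames, $\Gamma\Vdash_{\mathcal C}\varphi$ means that at every world of every model on a frame in $\mathcal C$, if all of $\Gamma$ is true then $\varphi$ is true. A logic is sound and complete with respect to $\mathcal C$ if $\Gamma\vdash\varphi\iff\Gamma\Vdash_{\mathcal C}\varphi$ for every set $\Gamma$ of sentences and every sentence $\varphi$. **Theorem.** Let $L$ be one of $\mathsf{FOFS}$, $\mathsf{FOFS4}$, $\mathsf{FOFS\text{-}D}$, $\mathsf{FOFS\text{-}D4}$, $\mathsf{FOFST}$, $\mathsf{FOFS\text{-}S4}$,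 and let $\mathcal C_L$ be the class of frames for which $M$ is, respectively: arbitrary; transitive; serial; serial and transitive; reflexive; reflexive and transitive. Let $\mathcal C_L^{\Rightarrow}$ be the class of frames in $\mathcal C_L$ such that $w\mathrel M v$ and $d_1\sim_w d_2$ imply $d_1\sim_v d_2$; let $\mathcal C_L^{\Leftarrow}$ be the class of frames in $\mathcal C_L$ such that $w\mathrel M v$, $d_1,d_2\in D(w)$ and $d_1\sim_v d_2$ imply $d_1\sim_w d_2$; and let $\mathcal C_L^{\Leftrightarrow}=\mathcal C_L^{\Rightarrow}\cap\mathcal C_L^{\Leftarrow}$. Then 1. $L\oplus\{\mathsf{NI}\}$ is sound and complete with respect to $\mathcal C_L^{\Rightarrow}$; 2. $L\oplus\{\mathsf{ND}\}$ is sound and complete with respect to $\mathcal C_L^{\Leftarrow}$; 3. $L\oplus\{\mathsf{NI},\mathsf{ND}\}$ is sound and complete with respect to $\mathcal C_L^{\Leftrightarrow}$. -/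

import Mathlib

universe u v w

/-- A signature: a countably infinite set of constants and a countable set of predicate symbols
with positive arities. -/
structure Signature where
  Const : Type u
  Pred : Type u
  arity : Pred → ℕ
  arity_pos : ∀ P, 0 < arity P
  countable_const : Countable Const
  infinite_const : Infinite Const
  countable_pred : Countable Pred

namespace FischerServi

/-- Terms: variables `v₀, v₁, …` and constants. -/
inductive Term (σ : Signature.{u}) : Type u
  | var (x : ℕ) : Term σ
  | const (c : σ.Const) : Term σ

/-- The language generated by a signature. -/
inductive Formula (σ : Signature.{u}) : Type u
  | rel (P : σ.Pred) (ts : Fin (σ.arity P) → Term σ) : Formula σ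
  | eq (s t : Term σ) : Formula σ
  | bot : Formula σ
  | conj (φ ψ : Formula σ) : Formula σ
  | disj (φ ψ : Formula σ) : Formula σ
  | imp (φ ψ : Formula σ) : Formula σ
  | box (φ : Formula σ) : Formula σ
  | dia (φ : Formula σ) : Formula σ
  | all (x : ℕ) (φ : Formula σ) : Formula σ
  | ex (x : ℕ) (φ : Formula σ) : Formula σ

/-- Replace the variable `x` by the constant `c` in a term. -/
def Term.subst {σ : Signature.{u}} (x : ℕ) (c : σ.Const) : Term σ → Term σ
  | .var y => if y = x then .const c else .var y
  | .const d => .const d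

namespace Formula

variable {σ : Signature.{u}}

def neg (φ : Formula σ) : Formula σ := imp φ bot

def top : Formula σ := neg bot

def iff (φ ψ : Formula σ) : Formula σ := conj (imp φ ψ) (imp ψ φ)

/-- The set of free variables of a formula. -/
def freeVars : Formula σ → Set ℕ
  | rel _ ts => {x | ∃ i, ts i = .var x}
  | eq s t => {x | s = .var x ∨ t = .var x}
  | bot => ∅
  | conj φ ψ => φ.freeVars ∪ ψ.freeVars
  | disj φ ψ => φ.freeVars ∪ ψ.freeVars
  | imp φ ψ => φ.freeVars ∪ ψ.freeVars
  | box φ => φ.freeVars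
  | dia φ => φ.freeVars
  | all x φ => φ.freeVars \ {x}
  | ex x φ => φ.freeVars \ {x}

/-- The set of constants occurring in a formula. -/
def consts : Formula σ → Set σ.Const
  | rel _ ts => {c | ∃ i, ts i = .const c}
  | eq s t => {c | s = .const c ∨ t = .const c}
  | bot => ∅
  | conj φ ψ => φ.consts ∪ ψ.consts
  | disj φ ψ => φ.consts ∪ ψ.consts
  | imp φ ψ => φ.consts ∪ ψ.consts
  | box φ => φ.consts
  | dia φ => φ.consts
  | all _ φ => φ.consts
  | ex _ φ => φ.consts

/-- `φ.subst x c` is `φ(c)`: every free occurrence of `x` is replaced by the constant `c`. -/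
def subst (x : ℕ) (c : σ.Const) : Formula σ → Formula σ
  | rel P ts => rel P (fun i => (ts i).subst x c)
  | eq s t => eq (s.subst x c) (t.subst x c)
  | bot => bot
  | conj φ ψ => conj (φ.subst x c) (ψ.subst x c)
  | disj φ ψ => disj (φ.subst x c) (ψ.subst x c)
  | imp φ ψ => imp (φ.subst x c) (ψ.subst x c)
  | box φ => box (φ.subst x c)
  | dia φ => dia (φ.subst x c)
  | all y φ => all y (if y = x then φ else φ.subst x c)
  | ex y φ => ex y (if y = x then φ else φ.subst x c)

/-- No occurrence of a modal operator. -/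
def ModalFree : Formula σ → Prop
  | rel _ _ => True
  | eq _ _ => True
  | bot => True
  | conj φ ψ => φ.ModalFree ∧ ψ.ModalFree
  | disj φ ψ => φ.ModalFree ∧ ψ.ModalFree
  | imp φ ψ => φ.ModalFree ∧ ψ.ModalFree
  | box _ => False
  | dia _ => False
  | all _ φ => φ.ModalFree
  | ex _ φ => φ.ModalFree

def IsSentence (φ : Formula σ) : Prop := φ.freeVars = ∅

/-- `φ` is a formula `φ(x)` in which no variable other than `x` is free. -/
def IsOnePlace (x : ℕ) (φ : Formula σ) : Prop := φ.freeVars ⊆ {x}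

/-- Finite conjunctions; the empty one is `⊤`. -/
def bigConj : List (Formula σ) → Formula σ
  | [] => top
  | φ :: l => conj φ (bigConj l)

end Formula

/-- Formulas of intuitionistic propositional logic. -/
inductive PropForm : Type
  | atom (n : ℕ) : PropForm
  | bot : PropForm
  | conj (p q : PropForm) : PropForm
  | disj (p q : PropForm) : PropForm
  | imp (p q : PropForm) : PropForm

/-- Theorems of the intuitionistic propositional calculus. -/
inductive IPC : PropForm → Prop
  | k (p q) : IPC (.imp p (.imp q p))
  | s (p q r) : IPC (.imp (.imp p (.imp q r)) (.imp (.imp p q) (.imp p r)))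
  | conj_left (p q) : IPC (.imp (.conj p q) p)
  | conj_right (p q) : IPC (.imp (.conj p q) q)
  | conj_intro (p q) : IPC (.imp p (.imp q (.conj p q)))
  | disj_left (p q) : IPC (.imp p (.disj p q))
  | disj_right (p q) : IPC (.imp q (.disj p q))
  | disj_elim (p q r) : IPC (.imp (.imp p r) (.imp (.imp q r) (.imp (.disj p q) r)))
  | exfalso (p) : IPC (.imp .bot p)
  | mp {p q} : IPC (.imp p q) → IPC p → IPC q

/-- Substitution of first-order formulas for the propositional variables. -/
def PropForm.inst {σ : Signature.{u}} (s : ℕ → Formula σ) : PropForm → Formula σ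
  | .atom n => s n
  | .bot => .bot
  | .conj p q => .conj (p.inst s) (q.inst s)
  | .disj p q => .disj (p.inst s) (q.inst s)
  | .imp p q => .imp (p.inst s) (q.inst s)

open Formula in
/-- `Thm A φ`: `φ` is a theorem of the logic obtained from the basic first-order Fischer Servi
system by adding the sentences in `A` as axioms. -/
inductive Thm {σ : Signature.{u}} (A : Set (Formula σ)) : Formula σ → Prop
  | extra {φ : Formula σ} : φ ∈ A → Thm A φ
  | int {p : PropForm} (s : ℕ → Formula σ) : (∀ n, (s n).IsSentence) → IPC p → Thm A (p.inst s)
  | box_conj {φ ψ : Formula σ} : φ.IsSentence → ψ.IsSentence →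
      Thm A (iff (box (conj φ ψ)) (conj (box φ) (box ψ)))
  | box_top : Thm A (box top)
  | dia_disj {φ ψ : Formula σ} : φ.IsSentence → ψ.IsSentence →
      Thm A (iff (dia (disj φ ψ)) (disj (dia φ) (dia ψ)))
  | dia_bot : Thm A (neg (dia bot))
  | fs1 {φ ψ : Formula σ} : φ.IsSentence → ψ.IsSentence →
      Thm A (imp (imp (dia φ) (box ψ)) (box (imp φ ψ)))
  | fs2 {φ ψ : Formula σ} : φ.IsSentence → ψ.IsSentence →
      Thm A (imp (dia (imp φ ψ)) (imp (box φ) (dia ψ)))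
  | univ {x} {φ : Formula σ} (c : σ.Const) : φ.IsOnePlace x → Thm A (imp (all x φ) (φ.subst x c))
  | exist {x} {φ : Formula σ} (c : σ.Const) : φ.IsOnePlace x → Thm A (imp (φ.subst x c) (ex x φ))
  | all_ant {x} {φ ψ : Formula σ} : φ.IsOnePlace x → ψ.IsSentence →
      Thm A (imp (all x (imp φ ψ)) (imp (ex x φ) ψ))
  | all_con {x} {φ ψ : Formula σ} : φ.IsSentence → ψ.IsOnePlace x →
      Thm A (imp (all x (imp φ ψ)) (imp φ (all x ψ)))
  | id_refl (c : σ.Const) : Thm A (eq (.const c) (.const c))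
  | id_sub {x} {φ : Formula σ} (c₁ c₂ : σ.Const) : φ.IsOnePlace x → φ.ModalFree →
      Thm A (imp (eq (.const c₁) (.const c₂)) (imp (φ.subst x c₁) (φ.subst x c₂)))
  | mp {φ ψ : Formula σ} : Thm A (imp φ ψ) → Thm A φ → Thm A ψ
  | gen {x} {φ : Formula σ} (c : σ.Const) : φ.IsOnePlace x → c ∉ φ.consts → Thm A (φ.subst x c) →
      Thm A (all x φ)
  | reg_box {φ ψ : Formula σ} : Thm A (imp φ ψ) → Thm A (imp (box φ) (box ψ))
  | reg_dia {φ ψ : Formula σ} : Thm A (imp φ ψ) → Thm A (imp (dia φ) (dia ψ))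

/-- `Γ ⊢ φ`: for some finite list `γ₁, …, γₙ` from `Γ`, `γ₁ ∧ … ∧ γₙ → φ` is a theorem. -/
def Derives {σ : Signature.{u}} (A Γ : Set (Formula σ)) (φ : Formula σ) : Prop :=
  ∃ l : List (Formula σ), (∀ γ ∈ l, γ ∈ Γ) ∧ Thm A (.imp (.bigConj l) φ)

section Schemes

variable (σ : Signature.{u})

def axD : Set (Formula σ) := {χ | ∃ φ : Formula σ, φ.IsSentence ∧ χ = .imp (.box φ) (.dia φ)}

def axTBox : Set (Formula σ) := {χ | ∃ φ : Formula σ, φ.IsSentence ∧ χ = .imp (.box φ) φ}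

def axTDia : Set (Formula σ) := {χ | ∃ φ : Formula σ, φ.IsSentence ∧ χ = .imp φ (.dia φ)}

def ax4Box : Set (Formula σ) :=
  {χ | ∃ φ : Formula σ, φ.IsSentence ∧ χ = .imp (.box φ) (.box (.box φ))}

def ax4Dia : Set (Formula σ) :=
  {χ | ∃ φ : Formula σ, φ.IsSentence ∧ χ = .imp (.dia (.dia φ)) (.dia φ)}

/-- Necessity of identity. -/
def axNI : Set (Formula σ) :=
  {χ | ∃ c₁ c₂ : σ.Const,
    χ = .imp (.eq (.const c₁) (.const c₂)) (.box (.eq (.const c₁) (.const c₂)))}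

/-- Necessity of distinctness. -/
def axND : Set (Formula σ) :=
  {χ | ∃ c₁ c₂ : σ.Const,
    χ = .imp (.dia (.eq (.const c₁) (.const c₂))) (.eq (.const c₁) (.const c₂))}

end Schemes

/-- Names for the six logics. -/
inductive Logic : Type
  | FOFS | FOFSD | FOFS4 | FOFSD4 | FOFST | FOFSS4

/-- The modal axioms each of the six logics adds to the basic system. -/
def Logic.axioms (σ : Signature.{u}) : Logic → Set (Formula σ)
  | .FOFS => ∅
  | .FOFSD => axD σ
  | .FOFS4 => ax4Box σ ∪ ax4Dia σ
  | .FOFSD4 => axD σ ∪ ax4Box σ ∪ ax4Dia σ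
  | .FOFST => axTBox σ ∪ axTDia σ
  | .FOFSS4 => axTBox σ ∪ axTDia σ ∪ ax4Box σ ∪ ax4Dia σ

/-- A Fischer Servi frame with a domain system. All domains are subsets of an ambient type `D`,
and `eqv w` is an equivalence relation on the subset `dom w`. -/
structure Frame where
  W : Type v
  D : Type w
  /-- the intuitionistic relation -/
  le : W → W → Prop
  /-- the modal relation -/
  M : W → W → Prop
  le_refl : ∀ a, le a a
  le_trans : ∀ a b c, le a b → le b c → le a c
  le_antisymm : ∀ a b, le a b → le b a → a = b
  fc1 : ∀ a b b', M a b → le b b' → ∃ a', le a a' ∧ M a' b'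
  fc2 : ∀ a a' b, le a a' → M a b → ∃ b', le b b' ∧ M a' b'
  dom : W → Set D
  dom_le : ∀ a b, le a b → dom a ⊆ dom b
  dom_M : ∀ a b, M a b → dom a ⊆ dom b
  eqv : W → D → D → Prop
  eqv_dom : ∀ a d e, eqv a d e → d ∈ dom a ∧ e ∈ dom a
  eqv_refl : ∀ a, ∀ d ∈ dom a, eqv a d d
  eqv_symm : ∀ a d e, eqv a d e → eqv a e d
  eqv_trans : ∀ a d e f, eqv a d e → eqv a e f → eqv a d f
  eqv_le : ∀ a b d e, le a b → eqv a d e → eqv b d e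

/-- An interpretation of the signature on a frame. -/
structure Interp (σ : Signature.{u}) (F : Frame.{v, w}) where
  const : σ.Const → F.D
  const_mem : ∀ c a, const c ∈ F.dom a
  pred : F.W → (P : σ.Pred) → Set (Fin (σ.arity P) → F.D)
  pred_dom : ∀ a P, ∀ d ∈ pred a P, ∀ i, d i ∈ F.dom a
  pred_le : ∀ a b P, F.le a b → pred a P ⊆ pred b P
  pred_eqv : ∀ a P d e, (∀ i, F.eqv a (d i) (e i)) → d ∈ pred a P → e ∈ pred a P

section Semantics

variable {σ : Signature.{u}} {F : Frame.{v, w}}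

/-- The denotation of a term under the assignment `g`. -/
def Interp.deno (I : Interp σ F) (g : ℕ → F.D) : Term σ → F.D
  | .var x => g x
  | .const c => I.const c

/-- Truth of a formula at the world `a` under the assignment `g`. -/
def Interp.Sat (I : Interp σ F) : F.W → (ℕ → F.D) → Formula σ → Prop
  | a, g, .rel P ts => (fun i => I.deno g (ts i)) ∈ I.pred a P
  | a, g, .eq s t => F.eqv a (I.deno g s) (I.deno g t)
  | _, _, .bot => False
  | a, g, .conj φ ψ => I.Sat a g φ ∧ I.Sat a g ψ
  | a, g, .disj φ ψ => I.Sat a g φ ∨ I.Sat a g ψ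
  | a, g, .imp φ ψ => ∀ b, F.le a b → I.Sat b g φ → I.Sat b g ψ
  | a, g, .box φ => ∀ b c, F.le a b → F.M b c → I.Sat c g φ
  | a, g, .dia φ => ∃ b, F.M a b ∧ I.Sat b g φ
  | a, g, .all x φ => ∀ b, F.le a b → ∀ d ∈ F.dom b, I.Sat b (Function.update g x d) φ
  | a, g, .ex x φ => ∃ d ∈ F.dom a, I.Sat a (Function.update g x d) φ

/-- Truth at a world: truth under all assignments of elements of the domain of that world. -/
def Interp.TrueAt (I : Interp σ F) (a : F.W) (φ : Formula σ) : Prop :=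
  ∀ g : ℕ → F.D, (∀ x, g x ∈ F.dom a) → I.Sat a g φ

end Semantics

/-- `φ` is a consequence of `Γ` over the class `C` of frames: at every world of every model on a
frame in `C`, if all of `Γ` is true then so is `φ`. -/
def Consequence {σ : Signature.{u}} (C : Set Frame.{v, w}) (Γ : Set (Formula σ))
    (φ : Formula σ) : Prop :=
  ∀ F ∈ C, ∀ (I : Interp σ F) (a : F.W), (∀ γ ∈ Γ, I.TrueAt a γ) → I.TrueAt a φ

/-- (Strong) soundness of the system with extra axioms `A` for the class `C` of frames. -/
def IsSound {σ : Signature.{u}} (A : Set (Formula σ)) (C : Set Frame.{v, w}) : Prop :=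
  ∀ (Γ : Set (Formula σ)) (φ : Formula σ), (∀ γ ∈ Γ, γ.IsSentence) → φ.IsSentence →
    Derives A Γ φ → Consequence C Γ φ

/-- (Strong) completeness of the system with extra axioms `A` for the class `C` of frames. -/
def IsComplete {σ : Signature.{u}} (A : Set (Formula σ)) (C : Set Frame.{v, w}) : Prop :=
  ∀ (Γ : Set (Formula σ)) (φ : Formula σ), (∀ γ ∈ Γ, γ.IsSentence) → φ.IsSentence →
    Consequence C Γ φ → Derives A Γ φ

/-- The frame condition on the modal relation belonging to each of the six logics. -/
def Logic.frames : Logic → Set Frame.{v, w}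
  | .FOFS => Set.univ
  | .FOFSD => {F | ∀ a, ∃ b, F.M a b}
  | .FOFS4 => {F | ∀ a b c, F.M a b → F.M b c → F.M a c}
  | .FOFSD4 => {F | (∀ a, ∃ b, F.M a b) ∧ ∀ a b c, F.M a b → F.M b c → F.M a c}
  | .FOFST => {F | ∀ a, F.M a a}
  | .FOFSS4 => {F | (∀ a, F.M a a) ∧ ∀ a b c, F.M a b → F.M b c → F.M a c}

/-- Frames in which identity is preserved along the modal relation. -/
def idPreserving : Set Frame.{v, w} :=
  {F | ∀ a b, F.M a b → ∀ d e, F.eqv a d e → F.eqv b d e}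

/-- Frames in which identity is reflected along the modal relation, for elements of the domain
of the earlier world. -/
def idReflecting : Set Frame.{v, w} :=
  {F | ∀ a b, F.M a b → ∀ d ∈ F.dom a, ∀ e ∈ F.dom a, F.eqv b d e → F.eqv a d e}

end FischerServi

/-! Soundness is an induction on derivations with one twist. In a model a constant denotes an
element of every domain, whereas the generalization rule needs the constant to range over the domain
of a single world. So formulas are evaluated by `Interp.Holds` under an arbitrary interpretation of
the constants in the domain of the current world, and `valid_of_thm` proves truth for all of these.

Completeness uses a canonical model. If worlds were single saturated theories, (FC1) would be the
obstacle: a successor enlarged by new sentences and new constants would need an enlarged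
predecessor. Here a world is instead a finite chain of saturated theories `th 0, …, th n`, each a
modal successor of the one before. A modal step appends one theory, and the intuitionistic order
compares chains of equal length pointwise. A world thus carries its own predecessors, and (FC1) is
truncation (`World.Step.fc1`).

The price is that all theories of a chain must be enlarged together. The set `Cl` of consequences of
a chain does the bookkeeping: `b` passes from level `i` to level `i + 1` when `□b` is a consequence
at level `i`. A sentence refuted at the top level stays refuted during a Lindenbaum construction on
all levels, because of the behaviour of `Cl` under additions at a lower level: disjunctions can be
split (`cl_add_disj`), existential sentences can be given fresh witnesses (`cl_add_ex`), and `◇φ`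
may be added below `φ` (`cl_add_dia_subset`, from the axiom `fs1`). For (FC2) a new top theory is
built over a fixed chain; constants foreign to the chain are quantified away by `exists_closure`,
and the axiom `fs2` does the rest.

Constants are stratified by levels: the theory at level `i` mentions only constants of level at most
`i`. Hence constants new at a level never clash with those inherited from below, and domains grow
along steps. No extension of the signature is needed: the given constants are renamed into a part of
level `0` which leaves infinitely many unused, and provability is invariant under renaming
(`Thm.map`).

The truth lemma uses the modal relation only through `Admissible`, so single steps may be replaced
by their transitive or reflexive closure when the logic has the matching axioms. Identity in the
canonical frame is membership of `c ≡ d` in the last theory, so NI and ND directly give preservation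
and reflection of identity. -/

namespace FischerServi

/-! ### Substitution, renaming and abstraction of constants -/

open Function

variable {σ : Signature.{u}}

/-- Rename the constants of a term by `f` and substitute `g` for its variables. -/
def Term.bind (f : σ.Const → σ.Const) (g : ℕ → Term σ) : Term σ → Term σ
  | .var x => g x
  | .const c => .const (f c)

/-- Replace the constant `c` by the variable `y`. -/
def Term.abs [DecidableEq σ.Const] (c : σ.Const) (y : ℕ) : Term σ → Term σ
  | .var x => .var x
  | .const d => if d = c then .var y else .const d

namespace Formula

/-- Rename the constants of a formula by `f` and substitute `g` for its free variables. -/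
def bind (f : σ.Const → σ.Const) : (ℕ → Term σ) → Formula σ → Formula σ
  | g, rel P ts => rel P (fun i => (ts i).bind f g)
  | g, eq s t => eq (s.bind f g) (t.bind f g)
  | _, bot => bot
  | g, conj φ ψ => conj (φ.bind f g) (ψ.bind f g)
  | g, disj φ ψ => disj (φ.bind f g) (ψ.bind f g)
  | g, imp φ ψ => imp (φ.bind f g) (ψ.bind f g)
  | g, box φ => box (φ.bind f g)
  | g, dia φ => dia (φ.bind f g)
  | g, all x φ => all x (φ.bind f (update g x (.var x)))
  | g, ex x φ => ex x (φ.bind f (update g x (.var x)))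

/-- Rename the constants of a formula. -/
def map (f : σ.Const → σ.Const) (φ : Formula σ) : Formula σ := φ.bind f .var

/-- Replace the constant `c` by the variable `y`. -/
def abs [DecidableEq σ.Const] (c : σ.Const) (y : ℕ) : Formula σ → Formula σ
  | rel P ts => rel P (fun i => (ts i).abs c y)
  | eq s t => eq (s.abs c y) (t.abs c y)
  | bot => bot
  | conj φ ψ => conj (φ.abs c y) (ψ.abs c y)
  | disj φ ψ => disj (φ.abs c y) (ψ.abs c y)
  | imp φ ψ => imp (φ.abs c y) (ψ.abs c y)
  | box φ => box (φ.abs c y)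
  | dia φ => dia (φ.abs c y)
  | all x φ => all x (φ.abs c y)
  | ex x φ => ex x (φ.abs c y)

/-- The variable `y` occurs neither free nor bound. -/
def NoVar (y : ℕ) : Formula σ → Prop
  | rel _ ts => ∀ i, ts i ≠ .var y
  | eq s t => s ≠ .var y ∧ t ≠ .var y
  | bot => True
  | conj φ ψ => φ.NoVar y ∧ ψ.NoVar y
  | disj φ ψ => φ.NoVar y ∧ ψ.NoVar y
  | imp φ ψ => φ.NoVar y ∧ ψ.NoVar y
  | box φ => φ.NoVar y
  | dia φ => φ.NoVar y
  | all x φ => x ≠ y ∧ φ.NoVar y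
  | ex x φ => x ≠ y ∧ φ.NoVar y

end Formula

/-- A substitution that sends each variable to itself or to a constant. -/
def Safe (g : ℕ → Term σ) : Prop := ∀ x y, g x = .var y → y = x

theorem safe_var : Safe (Term.var : ℕ → Term σ) := fun _ _ h => (Term.var.inj h).symm

theorem safe_const (g : ℕ → σ.Const) : Safe (fun x => Term.const (g x)) := fun _ _ h => by cases h

theorem Safe.update_var {g : ℕ → Term σ} (hg : Safe g) (x : ℕ) : Safe (update g x (.var x)) := by
  intro y z h
  by_cases hy : y = x
  · subst hy
    simpa using h.symm
  · rw [update_of_ne hy] at h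
    exact hg y z h

theorem safe_update_const (x : ℕ) (c : σ.Const) : Safe (update Term.var x (.const c)) := by
  intro y z h
  by_cases hy : y = x
  · subst hy
    simp at h
  · rw [update_of_ne hy] at h
    exact safe_var y z h

/-- A code of a term, given a code of the constants. -/
def Term.code (e : σ.Const → ℕ) : Term σ → ℕ
  | .var x => 2 * x
  | .const c => 2 * e c + 1

theorem Term.code_injective {e : σ.Const → ℕ} (he : Injective e) :
    Injective (Term.code e) := by
  rintro (x | c) (y | d) h <;> simp only [Term.code] at h
  · rw [show x = y by omega]
  · omega
  · omega
  · rw [he (show e c = e d by omega)]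

namespace Formula

theorem bind_congr {f f' : σ.Const → σ.Const} {φ : Formula σ} {g g' : ℕ → Term σ}
    (hf : ∀ c ∈ φ.consts, f c = f' c) (hg : ∀ x ∈ φ.freeVars, g x = g' x) :
    φ.bind f g = φ.bind f' g' := by
  have ht : ∀ t : Term σ, (∀ c, t = .const c → f c = f' c) → (∀ x, t = .var x → g x = g' x) →
      t.bind f g = t.bind f' g' := by
    rintro (x | c) h1 h2
    · exact h2 x rfl
    · exact congrArg _ (h1 c rfl)
  induction φ generalizing g g' with
  | rel P ts =>
    simp only [bind, rel.injEq, heq_eq_eq, true_and]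
    funext i
    exact ht _ (fun c h => hf c ⟨i, h⟩) (fun x h => hg x ⟨i, h⟩)
  | eq s t =>
    simp only [bind, eq.injEq]
    exact ⟨ht _ (fun c h => hf c (.inl h)) (fun x h => hg x (.inl h)),
      ht _ (fun c h => hf c (.inr h)) (fun x h => hg x (.inr h))⟩
  | bot => rfl
  | conj φ ψ ih1 ih2 | disj φ ψ ih1 ih2 | imp φ ψ ih1 ih2 =>
    have h1 := ih1 (fun c h => hf c (.inl h)) (fun x h => hg x (.inl h))
    have h2 := ih2 (fun c h => hf c (.inr h)) (fun x h => hg x (.inr h))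
    simp only [bind]
    rw [h1 (fun t a b => ht t a b), h2 (fun t a b => ht t a b)]
  | box φ ih | dia φ ih =>
    simp only [bind]
    rw [ih hf hg ht]
  | all x φ ih | ex x φ ih =>
    have hg' : ∀ y ∈ φ.freeVars, update g x (.var x) y = update g' x (.var x) y := by
      intro y hy
      by_cases hyx : y = x
      · subst hyx
        simp
      · rw [update_of_ne hyx, update_of_ne hyx]
        exact hg y ⟨hy, hyx⟩
    simp only [bind]
    rw [ih hf hg']
    rintro (z | c) h1 h2
    · exact h2 z rfl
    · exact congrArg _ (h1 c rfl)

/-- A safe inner substitution turns no variable into another one, so the outer substitution can be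
composed with it under a quantifier without capture. -/
theorem bind_bind {f f' : σ.Const → σ.Const} (φ : Formula σ) {g g' : ℕ → Term σ} (hg : Safe g) :
    (φ.bind f g).bind f' g' = φ.bind (f' ∘ f) (fun x => (g x).bind f' g') := by
  have ht : ∀ (g g' : ℕ → Term σ) (t : Term σ),
      (t.bind f g).bind f' g' = t.bind (f' ∘ f) (fun x => (g x).bind f' g') := by
    rintro g g' (x | c) <;> rfl
  have hup : ∀ (g g' : ℕ → Term σ) (x : ℕ), Safe g →
      (fun y => (update g x (.var x) y).bind f' (update g' x (.var x))) =
        update (fun y => (g y).bind f' g') x (.var x) := by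
    intro g g' x hg
    funext y
    by_cases hy : y = x
    · subst hy
      simp [Term.bind]
    · rw [update_of_ne hy, update_of_ne hy]
      cases hz : g y with
      | var z =>
        have := hg y z hz
        subst this
        simp [Term.bind, hy]
      | const c => rfl
  induction φ generalizing g g' with
  | rel P ts => simp only [bind, ht]
  | eq s t => simp only [bind, ht]
  | bot => rfl
  | conj φ ψ ih1 ih2 | disj φ ψ ih1 ih2 | imp φ ψ ih1 ih2 => simp only [bind, ih1 hg, ih2 hg]
  | box φ ih | dia φ ih => simp only [bind, ih hg]
  | all x φ ih | ex x φ ih => simp only [bind, ih (hg.update_var x), hup g g' x hg]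

theorem bind_id (φ : Formula σ) : φ.bind id .var = φ := by
  have ht : ∀ t : Term σ, t.bind id .var = t := by rintro (x | c) <;> rfl
  induction φ with
  | rel P ts => simp only [bind, ht]
  | eq s t => simp only [bind, ht]
  | bot => rfl
  | conj φ ψ ih1 ih2 | disj φ ψ ih1 ih2 | imp φ ψ ih1 ih2 => simp only [bind, ih1, ih2]
  | box φ ih | dia φ ih => simp only [bind, ih]
  | all x φ ih | ex x φ ih => simp only [bind, update_eq_self, ih]

/-- Reduces substitution of a constant to `bind`, so that its interaction with renaming and closing
becomes an instance of `bind_bind`. -/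
theorem subst_eq_bind (x : ℕ) (c : σ.Const) (φ : Formula σ) :
    φ.subst x c = φ.bind id (update .var x (.const c)) := by
  have ht : ∀ t : Term σ, t.subst x c = t.bind id (update .var x (.const c)) := by
    rintro (y | d)
    · by_cases hy : y = x
      · subst hy
        simp [Term.subst, Term.bind]
      · simp [Term.subst, Term.bind, hy]
    · rfl
  have hq : ∀ (y : ℕ) (φ : Formula σ), φ.subst x c = φ.bind id (update .var x (.const c)) →
      (if y = x then φ else φ.subst x c) =
        φ.bind id (update (update .var x (.const c)) y (.var y)) := by
    intro y φ ih
    split_ifs with hy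
    · subst hy
      rw [update_idem, update_eq_self, bind_id]
    · rw [ih, update_comm (Ne.symm hy), update_eq_self]
  induction φ with
  | rel P ts => simp only [subst, bind, ht]
  | eq s t => simp only [subst, bind, ht]
  | bot => rfl
  | conj φ ψ ih1 ih2 | disj φ ψ ih1 ih2 | imp φ ψ ih1 ih2 => simp only [subst, bind, ih1, ih2]
  | box φ ih | dia φ ih => simp only [subst, bind, ih]
  | all y φ ih | ex y φ ih => simp only [subst, bind, hq y φ ih]

theorem mem_freeVars_bind {f : σ.Const → σ.Const} {φ : Formula σ} {g : ℕ → Term σ} (hg : Safe g)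
    {y : ℕ} (hy : y ∈ (φ.bind f g).freeVars) : y ∈ φ.freeVars ∧ g y = .var y := by
  have ht : ∀ (g : ℕ → Term σ), Safe g → ∀ t : Term σ, t.bind f g = .var y →
      t = .var y ∧ g y = .var y := by
    rintro g hg (x | c) h
    · have := hg x y h
      subst this
      exact ⟨rfl, h⟩
    · cases h
  induction φ generalizing g with
  | rel P ts =>
    obtain ⟨i, hi⟩ := hy
    obtain ⟨h1, h2⟩ := ht g hg _ hi
    exact ⟨⟨i, h1⟩, h2⟩
  | eq s t =>
    rcases hy with h | h
    · exact ⟨.inl (ht g hg _ h).1, (ht g hg _ h).2⟩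
    · exact ⟨.inr (ht g hg _ h).1, (ht g hg _ h).2⟩
  | bot => exact hy.elim
  | conj φ ψ ih1 ih2 | disj φ ψ ih1 ih2 | imp φ ψ ih1 ih2 =>
    rcases hy with h | h
    · exact ⟨.inl (ih1 hg h).1, (ih1 hg h).2⟩
    · exact ⟨.inr (ih2 hg h).1, (ih2 hg h).2⟩
  | box φ ih | dia φ ih => exact ih hg hy
  | all x φ ih | ex x φ ih =>
    have h := ih (hg.update_var x) hy.1
    have hne : y ≠ x := hy.2
    rw [update_of_ne hne] at h
    exact ⟨⟨h.1, hne⟩, h.2⟩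

theorem mem_consts_bind {f : σ.Const → σ.Const} {φ : Formula σ} {g : ℕ → Term σ}
    {d : σ.Const} (hd : d ∈ (φ.bind f g).consts) :
    (∃ c ∈ φ.consts, f c = d) ∨ ∃ x ∈ φ.freeVars, g x = .const d := by
  have ht : ∀ (g : ℕ → Term σ) (t : Term σ), t.bind f g = .const d →
      (∃ c, t = .const c ∧ f c = d) ∨ ∃ x, t = .var x ∧ g x = .const d := by
    rintro g (x | c) h
    · exact .inr ⟨x, rfl, h⟩
    · exact .inl ⟨c, rfl, Term.const.inj h⟩
  induction φ generalizing g with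
  | rel P ts =>
    obtain ⟨i, hi⟩ := hd
    rcases ht g _ hi with ⟨c, h1, h2⟩ | ⟨x, h1, h2⟩
    · exact .inl ⟨c, ⟨i, h1⟩, h2⟩
    · exact .inr ⟨x, ⟨i, h1⟩, h2⟩
  | eq s t =>
    rcases hd with h | h
    · rcases ht g _ h with ⟨c, h1, h2⟩ | ⟨x, h1, h2⟩
      · exact .inl ⟨c, .inl h1, h2⟩
      · exact .inr ⟨x, .inl h1, h2⟩
    · rcases ht g _ h with ⟨c, h1, h2⟩ | ⟨x, h1, h2⟩
      · exact .inl ⟨c, .inr h1, h2⟩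
      · exact .inr ⟨x, .inr h1, h2⟩
  | bot => exact hd.elim
  | conj φ ψ ih1 ih2 | disj φ ψ ih1 ih2 | imp φ ψ ih1 ih2 =>
    rcases hd with h | h
    · rcases ih1 h with ⟨c, h1, h2⟩ | ⟨x, h1, h2⟩
      · exact .inl ⟨c, .inl h1, h2⟩
      · exact .inr ⟨x, .inl h1, h2⟩
    · rcases ih2 h with ⟨c, h1, h2⟩ | ⟨x, h1, h2⟩
      · exact .inl ⟨c, .inr h1, h2⟩
      · exact .inr ⟨x, .inr h1, h2⟩
  | box φ ih | dia φ ih => exact ih hd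
  | all y φ ih | ex y φ ih =>
    rcases ih hd with ⟨c, h1, h2⟩ | ⟨x, h1, h2⟩
    · exact .inl ⟨c, h1, h2⟩
    · have hne : x ≠ y := by
        rintro rfl
        simp at h2
      rw [update_of_ne hne] at h2
      exact .inr ⟨x, ⟨h1, hne⟩, h2⟩

theorem mem_consts_subst {φ : Formula σ} {x : ℕ} {c d : σ.Const}
    (hd : d ∈ (φ.subst x c).consts) : d ∈ φ.consts ∨ d = c := by
  rw [subst_eq_bind] at hd
  rcases mem_consts_bind hd with ⟨e, h1, h2⟩ | ⟨y, _, h2⟩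
  · exact .inl (h2 ▸ h1)
  · by_cases hy : y = x
    · subst hy
      rw [update_self] at h2
      exact .inr (Term.const.inj h2).symm
    · rw [update_of_ne hy] at h2
      cases h2

theorem IsOnePlace.subst {φ : Formula σ} {x : ℕ} (h : φ.IsOnePlace x) (c : σ.Const) :
    (φ.subst x c).IsSentence := by
  refine Set.eq_empty_iff_forall_notMem.2 fun y hy => ?_
  rw [subst_eq_bind] at hy
  obtain ⟨h1, h2⟩ := mem_freeVars_bind (safe_update_const x c) hy
  have : y = x := h h1
  subst this
  simp at h2

theorem IsSentence.subst_eq {φ : Formula σ} (h : φ.IsSentence) (x : ℕ) (c : σ.Const) :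
    φ.subst x c = φ := by
  rw [subst_eq_bind]
  conv_rhs => rw [← bind_id φ]
  refine bind_congr (fun _ _ => rfl) fun y hy => ?_
  rw [IsSentence] at h
  rw [h] at hy
  exact hy.elim

theorem isSentence_all {φ : Formula σ} {x : ℕ} : (all x φ).IsSentence ↔ φ.IsOnePlace x :=
  Set.sdiff_eq_empty

theorem isSentence_ex {φ : Formula σ} {x : ℕ} : (ex x φ).IsSentence ↔ φ.IsOnePlace x :=
  Set.sdiff_eq_empty

theorem IsSentence.isOnePlace {φ : Formula σ} (h : φ.IsSentence) (x : ℕ) : φ.IsOnePlace x := by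
  rw [IsSentence] at h
  rw [IsOnePlace, h]
  exact Set.empty_subset _

theorem isSentence_imp {φ ψ : Formula σ} :
    (imp φ ψ).IsSentence ↔ φ.IsSentence ∧ ψ.IsSentence := Set.union_empty_iff

theorem isSentence_conj {φ ψ : Formula σ} :
    (conj φ ψ).IsSentence ↔ φ.IsSentence ∧ ψ.IsSentence := Set.union_empty_iff

theorem isSentence_disj {φ ψ : Formula σ} :
    (disj φ ψ).IsSentence ↔ φ.IsSentence ∧ ψ.IsSentence := Set.union_empty_iff

theorem isSentence_bot : (bot : Formula σ).IsSentence := rfl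

theorem isSentence_top : (top : Formula σ).IsSentence := Set.union_empty_iff.2 ⟨rfl, rfl⟩

theorem finite_consts (φ : Formula σ) : φ.consts.Finite := by
  have ht : ∀ t : Term σ, {c | t = .const c}.Finite := by
    intro t
    refine Set.Subsingleton.finite fun c hc d hd => ?_
    exact Term.const.inj (hc.symm.trans hd)
  induction φ with
  | rel P ts =>
    have : (rel P ts).consts = ⋃ i, {c | ts i = .const c} := by
      ext c
      simp [consts]
    rw [this]
    exact Set.finite_iUnion fun i => ht _
  | eq s t => exact (ht s).union (ht t)
  | bot => exact Set.finite_empty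
  | conj φ ψ ih1 ih2 | disj φ ψ ih1 ih2 | imp φ ψ ih1 ih2 => exact ih1.union ih2
  | box φ ih | dia φ ih | all x φ ih | ex x φ ih => exact ih

theorem exists_const_notMem (φ : Formula σ) : ∃ c, c ∉ φ.consts :=
  have := σ.infinite_const
  φ.finite_consts.exists_notMem

/-- Phrased with a filter because the conditions coming from the finitely many subformulas then
simply intersect. -/
theorem eventually_noVar (φ : Formula σ) : ∀ᶠ y in Filter.atTop, φ.NoVar y := by
  have ht : ∀ t : Term σ, ∀ᶠ y in Filter.atTop, t ≠ .var y := by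
    rintro (x | c)
    · filter_upwards [Filter.eventually_gt_atTop x] with y hy h
      exact hy.ne (Term.var.inj h)
    · exact Filter.Eventually.of_forall fun y h => by cases h
  induction φ with
  | rel P ts => exact Filter.eventually_all.2 fun i => ht _
  | eq s t => exact (ht s).and (ht t)
  | bot => exact Filter.Eventually.of_forall fun _ => trivial
  | conj φ ψ ih1 ih2 | disj φ ψ ih1 ih2 | imp φ ψ ih1 ih2 => exact ih1.and ih2
  | box φ ih | dia φ ih => exact ih
  | all x φ ih | ex x φ ih =>
    exact ((Filter.eventually_gt_atTop x).mono fun y hy => hy.ne).and ih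

section abs

variable [DecidableEq σ.Const]

theorem subst_abs {φ : Formula σ} {c : σ.Const} {y : ℕ} (h : φ.NoVar y) :
    (φ.abs c y).subst y c = φ := by
  have ht : ∀ t : Term σ, t ≠ .var y → (t.abs c y).subst y c = t := by
    rintro (x | d) h
    · have : x ≠ y := fun e => h (e ▸ rfl)
      simp [Term.abs, Term.subst, this]
    · by_cases hd : d = c
      · simp [Term.abs, Term.subst, hd]
      · simp [Term.abs, Term.subst, hd]
  induction φ with
  | rel P ts => simp only [abs, subst, ht _ (h _)]
  | eq s t => simp only [abs, subst, ht _ h.1, ht _ h.2]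
  | bot => rfl
  | conj φ ψ ih1 ih2 | disj φ ψ ih1 ih2 | imp φ ψ ih1 ih2 =>
    simp only [abs, subst, ih1 h.1, ih2 h.2]
  | box φ ih | dia φ ih =>
    simp only [abs, subst]
    rw [ih h]
  | all x φ ih | ex x φ ih => simp only [abs, subst, if_neg h.1, ih h.2]

theorem mem_freeVars_abs {φ : Formula σ} {c : σ.Const} {y x : ℕ} (h : x ∈ (φ.abs c y).freeVars) :
    x ∈ φ.freeVars ∨ x = y := by
  have ht : ∀ t : Term σ, t.abs c y = .var x → t = .var x ∨ x = y := by
    rintro (z | d) h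
    · exact .inl h
    · by_cases hd : d = c
      · rw [Term.abs, if_pos hd] at h
        exact .inr (Term.var.inj h).symm
      · rw [Term.abs, if_neg hd] at h
        cases h
  induction φ with
  | rel P ts =>
    obtain ⟨i, hi⟩ := h
    exact (ht _ hi).imp_left fun h => ⟨i, h⟩
  | eq s t =>
    rcases h with h | h
    · exact (ht _ h).imp_left .inl
    · exact (ht _ h).imp_left .inr
  | bot => exact h.elim
  | conj φ ψ ih1 ih2 | disj φ ψ ih1 ih2 | imp φ ψ ih1 ih2 =>
    rcases h with h | h
    · exact (ih1 h).imp_left .inl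
    · exact (ih2 h).imp_left .inr
  | box φ ih | dia φ ih => exact ih h
  | all z φ ih | ex z φ ih => exact (ih h.1).imp_left fun h' => ⟨h', h.2⟩

theorem mem_consts_abs {φ : Formula σ} {c d : σ.Const} {y : ℕ} (h : d ∈ (φ.abs c y).consts) :
    d ∈ φ.consts ∧ d ≠ c := by
  have ht : ∀ t : Term σ, t.abs c y = .const d → t = .const d ∧ d ≠ c := by
    rintro (z | e) h
    · cases h
    · by_cases he : e = c
      · rw [Term.abs, if_pos he] at h
        cases h
      · rw [Term.abs, if_neg he] at h
        exact ⟨h, Term.const.inj h ▸ he⟩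
  induction φ with
  | rel P ts =>
    obtain ⟨i, hi⟩ := h
    exact ⟨⟨i, (ht _ hi).1⟩, (ht _ hi).2⟩
  | eq s t =>
    rcases h with h | h
    · exact ⟨.inl (ht _ h).1, (ht _ h).2⟩
    · exact ⟨.inr (ht _ h).1, (ht _ h).2⟩
  | bot => exact h.elim
  | conj φ ψ ih1 ih2 | disj φ ψ ih1 ih2 | imp φ ψ ih1 ih2 =>
    rcases h with h | h
    · exact ⟨.inl (ih1 h).1, (ih1 h).2⟩
    · exact ⟨.inr (ih2 h).1, (ih2 h).2⟩
  | box φ ih | dia φ ih | all z φ ih | ex z φ ih => exact ih h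

end abs

/-! ### Countability of the language -/

/-- A code of a formula, given codes of the constants and predicate symbols. -/
def code (e : σ.Const → ℕ) (p : σ.Pred → ℕ) : Formula σ → ℕ
  | rel P ts => Nat.pair 0 (Nat.pair (p P) (Encodable.encode (List.ofFn fun i => (ts i).code e)))
  | eq s t => Nat.pair 1 (Nat.pair (s.code e) (t.code e))
  | bot => Nat.pair 2 0
  | conj φ ψ => Nat.pair 3 (Nat.pair (φ.code e p) (ψ.code e p))
  | disj φ ψ => Nat.pair 4 (Nat.pair (φ.code e p) (ψ.code e p))
  | imp φ ψ => Nat.pair 5 (Nat.pair (φ.code e p) (ψ.code e p))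
  | box φ => Nat.pair 6 (φ.code e p)
  | dia φ => Nat.pair 7 (φ.code e p)
  | all x φ => Nat.pair 8 (Nat.pair x (φ.code e p))
  | ex x φ => Nat.pair 9 (Nat.pair x (φ.code e p))

theorem code_injective {e : σ.Const → ℕ} (he : Injective e) {p : σ.Pred → ℕ} (hp : Injective p) :
    Injective (code e p) := by
  intro φ
  induction φ with
  | rel P ts =>
    rintro (⟨Q, ss⟩ | _ | _ | _ | _ | _ | _ | _ | _ | _) h <;>
      simp only [code, Nat.pair_eq_pair] at h <;> try omega
    obtain ⟨-, h1, h2⟩ := h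
    obtain rfl := hp h1
    have h3 := List.ofFn_injective (Encodable.encode_injective h2)
    congr 1
    funext i
    exact Term.code_injective he (congrFun h3 i)
  | eq s t =>
    rintro (_ | ⟨s', t'⟩ | _ | _ | _ | _ | _ | _ | _ | _) h <;>
      simp only [code, Nat.pair_eq_pair] at h <;> try omega
    rw [Term.code_injective he h.2.1, Term.code_injective he h.2.2]
  | bot =>
    rintro (_ | _ | _ | _ | _ | _ | _ | _ | _ | _) h <;>
      simp only [code, Nat.pair_eq_pair] at h <;> first | rfl | omega
  | conj φ ψ ih1 ih2 | disj φ ψ ih1 ih2 | imp φ ψ ih1 ih2 =>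
    rintro (_ | _ | _ | _ | _ | _ | _ | _ | _ | _) h <;>
      simp only [code, Nat.pair_eq_pair] at h <;>
      first | omega | rw [ih1 h.2.1, ih2 h.2.2]
  | box φ ih | dia φ ih =>
    rintro (_ | _ | _ | _ | _ | _ | _ | _ | _ | _) h <;>
      simp only [code, Nat.pair_eq_pair] at h <;>
      first | omega | rw [ih h.2]
  | all x φ ih | ex x φ ih =>
    rintro (_ | _ | _ | _ | _ | _ | _ | _ | _ | _) h <;>
      simp only [code, Nat.pair_eq_pair] at h <;>
      first | omega | rw [h.2.1, ih h.2.2]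

instance : Countable (Formula σ) := by
  have := σ.countable_const
  have := σ.countable_pred
  obtain ⟨e, he⟩ := exists_injective_nat σ.Const
  obtain ⟨p, hp⟩ := exists_injective_nat σ.Pred
  exact (code_injective he hp).countable

end Formula

/-! ### Sentences and intuitionistic derivations -/

/-- Sentences. -/
abbrev Sent (σ : Signature.{u}) : Type u := {φ : Formula σ // φ.IsSentence}

namespace Sent

def bot : Sent σ := ⟨.bot, Formula.isSentence_bot⟩

def top : Sent σ := ⟨.top, Formula.isSentence_top⟩

def conj (φ ψ : Sent σ) : Sent σ := ⟨.conj φ ψ, Formula.isSentence_conj.2 ⟨φ.2, ψ.2⟩⟩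

def disj (φ ψ : Sent σ) : Sent σ := ⟨.disj φ ψ, Formula.isSentence_disj.2 ⟨φ.2, ψ.2⟩⟩

def imp (φ ψ : Sent σ) : Sent σ := ⟨.imp φ ψ, Formula.isSentence_imp.2 ⟨φ.2, ψ.2⟩⟩

def box (φ : Sent σ) : Sent σ := ⟨.box φ, φ.2⟩

def dia (φ : Sent σ) : Sent σ := ⟨.dia φ, φ.2⟩

/-- The constants of a sentence. -/
def consts (φ : Sent σ) : Set σ.Const := φ.1.consts

end Sent

section IPC

variable {A : Set (Formula σ)} (φ ψ χ : Sent σ)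

/-- The valuation sending the first three propositional variables to three given sentences. -/
def triple : ℕ → Formula σ
  | 0 => φ
  | 1 => ψ
  | _ => χ

theorem isSentence_triple : ∀ n, (triple φ ψ χ n).IsSentence
  | 0 => φ.2
  | 1 => ψ.2
  | _ + 2 => χ.2

theorem thm_k : Thm A (φ.imp (ψ.imp φ)).1 :=
  .int (triple φ ψ ψ) (isSentence_triple _ _ _) (.k (.atom 0) (.atom 1))

theorem thm_s : Thm A (((φ.imp (ψ.imp χ)).imp ((φ.imp ψ).imp (φ.imp χ)))).1 :=
  .int (triple φ ψ χ) (isSentence_triple _ _ _) (.s (.atom 0) (.atom 1) (.atom 2))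

theorem thm_conj_left : Thm A ((φ.conj ψ).imp φ).1 :=
  .int (triple φ ψ ψ) (isSentence_triple _ _ _) (.conj_left (.atom 0) (.atom 1))

theorem thm_conj_right : Thm A ((φ.conj ψ).imp ψ).1 :=
  .int (triple φ ψ ψ) (isSentence_triple _ _ _) (.conj_right (.atom 0) (.atom 1))

theorem thm_conj_intro : Thm A (φ.imp (ψ.imp (φ.conj ψ))).1 :=
  .int (triple φ ψ ψ) (isSentence_triple _ _ _) (.conj_intro (.atom 0) (.atom 1))

theorem thm_disj_left : Thm A (φ.imp (φ.disj ψ)).1 :=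
  .int (triple φ ψ ψ) (isSentence_triple _ _ _) (.disj_left (.atom 0) (.atom 1))

theorem thm_disj_right : Thm A (ψ.imp (φ.disj ψ)).1 :=
  .int (triple φ ψ ψ) (isSentence_triple _ _ _) (.disj_right (.atom 0) (.atom 1))

theorem thm_disj_elim :
    Thm A ((φ.imp χ).imp ((ψ.imp χ).imp ((φ.disj ψ).imp χ))).1 :=
  .int (triple φ ψ χ) (isSentence_triple _ _ _) (.disj_elim (.atom 0) (.atom 1) (.atom 2))

theorem thm_exfalso : Thm A (Sent.bot.imp φ).1 :=
  .int (triple φ φ φ) (isSentence_triple _ _ _) (.exfalso (.atom 0))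

end IPC

section Entailment

/-- `φ → ψ` is a theorem. -/
def Ent (A : Set (Formula σ)) (φ ψ : Sent σ) : Prop := Thm A (φ.imp ψ).1

variable {A : Set (Formula σ)} {φ ψ χ : Sent σ}

theorem thm_const (h : Thm A ψ.1) : Ent A φ ψ := (thm_k ψ φ).mp h

theorem Ent.mp₂ (h₁ : Ent A φ (ψ.imp χ)) (h₂ : Ent A φ ψ) : Ent A φ χ :=
  ((thm_s φ ψ χ).mp h₁).mp h₂

theorem Ent.refl (φ : Sent σ) : Ent A φ φ :=
  Ent.mp₂ (ψ := φ.imp φ) (thm_k φ (φ.imp φ)) (thm_k φ φ)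

theorem Ent.trans (h₁ : Ent A φ ψ) (h₂ : Ent A ψ χ) : Ent A φ χ :=
  Ent.mp₂ (ψ := ψ) (thm_const h₂) h₁

theorem Ent.conj (h₁ : Ent A φ ψ) (h₂ : Ent A φ χ) : Ent A φ (ψ.conj χ) :=
  Ent.mp₂ (ψ := χ) (Ent.trans h₁ (thm_conj_intro ψ χ)) h₂

theorem Ent.disj (h₁ : Ent A φ χ) (h₂ : Ent A ψ χ) : Ent A (φ.disj ψ) χ :=
  ((thm_disj_elim φ ψ χ).mp h₁).mp h₂

theorem ent_imp_iff : Ent A φ (ψ.imp χ) ↔ Ent A (φ.conj ψ) χ := by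
  constructor
  · intro h
    exact Ent.mp₂ (Ent.trans (thm_conj_left φ ψ) h) (thm_conj_right φ ψ)
  · intro h
    exact Ent.mp₂ (ψ := ψ.imp (φ.conj ψ))
      (thm_const ((thm_s ψ (φ.conj ψ) χ).mp ((thm_k _ ψ).mp h))) (thm_conj_intro φ ψ)

theorem ent_top_iff : Ent A .top φ ↔ Thm A φ.1 :=
  ⟨fun h => Thm.mp h (Ent.refl Sent.bot), thm_const⟩

theorem Ent.box (h : Ent A φ ψ) : Ent A φ.box ψ.box := Thm.reg_box h

theorem Ent.dia (h : Ent A φ ψ) : Ent A φ.dia ψ.dia := Thm.reg_dia h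

end Entailment

/-! ### The Lindenbaum algebra -/

/-- Provable equivalence. -/
def provEquiv (A : Set (Formula σ)) : Setoid (Sent σ) where
  r φ ψ := Ent A φ ψ ∧ Ent A ψ φ
  iseqv := ⟨fun φ => ⟨.refl φ, .refl φ⟩, fun h => ⟨h.2, h.1⟩,
    fun h h' => ⟨h.1.trans h'.1, h'.2.trans h.2⟩⟩

/-- The Lindenbaum algebra of a logic. -/
def Lind (A : Set (Formula σ)) : Type u := Quotient (provEquiv A)

/-- The class of a sentence in the Lindenbaum algebra. -/
def cls (A : Set (Formula σ)) (φ : Sent σ) : Lind A := Quotient.mk (provEquiv A) φ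

section Lind

variable {A : Set (Formula σ)}

/-- From here on propositional derivations become inequalities in a Heyting algebra. -/
instance : HeytingAlgebra (Lind A) where
  le := Quotient.lift₂ (Ent A) fun _ _ _ _ h h' =>
    propext ⟨fun k => (h.2.trans k).trans h'.1, fun k => (h.1.trans k).trans h'.2⟩
  le_refl := by
    rintro ⟨φ⟩
    exact Ent.refl φ
  le_trans := by
    rintro ⟨φ⟩ ⟨ψ⟩ ⟨χ⟩ h h'
    exact Ent.trans h h'
  le_antisymm := by
    rintro ⟨φ⟩ ⟨ψ⟩ h h'
    exact Quotient.sound ⟨h, h'⟩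
  sup := Quotient.map₂ Sent.disj fun _ _ h _ _ h' =>
    ⟨.disj (h.1.trans (thm_disj_left _ _)) (h'.1.trans (thm_disj_right _ _)),
      .disj (h.2.trans (thm_disj_left _ _)) (h'.2.trans (thm_disj_right _ _))⟩
  le_sup_left := by
    rintro ⟨φ⟩ ⟨ψ⟩
    exact thm_disj_left φ ψ
  le_sup_right := by
    rintro ⟨φ⟩ ⟨ψ⟩
    exact thm_disj_right φ ψ
  sup_le := by
    rintro ⟨φ⟩ ⟨ψ⟩ ⟨χ⟩ h h'
    exact Ent.disj h h'
  inf := Quotient.map₂ Sent.conj fun _ _ h _ _ h' =>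
    ⟨.conj (Ent.trans (thm_conj_left _ _) h.1) (Ent.trans (thm_conj_right _ _) h'.1),
      .conj (Ent.trans (thm_conj_left _ _) h.2) (Ent.trans (thm_conj_right _ _) h'.2)⟩
  inf_le_left := by
    rintro ⟨φ⟩ ⟨ψ⟩
    exact thm_conj_left φ ψ
  inf_le_right := by
    rintro ⟨φ⟩ ⟨ψ⟩
    exact thm_conj_right φ ψ
  le_inf := by
    rintro ⟨φ⟩ ⟨ψ⟩ ⟨χ⟩ h h'
    exact Ent.conj h h'
  top := cls A .top
  le_top := by
    rintro ⟨φ⟩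
    exact thm_const (Ent.refl Sent.bot)
  himp := Quotient.map₂ Sent.imp fun φ φ' h ψ ψ' h' =>
    ⟨ent_imp_iff.2 (Ent.trans (Ent.mp₂ (thm_conj_left _ _) (Ent.trans (thm_conj_right _ _) h.2))
        h'.1),
      ent_imp_iff.2 (Ent.trans (Ent.mp₂ (thm_conj_left _ _) (Ent.trans (thm_conj_right _ _) h.1))
        h'.2)⟩
  le_himp_iff := by
    rintro ⟨φ⟩ ⟨ψ⟩ ⟨χ⟩
    exact ent_imp_iff
  bot := cls A .bot
  bot_le := by
    rintro ⟨φ⟩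
    exact thm_exfalso φ
  compl := Quotient.map (fun φ => Sent.imp φ .bot) fun φ φ' h =>
    ⟨ent_imp_iff.2 (Ent.mp₂ (thm_conj_left _ _) (Ent.trans (thm_conj_right _ _) h.2)),
      ent_imp_iff.2 (Ent.mp₂ (thm_conj_left _ _) (Ent.trans (thm_conj_right _ _) h.1))⟩
  himp_bot := by
    rintro ⟨φ⟩
    rfl

theorem cls_le {φ ψ : Sent σ} : cls A φ ≤ cls A ψ ↔ Ent A φ ψ := Iff.rfl

theorem cls_conj (φ ψ : Sent σ) : cls A (φ.conj ψ) = cls A φ ⊓ cls A ψ := rfl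

theorem cls_disj (φ ψ : Sent σ) : cls A (φ.disj ψ) = cls A φ ⊔ cls A ψ := rfl

theorem cls_imp (φ ψ : Sent σ) : cls A (φ.imp ψ) = (cls A φ ⇨ cls A ψ) := rfl

theorem cls_top : cls A .top = ⊤ := rfl

theorem cls_eq_top {φ : Sent σ} : cls A φ = ⊤ ↔ Thm A φ.1 := by
  rw [← top_le_iff, ← cls_top, cls_le, ent_top_iff]

theorem cls_box_mono {φ ψ : Sent σ} (h : cls A φ ≤ cls A ψ) : cls A φ.box ≤ cls A ψ.box :=
  Ent.box h

theorem cls_dia_mono {φ ψ : Sent σ} (h : cls A φ ≤ cls A ψ) : cls A φ.dia ≤ cls A ψ.dia :=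
  Ent.dia h

theorem le_cls_box_conj (φ ψ : Sent σ) : cls A φ.box ⊓ cls A ψ.box ≤ cls A (φ.conj ψ).box :=
  Thm.mp (thm_conj_right ((φ.conj ψ).box.imp (φ.box.conj ψ.box))
    ((φ.box.conj ψ.box).imp (φ.conj ψ).box)) (.box_conj φ.2 ψ.2)

theorem cls_box_top : cls A Sent.top.box = ⊤ := cls_eq_top.2 .box_top

theorem cls_dia_disj_le (φ ψ : Sent σ) : cls A (φ.disj ψ).dia ≤ cls A φ.dia ⊔ cls A ψ.dia :=
  Thm.mp (thm_conj_left ((φ.disj ψ).dia.imp (φ.dia.disj ψ.dia))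
    ((φ.dia.disj ψ.dia).imp (φ.disj ψ).dia)) (.dia_disj φ.2 ψ.2)

theorem cls_dia_bot : cls A Sent.bot.dia = ⊥ :=
  le_bot_iff.1 (show Ent A Sent.bot.dia .bot from Thm.dia_bot)

theorem cls_dia_himp_box_le (φ ψ : Sent σ) :
    cls A φ.dia ⇨ cls A ψ.box ≤ cls A (φ.imp ψ).box :=
  Thm.fs1 φ.2 ψ.2

/-- Currying gives `ψ ≤ φ → χ`; apply monotonicity of `◇` and then the axiom `fs2`. -/
theorem cls_box_inf_dia_le {φ ψ χ : Sent σ} (h : cls A φ ⊓ cls A ψ ≤ cls A χ) :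
    cls A φ.box ⊓ cls A ψ.dia ≤ cls A χ.dia := by
  have h1 : cls A ψ ≤ cls A (φ.imp χ) := by
    rw [cls_imp, le_himp_iff, inf_comm]
    exact h
  have h2 : cls A (φ.imp χ).dia ≤ cls A φ.box ⇨ cls A χ.dia := Thm.fs2 φ.2 χ.2
  rw [inf_comm, ← le_himp_iff]
  exact (cls_dia_mono h1).trans h2

section Quantifiers

variable {x : ℕ} {φ : Formula σ}

theorem cls_all_le (h : φ.IsOnePlace x) (c : σ.Const) :
    cls A ⟨.all x φ, Formula.isSentence_all.2 h⟩ ≤ cls A ⟨φ.subst x c, h.subst c⟩ :=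
  Thm.univ c h

theorem cls_le_ex (h : φ.IsOnePlace x) (c : σ.Const) :
    cls A ⟨φ.subst x c, h.subst c⟩ ≤ cls A ⟨.ex x φ, Formula.isSentence_ex.2 h⟩ :=
  Thm.exist c h

theorem le_cls_all (h : φ.IsOnePlace x) {c : σ.Const} {ψ : Sent σ} (hφ : c ∉ φ.consts)
    (hψ : c ∉ ψ.consts) (hle : cls A ψ ≤ cls A ⟨φ.subst x c, h.subst c⟩) :
    cls A ψ ≤ cls A ⟨.all x φ, Formula.isSentence_all.2 h⟩ := by
  refine Thm.mp (Thm.all_con ψ.2 h) (Thm.gen c ?_ ?_ ?_)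
  · exact Set.union_subset (ψ.2.isOnePlace x) h
  · rintro (h | h)
    exacts [hψ h, hφ h]
  · have : (Formula.imp ψ.1 φ).subst x c = .imp ψ.1 (φ.subst x c) := by
      rw [Formula.subst, ψ.2.subst_eq]
    rw [this]
    exact hle

theorem cls_ex_le (h : φ.IsOnePlace x) {c : σ.Const} {ψ : Sent σ} (hφ : c ∉ φ.consts)
    (hψ : c ∉ ψ.consts) (hle : cls A ⟨φ.subst x c, h.subst c⟩ ≤ cls A ψ) :
    cls A ⟨.ex x φ, Formula.isSentence_ex.2 h⟩ ≤ cls A ψ := by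
  refine Thm.mp (Thm.all_ant h ψ.2) (Thm.gen c ?_ ?_ ?_)
  · exact Set.union_subset h (ψ.2.isOnePlace x)
  · rintro (h | h)
    exacts [hφ h, hψ h]
  · have : (Formula.imp φ ψ.1).subst x c = .imp (φ.subst x c) ψ.1 := by
      rw [Formula.subst, ψ.2.subst_eq]
    rw [this]
    exact hle

end Quantifiers

/-- Existential closure of a sentence over one constant: the strongest consequence in which the
constant does not occur. -/
theorem exists_closure_one (b : Sent σ) (e : σ.Const) : ∃ b' : Sent σ, b'.consts ⊆ b.consts \ {e} ∧
    cls A b ≤ cls A b' ∧ ∀ θ : Sent σ, e ∉ θ.consts → cls A b ≤ cls A θ → cls A b' ≤ cls A θ := by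
  classical
  -- With `y` absent from `b`, even as a bound variable, putting `e` back for `y` recovers `b`
  -- exactly. The closure is `∃y b(y)`.
  obtain ⟨y, hy⟩ := b.1.eventually_noVar.exists
  have h : (b.1.abs e y).IsOnePlace y := by
    intro x hx
    rcases Formula.mem_freeVars_abs hx with h | h
    · rw [show b.1.freeVars = ∅ from b.2] at h
      exact h.elim
    · exact h
  have hb : (⟨(b.1.abs e y).subst y e, h.subst e⟩ : Sent σ) = b :=
    Subtype.ext (Formula.subst_abs hy)
  refine ⟨⟨.ex y (b.1.abs e y), Formula.isSentence_ex.2 h⟩, fun c hc => Formula.mem_consts_abs hc,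
    ?_, fun θ hθ hle => ?_⟩
  · have := cls_le_ex (A := A) h e
    rwa [hb] at this
  · refine cls_ex_le h (fun he => (Formula.mem_consts_abs he).2 rfl) hθ ?_
    rwa [hb]

/-- Existential closure of a sentence over a finite set of constants. -/
theorem exists_closure (b : Sent σ) {S : Set σ.Const} (hS : S.Finite) :
    ∃ b' : Sent σ, b'.consts ⊆ b.consts \ S ∧ cls A b ≤ cls A b' ∧
      ∀ θ : Sent σ, Disjoint θ.consts S → cls A b ≤ cls A θ → cls A b' ≤ cls A θ := by
  induction S, hS using Set.Finite.induction_on with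
  | empty => exact ⟨b, by simp, le_rfl, fun θ _ h => h⟩
  | @insert e S _ _ ih =>
    obtain ⟨b₁, h1, h2, h3⟩ := ih
    obtain ⟨b₂, k1, k2, k3⟩ := exists_closure_one (A := A) b₁ e
    refine ⟨b₂, fun c hc => ?_, h2.trans k2, fun θ hθ hle => ?_⟩
    · have hc1 := k1 hc
      have hc2 := h1 hc1.1
      exact ⟨hc2.1, fun h => h.elim hc1.2 hc2.2⟩
    · rw [Set.disjoint_insert_right] at hθ
      exact k3 θ hθ.1 (h3 θ hθ.2 hle)

end Lind

/-! ### Consequences of a chain of sets of sentences -/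

/-- `Meet Γ a`: `a` is a finite conjunction of members of `Γ`. -/
inductive Meet (Γ : Set (Sent σ)) : Sent σ → Prop
  | top : Meet Γ .top
  | cons {γ a : Sent σ} : γ ∈ Γ → Meet Γ a → Meet Γ (γ.conj a)

theorem consts_top : (Sent.top : Sent σ).consts = ∅ := Set.union_empty _

section Meet

variable {A : Set (Formula σ)} {Γ Δ : Set (Sent σ)} {a b φ : Sent σ}

theorem Meet.mono (h : Γ ⊆ Δ) (ha : Meet Γ a) : Meet Δ a := by
  induction ha with
  | top => exact .top
  | cons hγ _ ih => exact .cons (h hγ) ih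

theorem Meet.inf (A : Set (Formula σ)) (ha : Meet Γ a) (hb : Meet Γ b) :
    ∃ c, Meet Γ c ∧ cls A c ≤ cls A a ⊓ cls A b := by
  induction ha with
  | top => exact ⟨b, hb, le_inf le_top le_rfl⟩
  | cons hγ _ ih =>
    obtain ⟨c, hc, hle⟩ := ih
    refine ⟨_, .cons hγ hc, ?_⟩
    rw [cls_conj, cls_conj, inf_assoc]
    exact inf_le_inf_left _ hle

theorem Meet.of_insert (A : Set (Formula σ)) (ha : Meet (insert φ Γ) a) :
    ∃ c, Meet Γ c ∧ cls A c ⊓ cls A φ ≤ cls A a := by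
  induction ha with
  | top => exact ⟨_, .top, le_top⟩
  | @cons γ a hγ _ ih =>
    obtain ⟨c, hc, hle⟩ := ih
    rcases hγ with rfl | hγ
    · exact ⟨c, hc, le_inf inf_le_right hle⟩
    · refine ⟨_, .cons hγ hc, ?_⟩
      rw [cls_conj, cls_conj, inf_assoc]
      exact inf_le_inf_left _ hle

theorem Meet.exists_mem_consts (ha : Meet Γ a) {c : σ.Const} (hc : c ∈ a.consts) :
    ∃ γ ∈ Γ, c ∈ γ.consts := by
  induction ha with
  | top =>
    rw [consts_top] at hc
    exact hc.elim
  | cons hγ _ ih =>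
    rcases hc with h | h
    · exact ⟨_, hγ, h⟩
    · exact ih h

theorem Meet.of_iUnion {Γ : ℕ → Set (Sent σ)} (hΓ : Monotone Γ) (ha : Meet (⋃ s, Γ s) a) :
    ∃ s, Meet (Γ s) a := by
  induction ha with
  | top => exact ⟨0, .top⟩
  | cons hγ _ ih =>
    obtain ⟨s, hs⟩ := ih
    obtain ⟨t, ht⟩ := Set.mem_iUnion.1 hγ
    exact ⟨max s t, .cons (hΓ (le_max_right s t) ht) (hs.mono (hΓ (le_max_left s t)))⟩

end Meet

/-- `Low A lev X i`: the sentences which the worlds below level `i` of the chain `X` force upon the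
world at level `i`. -/
def Low (A : Set (Formula σ)) (lev : σ.Const → ℕ) (X : ℕ → Set (Sent σ)) : ℕ → Set (Sent σ)
  | 0 => {.top}
  | i + 1 => {b | (∀ c ∈ b.consts, lev c ≤ i) ∧
      ∃ a, Meet (X i) a ∧ ∃ b' ∈ Low A lev X i, cls A a ⊓ cls A b' ≤ cls A b.box}

/-- `Cl A lev X i`: the consequences at level `i` of the chain `X` of sets of sentences. -/
def Cl (A : Set (Formula σ)) (lev : σ.Const → ℕ) (X : ℕ → Set (Sent σ)) (i : ℕ) : Set (Sent σ) :=
  {ψ | ∃ a, Meet (X i) a ∧ ∃ b ∈ Low A lev X i, cls A a ⊓ cls A b ≤ cls A ψ}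

/-- Add the sentence `φ` to the chain `X` at level `i`. -/
def add (X : ℕ → Set (Sent σ)) (i : ℕ) (φ : Sent σ) : ℕ → Set (Sent σ) :=
  update X i (insert φ (X i))

section Cl

variable {A : Set (Formula σ)} {lev : σ.Const → ℕ} {X Y : ℕ → Set (Sent σ)} {i j : ℕ}
  {φ ψ χ θ : Sent σ}

theorem add_self : add X i φ i = insert φ (X i) := update_self ..

theorem add_of_ne (h : j ≠ i) : add X i φ j = X j := update_of_ne h ..

theorem subset_add (j : ℕ) : X j ⊆ add X i φ j := by
  by_cases h : j = i
  · subst h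
    rw [add_self]
    exact Set.subset_insert _ _
  · rw [add_of_ne h]

theorem mem_add_self : φ ∈ add X i φ i := by
  rw [add_self]
  exact Set.mem_insert _ _

theorem add_mono (h : ∀ j, X j ⊆ Y j) (j : ℕ) : add X i φ j ⊆ add Y i φ j := by
  by_cases hj : j = i
  · subst hj
    rw [add_self, add_self]
    exact Set.insert_subset_insert (h _)
  · rw [add_of_ne hj, add_of_ne hj]
    exact h j

theorem mem_low_succ {b : Sent σ} :
    b ∈ Low A lev X (i + 1) ↔ (∀ c ∈ b.consts, lev c ≤ i) ∧ b.box ∈ Cl A lev X i := Iff.rfl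

theorem lev_lt_of_mem_low {b : Sent σ} (hb : b ∈ Low A lev X i) {c : σ.Const}
    (hc : c ∈ b.consts) : lev c < i := by
  cases i with
  | zero =>
    rw [show b = .top from hb, consts_top] at hc
    exact hc.elim
  | succ i => exact Nat.lt_succ_of_le (hb.1 c hc)

theorem cl_up (h : φ ∈ Cl A lev X i) (hle : cls A φ ≤ cls A ψ) : ψ ∈ Cl A lev X i := by
  obtain ⟨a, ha, b, hb, h⟩ := h
  exact ⟨a, ha, b, hb, h.trans hle⟩

theorem top_mem_low : Sent.top ∈ Low A lev X i := by
  induction i with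
  | zero => rfl
  | succ i ih =>
    refine ⟨fun c hc => ?_, .top, .top, .top, ih, ?_⟩
    · rw [consts_top] at hc
      exact hc.elim
    · rw [cls_box_top]
      exact le_top

theorem low_inf {b b' : Sent σ} (hb : b ∈ Low A lev X i) (hb' : b' ∈ Low A lev X i) :
    ∃ d ∈ Low A lev X i, cls A d ≤ cls A b ⊓ cls A b' := by
  induction i generalizing b b' with
  | zero => exact ⟨b, hb, le_inf le_rfl (by rw [show b = b' from hb.trans hb'.symm])⟩
  | succ i ih =>
    obtain ⟨hl, a, ha, d, hd, h⟩ := hb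
    obtain ⟨hl', a', ha', d', hd', h'⟩ := hb'
    obtain ⟨e, he, hle⟩ := ih hd hd'
    obtain ⟨f, hf, hle'⟩ := ha.inf A ha'
    refine ⟨b.conj b', ⟨?_, f, hf, e, he, ?_⟩, le_rfl⟩
    · rintro c (hc | hc)
      exacts [hl c hc, hl' c hc]
    · refine le_trans (le_inf ?_ ?_) (le_cls_box_conj b b')
      · exact (inf_le_inf (hle'.trans inf_le_left) (hle.trans inf_le_left)).trans h
      · exact (inf_le_inf (hle'.trans inf_le_right) (hle.trans inf_le_right)).trans h'

theorem cl_conj (h : φ ∈ Cl A lev X i) (h' : ψ ∈ Cl A lev X i) :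
    φ.conj ψ ∈ Cl A lev X i := by
  obtain ⟨a, ha, d, hd, h⟩ := h
  obtain ⟨a', ha', d', hd', h'⟩ := h'
  obtain ⟨e, he, hle⟩ := low_inf hd hd'
  obtain ⟨f, hf, hle'⟩ := ha.inf A ha'
  refine ⟨f, hf, e, he, ?_⟩
  rw [cls_conj]
  refine le_inf ?_ ?_
  · exact (inf_le_inf (hle'.trans inf_le_left) (hle.trans inf_le_left)).trans h
  · exact (inf_le_inf (hle'.trans inf_le_right) (hle.trans inf_le_right)).trans h'

theorem cl_up₂ (h : φ ∈ Cl A lev X i) (h' : ψ ∈ Cl A lev X i)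
    (hle : cls A φ ⊓ cls A ψ ≤ cls A χ) : χ ∈ Cl A lev X i := cl_up (cl_conj h h') hle

theorem cl_low (h : φ ∈ Low A lev X i) : φ ∈ Cl A lev X i := ⟨_, .top, φ, h, inf_le_right⟩

theorem cl_meet (h : Meet (X i) φ) : φ ∈ Cl A lev X i := ⟨φ, h, _, top_mem_low, inf_le_left⟩

theorem cl_of_thm (h : cls A φ = ⊤) : φ ∈ Cl A lev X i := cl_up (cl_meet .top) (h ▸ le_top)

theorem cl_mem (h : φ ∈ X i) : φ ∈ Cl A lev X i :=
  cl_up (cl_meet (.cons h .top)) (by rw [cls_conj]; exact inf_le_left)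

theorem cl_box_elim (h : φ.box ∈ Cl A lev X i) (hc : ∀ c ∈ φ.consts, lev c ≤ i) :
    φ ∈ Cl A lev X (i + 1) := cl_low (mem_low_succ.2 ⟨hc, h⟩)

theorem low_mono (h : ∀ j, X j ⊆ Y j) : Low A lev X i ⊆ Low A lev Y i := by
  induction i with
  | zero => exact subset_rfl
  | succ i ih =>
    rintro b ⟨hl, a, ha, d, hd, hle⟩
    exact ⟨hl, a, ha.mono (h i), d, ih hd, hle⟩

theorem cl_mono (h : ∀ j, X j ⊆ Y j) : Cl A lev X i ⊆ Cl A lev Y i := by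
  rintro φ ⟨a, ha, b, hb, hle⟩
  exact ⟨a, ha.mono (h i), b, low_mono h hb, hle⟩

theorem low_congr (h : ∀ j < i, X j = Y j) : Low A lev X i = Low A lev Y i := by
  induction i with
  | zero => rfl
  | succ i ih =>
    ext b
    simp only [Low, Set.mem_ofPred_eq]
    rw [ih fun j hj => h j (hj.trans (Nat.lt_succ_self i)), h i (Nat.lt_succ_self i)]

theorem cl_congr (h : ∀ j ≤ i, X j = Y j) : Cl A lev X i = Cl A lev Y i := by
  rw [Cl, Cl, low_congr fun j hj => h j hj.le, h i le_rfl]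

/-- Compactness: membership in `Low` uses finitely many sentences on finitely many levels, all
present at some common stage. -/
theorem low_iUnion {X : ℕ → ℕ → Set (Sent σ)} (hX : Monotone X)
    (h : φ ∈ Low A lev (fun j => ⋃ s, X s j) i) : ∃ s, φ ∈ Low A lev (X s) i := by
  induction i generalizing φ with
  | zero => exact ⟨0, h⟩
  | succ i ih =>
    obtain ⟨hl, a, ha, d, hd, hle⟩ := h
    obtain ⟨s, hs⟩ := ih hd
    obtain ⟨t, ht⟩ := ha.of_iUnion fun s t hst => hX hst i
    exact ⟨max s t, hl, a, ht.mono (hX (le_max_right s t) i), d,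
      low_mono (hX (le_max_left s t)) hs, hle⟩

theorem cl_iUnion {X : ℕ → ℕ → Set (Sent σ)} (hX : Monotone X)
    (h : φ ∈ Cl A lev (fun j => ⋃ s, X s j) i) : ∃ s, φ ∈ Cl A lev (X s) i := by
  obtain ⟨a, ha, d, hd, hle⟩ := h
  obtain ⟨s, hs⟩ := low_iUnion hX hd
  obtain ⟨t, ht⟩ := ha.of_iUnion fun s t hst => hX hst i
  exact ⟨max s t, a, ht.mono (hX (le_max_right s t) i), d,
    low_mono (hX (le_max_left s t)) hs, hle⟩

/-- Level `i` influences the levels above it only through its set of consequences, so it suffices to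
compare these at `i`. -/
theorem cl_tail (hi : Cl A lev X i ⊆ Cl A lev Y i) (h : ∀ k, i < k → X k = Y k) (hj : i ≤ j) :
    Cl A lev X j ⊆ Cl A lev Y j := by
  induction j, hj using Nat.le_induction with
  | base => exact hi
  | succ j hj ih =>
    rintro φ ⟨a, ha, b, hb, hle⟩
    rw [h (j + 1) (Nat.lt_succ_of_le hj)] at ha
    exact ⟨a, ha, b, ⟨hb.1, ih hb.2⟩, hle⟩

/-- A deduction theorem: what level `i` receives from below does not depend on the sentences added
at level `i` itself. -/
theorem cl_of_add (h : ψ ∈ Cl A lev (add X i φ) i) : φ.imp ψ ∈ Cl A lev X i := by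
  obtain ⟨a, ha, b, hb, hle⟩ := h
  rw [add_self] at ha
  obtain ⟨c, hc, hle'⟩ := ha.of_insert A
  rw [low_congr fun j hj => add_of_ne hj.ne] at hb
  refine ⟨c, hc, b, hb, ?_⟩
  rw [cls_imp, le_himp_iff, inf_right_comm]
  exact (inf_le_inf_right _ hle').trans hle

theorem cl_add_subset (h : φ ∈ Cl A lev X i) (hj : i ≤ j) :
    Cl A lev (add X i φ) j ⊆ Cl A lev X j := by
  refine cl_tail (fun ψ hψ => ?_) (fun k hk => add_of_ne hk.ne') hj
  exact cl_up₂ (cl_of_add hψ) h (by rw [cls_imp, himp_inf_self]; exact inf_le_left)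

/-- If `◇φ` yields `□b` at level `i`, then `fs1` turns `◇φ → □b` into `□(φ → b)`. So `φ → b` already
reaches level `i + 1`, where `φ` is present, and nothing new arises there. -/
theorem cl_add_dia_subset (h : φ ∈ X (i + 1)) (hc : ∀ c ∈ φ.consts, lev c ≤ i) (hj : i + 1 ≤ j) :
    Cl A lev (add X i φ.dia) j ⊆ Cl A lev X j := by
  refine cl_tail ?_ (fun k hk => add_of_ne (by omega)) hj
  rintro ψ ⟨a, ha, b, hb, hle⟩
  rw [add_of_ne (by omega)] at ha
  have h1 : φ.imp b ∈ Cl A lev X (i + 1) := by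
    refine cl_box_elim (cl_up (cl_of_add hb.2) (cls_dia_himp_box_le φ b)) ?_
    rintro c (h | h)
    exacts [hc c h, hb.1 c h]
  have h2 : b ∈ Cl A lev X (i + 1) :=
    cl_up₂ h1 (cl_mem h) (by rw [cls_imp, himp_inf_self]; exact inf_le_left)
  exact cl_up₂ (cl_meet ha) h2 hle

/-- Proof by cases on a lower level. If the two cases send `b` and `b'` one level up, then both
yield `□(b ∨ b')`, so by induction `b ∨ b'` is sent up by the disjunction. -/
theorem cl_add_disj (hj : i ≤ j) (h : θ ∈ Cl A lev (add X i φ) j)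
    (h' : θ ∈ Cl A lev (add X i ψ) j) : θ ∈ Cl A lev (add X i (φ.disj ψ)) j := by
  induction j, hj using Nat.le_induction generalizing θ with
  | base =>
    have hX : ∀ χ : Sent σ, ∀ j, X j ⊆ add X i χ j := fun χ j => subset_add j
    have h1 := cl_mono (hX (φ.disj ψ)) (cl_conj (cl_of_add h) (cl_of_add h'))
    refine cl_up₂ h1 (cl_mem mem_add_self) ?_
    rw [cls_conj, cls_disj, cls_imp, cls_imp, inf_sup_left]
    refine sup_le ?_ ?_
    · rw [inf_right_comm, himp_inf_self]
      exact inf_le_left.trans inf_le_left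
    · rw [inf_assoc, himp_inf_self]
      exact inf_le_right.trans inf_le_left
  | succ j hj ih =>
    obtain ⟨a, ha, b, hb, hle⟩ := h
    obtain ⟨a', ha', b', hb', hle'⟩ := h'
    rw [add_of_ne (by omega)] at ha ha'
    have h1 : b.disj b' ∈ Cl A lev (add X i (φ.disj ψ)) (j + 1) := by
      refine cl_box_elim (ih (cl_up hb.2 (cls_box_mono ?_)) (cl_up hb'.2 (cls_box_mono ?_))) ?_
      · rw [cls_disj]
        exact le_sup_left
      · rw [cls_disj]
        exact le_sup_right
      · rintro c (h | h)
        exacts [hb.1 c h, hb'.1 c h]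
    have hm : ∀ a, Meet (X (j + 1)) a → a ∈ Cl A lev (add X i (φ.disj ψ)) (j + 1) :=
      fun a ha => cl_meet (ha.mono (subset_add _))
    refine cl_up₂ (cl_conj (hm a ha) (hm a' ha')) h1 ?_
    rw [cls_conj, cls_disj, inf_sup_left]
    exact sup_le ((inf_le_inf_right _ inf_le_left).trans hle)
      ((inf_le_inf_right _ inf_le_right).trans hle')

/-- A fresh witness adds no consequences free of `e`. At level `i` the constant `e` is absent from
everything inherited, since that has levels below `i`. Higher up, a transmitted `b` may contain `e`;
its existential closure over `e` is transmitted instead and has the same `e`-free consequences. -/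
theorem cl_add_ex {x : ℕ} {χ : Formula σ} (hχ : χ.IsOnePlace x) {e : σ.Const} (he : lev e = i)
    (heχ : e ∉ χ.consts) (heX : ∀ j, ∀ γ ∈ X j, e ∉ γ.consts) (hj : i ≤ j) (heθ : e ∉ θ.consts)
    (h : θ ∈ Cl A lev (add X i ⟨χ.subst x e, hχ.subst e⟩) j) :
    θ ∈ Cl A lev (add X i ⟨.ex x χ, Formula.isSentence_ex.2 hχ⟩) j := by
  have hm : ∀ j a, Meet (X j) a → e ∉ a.consts := fun j a ha hea =>
    let ⟨γ, hγ, h⟩ := ha.exists_mem_consts hea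
    heX j γ hγ h
  have hX : ∀ χ : Sent σ, ∀ j, X j ⊆ add X i χ j := fun χ j => subset_add j
  induction j, hj using Nat.le_induction generalizing θ with
  | base =>
    obtain ⟨a, ha, b, hb, hle⟩ := cl_of_add h
    have h1 : cls A ⟨.ex x χ, Formula.isSentence_ex.2 hχ⟩ ≤ cls A ((a.conj b).imp θ) := by
      refine cls_ex_le hχ heχ ?_ ?_
      · rintro ((h | h) | h)
        · exact hm _ a ha h
        · exact (lev_lt_of_mem_low hb h).ne he
        · exact heθ h
      · rw [cls_imp, cls_conj]
        rw [cls_imp] at hle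
        exact le_himp_comm.1 hle
    have h2 : a.conj b ∈ Cl A lev X i := ⟨a, ha, b, hb, le_rfl⟩
    exact cl_up₂ (cl_up (cl_mem mem_add_self) h1) (cl_mono (hX _) h2)
      (by rw [cls_imp, himp_inf_self]; exact inf_le_left)
  | succ j hj ih =>
    obtain ⟨a, ha, b, hb, hle⟩ := h
    rw [add_of_ne (by omega)] at ha
    obtain ⟨b', h1, h2, h3⟩ := exists_closure_one (A := A) b e
    have hb' : b' ∈ Cl A lev (add X i ⟨.ex x χ, Formula.isSentence_ex.2 hχ⟩) (j + 1) :=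
      cl_box_elim (ih (fun h => (h1 h).2 rfl) (cl_up hb.2 (cls_box_mono h2)))
        fun c hc => hb.1 c (h1 hc).1
    refine cl_up₂ (cl_meet (ha.mono (hX _ _))) hb' ?_
    have := h3 (a.imp θ) (fun h => h.elim (hm _ a ha) heθ) (by
      rw [cls_imp, le_himp_iff, inf_comm]
      exact hle)
    rwa [cls_imp, le_himp_iff, inf_comm] at this

theorem cl_all {x : ℕ} {χ : Formula σ} (hχ : χ.IsOnePlace x) {e : σ.Const} (he : lev e = i)
    (heχ : e ∉ χ.consts) (heX : ∀ γ ∈ X i, e ∉ γ.consts)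
    (h : ⟨χ.subst x e, hχ.subst e⟩ ∈ Cl A lev X i) :
    ⟨.all x χ, Formula.isSentence_all.2 hχ⟩ ∈ Cl A lev X i := by
  obtain ⟨a, ha, b, hb, hle⟩ := h
  refine ⟨a, ha, b, hb, le_cls_all (ψ := a.conj b) hχ heχ ?_ hle⟩
  rintro (h | h)
  · obtain ⟨γ, hγ, h⟩ := ha.exists_mem_consts h
    exact heX γ hγ h
  · exact (lev_lt_of_mem_low hb h).ne he

/-- An empty level knows only what was transmitted to it, that is, sentences whose necessitations
are consequences one level below. -/
theorem cl_box_intro {X : ℕ → Set (Sent σ)} (hX : X (i + 1) = ∅) (h : φ ∈ Cl A lev X (i + 1)) :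
    φ.box ∈ Cl A lev X i := by
  obtain ⟨a, ha, b, hb, hle⟩ := h
  refine cl_up hb.2 (cls_box_mono ?_)
  refine le_trans (le_inf ?_ le_rfl) hle
  rw [hX] at ha
  cases ha with
  | top => exact le_top
  | cons h => exact h.elim

/-- Inconsistency climbs, as `⊥` entails `□⊥`. Hence avoiding a single sentence at the top keeps all
lower levels consistent. -/
theorem cl_bot (h : .bot ∈ Cl A lev X i) (hj : i ≤ j) (φ : Sent σ) : φ ∈ Cl A lev X j := by
  induction j, hj using Nat.le_induction generalizing φ with
  | base => exact cl_up h bot_le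
  | succ j hj ih =>
    exact cl_up (cl_box_elim (ih (Sent.box .bot)) fun c hc => hc.elim) bot_le

end Cl

/-! ### The Lindenbaum construction on all levels at once -/

/-- All constants of `φ` lie in `act` and have level at most `i`. -/
def InLang (act : Set σ.Const) (lev : σ.Const → ℕ) (i : ℕ) (φ : Sent σ) : Prop :=
  ∀ c ∈ φ.consts, c ∈ act ∧ lev c ≤ i

/-- `φ`, if existential, has a witness at level `i` of the chain `Y`. -/
def Witnessed (act : Set σ.Const) (lev : σ.Const → ℕ) (Y : ℕ → Set (Sent σ)) (i : ℕ)
    (φ : Sent σ) : Prop :=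
  ∀ x χ, φ.1 = .ex x χ → ∃ e ∈ act, lev e ≤ i ∧ ∃ ψ ∈ Y i, ψ.1 = χ.subst x e

/-- No sentence of `Δ` is a consequence at level `n` of the chain `Y`. -/
def Avoids (A : Set (Formula σ)) (lev : σ.Const → ℕ) (Δ : Set (Sent σ)) (n : ℕ)
    (Y : ℕ → Set (Sent σ)) : Prop := ∀ θ ∈ Δ, θ ∉ Cl A lev Y n

theorem Witnessed.mono {act : Set σ.Const} {lev : σ.Const → ℕ} {Y Y' : ℕ → Set (Sent σ)} {i : ℕ}
    {φ : Sent σ} (h : Witnessed act lev Y i φ) (hY : Y i ⊆ Y' i) : Witnessed act lev Y' i φ := by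
  intro x χ hx
  obtain ⟨e, he, hl, ψ, hψ, h'⟩ := h x χ hx
  exact ⟨e, he, hl, ψ, hY hψ, h'⟩

section Saturation

variable (A : Set (Formula σ)) (lev : σ.Const → ℕ) (m n : ℕ) (old act : Set σ.Const)
  (Δ : Set (Sent σ)) (X : ℕ → Set (Sent σ))

/-- The finite stages of the construction of a saturated extension of the chain `X`. -/
structure Stage (Y : ℕ → Set (Sent σ)) : Prop where
  le : ∀ j, X j ⊆ Y j
  out : ∀ j, j < m ∨ n < j → Y j = X j
  lang : ∀ j, ∀ γ ∈ Y j, γ ∈ X j ∨ InLang act lev j γ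
  avoids : Avoids A lev Δ n Y
  fin : ∃ F : Set σ.Const, F.Finite ∧ ∀ j, ∀ γ ∈ Y j, γ.consts ⊆ old ∪ F

variable {A lev m n old act Δ X}

theorem Stage.insert_add {Y : ℕ → Set (Sent σ)} (hY : Stage A lev m n old act Δ X Y) {i : ℕ}
    {φ : Sent σ} (hmi : m ≤ i) (hin : i ≤ n) (hφ : InLang act lev i φ) (h : Avoids A lev Δ n (add Y i φ)) :
    Stage A lev m n old act Δ X (add Y i φ) where
  le j := (hY.le j).trans (subset_add j)
  out j hj := by rw [add_of_ne (by omega), hY.out j hj]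
  lang j γ hγ := by
    by_cases hj : j = i
    · subst hj
      rw [add_self] at hγ
      rcases hγ with rfl | hγ
      exacts [.inr hφ, hY.lang _ _ hγ]
    · rw [add_of_ne hj] at hγ
      exact hY.lang j γ hγ
  avoids := h
  fin := by
    obtain ⟨F, hF, hF'⟩ := hY.fin
    refine ⟨F ∪ φ.consts, hF.union φ.1.finite_consts, fun j γ hγ => ?_⟩
    have hs : old ∪ F ⊆ old ∪ (F ∪ φ.consts) :=
      Set.union_subset_union_right _ Set.subset_union_left
    by_cases hj : j = i
    · subst hj
      rw [add_self] at hγ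
      rcases hγ with rfl | hγ
      exacts [fun c hc => .inr (.inr hc), (hF' _ _ hγ).trans hs]
    · rw [add_of_ne hj] at hγ
      exact (hF' _ _ hγ).trans hs

theorem Stage.exists_step (hΔ : ∀ θ ∈ Δ, θ.consts ⊆ old)
    (hinf : ∀ i, m ≤ i → i ≤ n → {c | c ∈ act ∧ lev c = i ∧ c ∉ old}.Infinite)
    {Y : ℕ → Set (Sent σ)} (hY : Stage A lev m n old act Δ X Y) (i : ℕ) (φ : Sent σ) :
    ∃ Y', Stage A lev m n old act Δ X Y' ∧ (∀ j, Y j ⊆ Y' j) ∧ (m ≤ i → i ≤ n →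
      InLang act lev i φ → Avoids A lev Δ n (add Y i φ) → φ ∈ Y' i ∧ Witnessed act lev Y' i φ) := by
  by_cases hc : m ≤ i ∧ i ≤ n ∧ InLang act lev i φ ∧ Avoids A lev Δ n (add Y i φ)
  swap
  · exact ⟨Y, hY, fun j => subset_rfl, fun h1 h2 h3 h4 => (hc ⟨h1, h2, h3, h4⟩).elim⟩
  obtain ⟨h1, h2, h3, h4⟩ := hc
  have hY1 := hY.insert_add h1 h2 h3 h4
  by_cases hex : ∃ x χ, φ.1 = .ex x χ
  swap
  · exact ⟨_, hY1, subset_add, fun _ _ _ _ => ⟨mem_add_self, fun x χ h => (hex ⟨x, χ, h⟩).elim⟩⟩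
  obtain ⟨x, χ, hx⟩ := hex
  obtain ⟨F, hF, hF'⟩ := hY1.fin
  have hφF := hF' i φ mem_add_self
  -- Only finitely many constants outside `old` have been used so far, so a witness of level exactly
  -- `i` is still available.
  obtain ⟨e, ⟨heact, hei, heold⟩, heF⟩ := ((hinf i h1 h2).sdiff hF).nonempty
  have heF' : e ∉ old ∪ F := fun h => h.elim heold heF
  obtain ⟨φ, hφ⟩ := φ
  subst hx
  have hχ := Formula.isSentence_ex.1 hφ
  have heχ : e ∉ χ.consts := fun h => heF' (hφF h)
  have hY2 := hY1.insert_add (φ := ⟨χ.subst x e, hχ.subst e⟩) h1 h2 (by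
    intro c hc
    rcases Formula.mem_consts_subst hc with h | rfl
    · exact h3 c h
    · exact ⟨heact, hei.le⟩) (by
    intro θ hθ hcl
    -- A bad consequence of the witness instance would be one of the existential sentence, which is
    -- already on level `i`.
    have := cl_add_ex hχ hei heχ (fun j γ hγ h => heF' (hF' j γ hγ h)) h2
      (fun h => heold (hΔ θ hθ h)) hcl
    exact h4 θ hθ (cl_add_subset (cl_mem mem_add_self) h2 this))
  refine ⟨_, hY2, fun j => (subset_add j).trans (subset_add j), fun _ _ _ _ =>
    ⟨subset_add i mem_add_self, fun y ξ h => ?_⟩⟩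
  obtain ⟨rfl, rfl⟩ := Formula.ex.inj h
  exact ⟨e, heact, hei.le, _, mem_add_self, rfl⟩

/-- A chain avoiding `Δ` has a maximal extension avoiding `Δ`, with witnesses for its existential
sentences; only the levels from `m` to `n` are extended. -/
theorem exists_saturated (hXold : ∀ j, ∀ γ ∈ X j, γ.consts ⊆ old)
    (hΔ : ∀ θ ∈ Δ, θ.consts ⊆ old)
    (hinf : ∀ i, m ≤ i → i ≤ n → {c | c ∈ act ∧ lev c = i ∧ c ∉ old}.Infinite)
    (hX : Avoids A lev Δ n X) :
    ∃ Y : ℕ → Set (Sent σ), (∀ j, X j ⊆ Y j) ∧ (∀ j, j < m ∨ n < j → Y j = X j) ∧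
      (∀ j, ∀ γ ∈ Y j, γ ∈ X j ∨ InLang act lev j γ) ∧ Avoids A lev Δ n Y ∧
      ∀ i, m ≤ i → i ≤ n → ∀ φ, InLang act lev i φ → Avoids A lev Δ n (add Y i φ) →
        φ ∈ Y i ∧ Witnessed act lev Y i φ := by
  have : Nonempty (Sent σ) := ⟨.bot⟩
  -- Each stage treats one pair consisting of a level and a sentence.
  obtain ⟨g, hg⟩ := exists_surjective_nat (ℕ × Sent σ)
  have h0 : Stage A lev m n old act Δ X X := ⟨fun _ => subset_rfl, fun _ _ => rfl,
    fun _ _ h => .inl h, hX, ∅, Set.finite_empty, fun j γ hγ => by simpa using hXold j γ hγ⟩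
  choose step hstep using fun (Y : {Y // Stage A lev m n old act Δ X Y}) (p : ℕ × Sent σ) =>
    Y.2.exists_step hΔ hinf p.1 p.2
  let seq : ℕ → {Y // Stage A lev m n old act Δ X Y} :=
    fun s => Nat.rec ⟨X, h0⟩ (fun s Y => ⟨step Y (g s), (hstep Y (g s)).1⟩) s
  have hseq : ∀ s, (seq (s + 1)).1 = step (seq s) (g s) := fun s => rfl
  have hmono : Monotone fun s => (seq s).1 := by
    refine monotone_nat_of_le_succ fun s j => ?_
    rw [hseq]
    exact (hstep (seq s) (g s)).2.1 j
  have hle : ∀ s j, (seq s).1 j ⊆ ⋃ s, (seq s).1 j := fun s j =>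
    Set.subset_iUnion (fun s => (seq s).1 j) s
  refine ⟨fun j => ⋃ s, (seq s).1 j, fun j => hle 0 j, fun j hj => ?_, fun j γ hγ => ?_,
    fun θ hθ h => ?_, fun i h1 h2 φ hφ hav => ?_⟩
  · simp only [(seq _).2.out j hj, Set.iUnion_const]
  · obtain ⟨s, hs⟩ := Set.mem_iUnion.1 hγ
    exact (seq s).2.lang j γ hs
  · obtain ⟨s, hs⟩ := cl_iUnion hmono h
    exact (seq s).2.avoids θ hθ hs
  · obtain ⟨s, hs⟩ := hg (i, φ)
    have := (hstep (seq s) (g s)).2.2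
    rw [hs] at this
    -- A sentence that can be added to the limit could have been added at its own earlier stage,
    -- where the chain was smaller.
    have h3 := this h1 h2 hφ fun θ hθ h => hav θ hθ (cl_mono (add_mono (hle s)) h)
    have hs' := hseq s
    rw [hs] at hs'
    rw [← hs'] at h3
    exact ⟨hle (s + 1) i h3.1, h3.2.mono (hle (s + 1) i)⟩

end Saturation

/-! ### Worlds as finite chains of saturated theories -/

/-- A stratification of the constants into infinitely many infinite levels, together with a copy
`base` of the constants inside level `0` whose complement is still infinite. -/
structure Levels (σ : Signature.{u}) where
  lev : σ.Const → ℕ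
  base : σ.Const → σ.Const
  base_injective : Injective base
  lev_base : ∀ c, lev (base c) = 0
  infinite : ∀ i, {c | lev c = i ∧ c ∉ Set.range base}.Infinite

/-- A finite chain `th 0, …, th n` of saturated theories, each a modal successor of the one before;
`act` is the set of constants in use. -/
@[ext] structure World (A : Set (Formula σ)) (Λ : Levels σ) where
  n : ℕ
  act : Set σ.Const
  th : ℕ → Set (Sent σ)
  base_mem : ∀ c, Λ.base c ∈ act
  lev_le : ∀ c ∈ act, Λ.lev c ≤ n
  coinf : ∀ i, {c | Λ.lev c = i ∧ c ∉ act}.Infinite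
  th_empty : ∀ i, n < i → th i = ∅
  lang : ∀ i, ∀ φ ∈ th i, InLang act Λ.lev i φ
  closed : ∀ i ≤ n, ∀ φ, InLang act Λ.lev i φ → φ ∈ Cl A Λ.lev th i → φ ∈ th i
  consistent : ∀ i ≤ n, .bot ∉ th i
  prime : ∀ i ≤ n, ∀ φ ψ : Sent σ, φ.disj ψ ∈ th i → φ ∈ th i ∨ ψ ∈ th i
  henkin : ∀ i ≤ n, ∀ φ ∈ th i, Witnessed act Λ.lev th i φ
  dia_mem : ∀ i < n, ∀ φ ∈ th (i + 1), InLang act Λ.lev i φ → φ.dia ∈ th i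

theorem InLang.mono {act act' : Set σ.Const} {lev : σ.Const → ℕ} {i j : ℕ} {φ : Sent σ}
    (h : InLang act lev i φ) (ha : act ⊆ act') (hij : i ≤ j) : InLang act' lev j φ :=
  fun c hc => ⟨ha (h c hc).1, (h c hc).2.trans hij⟩

theorem exists_infinite_split {α : Type*} {s : Set α} (hs : s.Infinite) :
    ∃ t ⊆ s, t.Infinite ∧ (s \ t).Infinite := by
  obtain ⟨t, u, rfl, hd, htu⟩ := hs.exists_union_disjoint_cardinal_eq_of_infinite
  obtain ⟨e⟩ := Cardinal.eq.1 htu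
  have hiff : t.Infinite ↔ u.Infinite := by
    rw [← Set.infinite_coe_iff, ← Set.infinite_coe_iff]
    exact e.infinite_iff
  have ht : t.Infinite := (Set.infinite_union.1 hs).elim id hiff.2
  refine ⟨t, Set.subset_union_left, ht, ?_⟩
  rw [Set.union_sdiff_left, hd.symm.sdiff_eq_left]
  exact hiff.1 ht

/-- On each level the unused constants are split into two infinite halves, one for witnesses now and
one kept for later extensions. -/
theorem exists_fresh_supply (lev : σ.Const → ℕ) {old : Set σ.Const}
    (hco : ∀ i, {c | lev c = i ∧ c ∉ old}.Infinite) (S : Set ℕ) :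
    ∃ act, old ⊆ act ∧ (∀ c ∈ act, c ∈ old ∨ lev c ∈ S) ∧
      (∀ i, {c | lev c = i ∧ c ∉ act}.Infinite) ∧
      ∀ i ∈ S, {c | c ∈ act ∧ lev c = i ∧ c ∉ old}.Infinite := by
  choose T hT hT1 hT2 using fun i => exists_infinite_split (hco i)
  refine ⟨old ∪ {c | lev c ∈ S ∧ c ∈ T (lev c)}, Set.subset_union_left,
    fun c hc => hc.imp_right fun h => h.1, fun i => (hT2 i).mono ?_, fun i hi => (hT1 i).mono ?_⟩
  · rintro c ⟨⟨hc, ho⟩, hcT⟩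
    refine ⟨hc, fun h => h.elim ho fun h => hcT ?_⟩
    rw [← hc]
    exact h.2
  · intro c hc
    obtain ⟨h1, h2⟩ := hT i hc
    refine ⟨.inr ⟨?_, ?_⟩, h1, h2⟩
    · rwa [show lev c = i from h1]
    · rwa [show lev c = i from h1]

section Existence

variable {A : Set (Formula σ)} {Λ : Levels σ} {m n : ℕ} {old : Set σ.Const}
  {X : ℕ → Set (Sent σ)} {Δ : Set (Sent σ)}

/-- A chain avoiding `Δ` whose levels below `m` are already saturated extends to a world avoiding
`Δ`, without changing the levels below `m`. -/
theorem exists_world_of_avoids (hbase : ∀ c, Λ.base c ∈ old) (hlev : ∀ c ∈ old, Λ.lev c ≤ n)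
    (hco : ∀ i, {c | Λ.lev c = i ∧ c ∉ old}.Infinite)
    (hlang : ∀ i, ∀ φ ∈ X i, InLang old Λ.lev i φ) (hemp : ∀ i, n < i → X i = ∅)
    (hΔ : ∀ θ ∈ Δ, θ.consts ⊆ old) (hne : Δ.Nonempty)
    (hdir : ∀ θ ∈ Δ, ∀ θ' ∈ Δ, θ.disj θ' ∈ Δ ∨ θ = θ') (hav : Avoids A Λ.lev Δ n X)
    (hcl : ∀ i < m, ∀ φ, InLang old Λ.lev i φ → φ ∈ Cl A Λ.lev X i → φ ∈ X i)
    (hpr : ∀ i < m, ∀ φ ψ : Sent σ, φ.disj ψ ∈ X i → φ ∈ X i ∨ ψ ∈ X i)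
    (hhen : ∀ i < m, ∀ φ ∈ X i, Witnessed old Λ.lev X i φ)
    (hdia : ∀ i < m, i < n → ∀ Y : ℕ → Set (Sent σ), (∀ j < m, Y j = X j) →
      Avoids A Λ.lev Δ n Y → ∀ φ ∈ Y (i + 1), InLang old Λ.lev i φ → φ.dia ∈ X i) :
    ∃ w : World A Λ, w.n = n ∧ old ⊆ w.act ∧ (∀ c ∈ w.act, c ∈ old ∨ m ≤ Λ.lev c) ∧
      (∀ j, X j ⊆ w.th j) ∧ (∀ j < m, w.th j = X j) ∧ Avoids A Λ.lev Δ n w.th := by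
  obtain ⟨act, hact, hactS, hactco, hinf⟩ := exists_fresh_supply Λ.lev hco (Set.Icc m n)
  obtain ⟨Y, hXY, hout, hYlang, hYav, hmax⟩ := exists_saturated (A := A) (m := m) (n := n)
    (fun j γ hγ c hc => (hlang j γ hγ c hc).1) hΔ (fun i h1 h2 => hinf i ⟨h1, h2⟩) hav
  have hlang' : ∀ j, ∀ γ ∈ Y j, InLang act Λ.lev j γ := fun j γ hγ =>
    (hYlang j γ hγ).elim (fun h => (hlang j γ h).mono hact le_rfl) id
  have hlow : ∀ i < m, ∀ φ, InLang act Λ.lev i φ → InLang old Λ.lev i φ := by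
    intro i hi φ hφ c hc
    obtain ⟨h1, h2⟩ := hφ c hc
    refine ⟨(hactS c h1).resolve_right fun h => ?_, h2⟩
    have := h.1
    omega
  have hYX : ∀ j < m, Y j = X j := fun j hj => hout j (.inl hj)
  have hadd : ∀ i ≤ n, ∀ φ, φ ∈ Cl A Λ.lev Y i → Avoids A Λ.lev Δ n (add Y i φ) :=
    fun i hi φ hφ θ hθ h => hYav θ hθ (cl_add_subset hφ hi h)
  refine ⟨⟨n, act, Y, fun c => hact (hbase c), fun c hc => ?_, hactco, fun i hi => ?_, hlang',
    fun i hi φ hφ h => ?_, fun i hi h => ?_, fun i hi φ ψ h => ?_, fun i hi φ h => ?_,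
    fun i hi φ h hφ => ?_⟩, rfl, hact, fun c hc => (hactS c hc).imp_right fun h => h.1, hXY, hYX,
    hYav⟩
  · exact (hactS c hc).elim (hlev c) fun h => h.2
  · rw [hout i (.inr hi), hemp i hi]
  · rcases lt_or_ge i m with him | him
    · rw [hYX i him]
      refine hcl i him φ (hlow i him φ hφ) ?_
      rwa [cl_congr fun j hj => (hYX j (hj.trans_lt him)).symm]
    · exact (hmax i him hi φ hφ (hadd i hi φ h)).1
  -- An inconsistent level `i ≤ n` would make every sentence of `Δ` a consequence at level `n`.
  · obtain ⟨θ, hθ⟩ := hne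
    exact hYav θ hθ (cl_bot (cl_mem h) hi θ)
  · rcases lt_or_ge i m with him | him
    · rw [hYX i him] at h ⊢
      exact hpr i him φ ψ h
    · have hlφ : InLang act Λ.lev i φ := fun c hc => hlang' i _ h c (.inl hc)
      have hlψ : InLang act Λ.lev i ψ := fun c hc => hlang' i _ h c (.inr hc)
      by_contra! hcon
      have h1 : ¬ Avoids A Λ.lev Δ n (add Y i φ) := fun h => hcon.1 (hmax i him hi φ hlφ h).1
      have h2 : ¬ Avoids A Λ.lev Δ n (add Y i ψ) := fun h => hcon.2 (hmax i him hi ψ hlψ h).1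
      simp only [Avoids, not_forall, not_not] at h1 h2
      obtain ⟨θ, hθ, h1⟩ := h1
      obtain ⟨θ', hθ', h2⟩ := h2
      -- Maximality makes `φ` lead to `θ` and `ψ` to `θ'`, both in `Δ`. A common weakening `η` in
      -- `Δ` would then follow from the disjunction that is present; `hdir` supplies such an `η`.
      have key : ∀ η ∈ Δ, cls A θ ≤ cls A η → cls A θ' ≤ cls A η → False := by
        intro η hη hle hle'
        exact hadd i hi _ (cl_mem h) η hη (cl_add_disj hi (cl_up h1 hle) (cl_up h2 hle'))
      rcases hdir θ hθ θ' hθ' with hd | rfl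
      · exact key _ hd (by rw [cls_disj]; exact le_sup_left) (by rw [cls_disj]; exact le_sup_right)
      · exact key θ hθ le_rfl le_rfl
  · rcases lt_or_ge i m with him | him
    · rw [hYX i him] at h
      intro x χ hx
      obtain ⟨e, he, hl, ψ, hψ, h'⟩ := hhen i him φ h x χ hx
      exact ⟨e, hact he, hl, ψ, hXY i hψ, h'⟩
    · exact (hmax i him hi φ (hlang' i φ h) (hadd i hi φ (cl_mem h))).2
  · rcases lt_or_ge i m with him | him
    · rw [hYX i him]
      exact hdia i him hi Y hYX hYav φ h (hlow i him φ hφ)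
    -- By `cl_add_dia_subset` the sentence `◇φ` can be added at no cost, so maximality has put it
    -- there.
    · exact (hmax i him hi.le φ.dia hφ fun θ hθ h' =>
        hYav θ hθ (cl_add_dia_subset h (fun c hc => (hφ c hc).2) hi h')).1

/-- A chain of which `ψ` is not a consequence extends to a world refuting `ψ`. -/
theorem exists_world {ψ : Sent σ} (hbase : ∀ c, Λ.base c ∈ old) (hlev : ∀ c ∈ old, Λ.lev c ≤ n)
    (hco : ∀ i, {c | Λ.lev c = i ∧ c ∉ old}.Infinite)
    (hlang : ∀ i, ∀ φ ∈ X i, InLang old Λ.lev i φ) (hemp : ∀ i, n < i → X i = ∅)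
    (hψ : ψ.consts ⊆ old) (hav : ψ ∉ Cl A Λ.lev X n) :
    ∃ w : World A Λ, w.n = n ∧ old ⊆ w.act ∧ (∀ j, X j ⊆ w.th j) ∧ ψ ∉ w.th w.n := by
  obtain ⟨w, h1, h2, -, h3, -, h4⟩ := exists_world_of_avoids (A := A) (m := 0) (Δ := {ψ}) hbase hlev
    hco hlang hemp (by rintro θ rfl; exact hψ) ⟨ψ, rfl⟩ (by rintro θ rfl θ' rfl; exact .inr rfl)
    (by rintro θ rfl; exact hav) (by simp) (by simp) (by simp) (by simp)
  refine ⟨w, h1, h2, h3, fun h => h4 ψ rfl ?_⟩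
  rw [← h1]
  exact cl_mem h

end Existence

/-! ### Order, modal steps and existence of witnessing worlds -/

namespace World

variable {A : Set (Formula σ)} {Λ : Levels σ}

/-- The theory at the end of the chain. -/
def last (w : World A Λ) : Set (Sent σ) := w.th w.n

variable {w u v : World A Λ} {φ ψ : Sent σ}

theorem inLang (h : φ.consts ⊆ w.act) : InLang w.act Λ.lev w.n φ :=
  fun _ hc => ⟨h hc, w.lev_le _ (h hc)⟩

theorem consts_subset (h : φ ∈ w.last) : φ.consts ⊆ w.act := fun c hc => (w.lang _ _ h c hc).1

theorem mem_of_cl (hφ : φ.consts ⊆ w.act) (h : φ ∈ Cl A Λ.lev w.th w.n) : φ ∈ w.last :=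
  w.closed _ le_rfl φ (inLang hφ) h

theorem up (h : φ ∈ w.last) (hψ : ψ.consts ⊆ w.act) (hle : cls A φ ≤ cls A ψ) : ψ ∈ w.last :=
  mem_of_cl hψ (cl_up (cl_mem h) hle)

theorem up₂ {χ : Sent σ} (h : φ ∈ w.last) (h' : ψ ∈ w.last) (hχ : χ.consts ⊆ w.act)
    (hle : cls A φ ⊓ cls A ψ ≤ cls A χ) : χ ∈ w.last :=
  mem_of_cl hχ (cl_up₂ (cl_mem h) (cl_mem h') hle)

theorem mem_of_eq_top (hφ : φ.consts ⊆ w.act) (h : cls A φ = ⊤) : φ ∈ w.last :=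
  mem_of_cl hφ (cl_of_thm h)

theorem bot_notMem : .bot ∉ w.last := w.consistent _ le_rfl

theorem conj_mem_iff : φ.conj ψ ∈ w.last ↔ φ ∈ w.last ∧ ψ ∈ w.last := by
  refine ⟨fun h => ?_, fun h => ?_⟩
  · have := consts_subset h
    exact ⟨up h (Set.subset_union_left.trans this) (by rw [cls_conj]; exact inf_le_left),
      up h (Set.subset_union_right.trans this) (by rw [cls_conj]; exact inf_le_right)⟩
  · exact up₂ h.1 h.2 (Set.union_subset (consts_subset h.1) (consts_subset h.2)) le_rfl

theorem disj_mem_iff (hφ : φ.consts ⊆ w.act) (hψ : ψ.consts ⊆ w.act) :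
    φ.disj ψ ∈ w.last ↔ φ ∈ w.last ∨ ψ ∈ w.last := by
  refine ⟨w.prime _ le_rfl φ ψ, fun h => ?_⟩
  have hl : (φ.disj ψ).consts ⊆ w.act := Set.union_subset hφ hψ
  rcases h with h | h
  · exact up h hl (by rw [cls_disj]; exact le_sup_left)
  · exact up h hl (by rw [cls_disj]; exact le_sup_right)

/-- The intuitionistic order: chains of the same length are compared pointwise. -/
def le (w u : World A Λ) : Prop := w.n = u.n ∧ w.act ⊆ u.act ∧ ∀ i, w.th i ⊆ u.th i

theorem le_refl (w : World A Λ) : w.le w := ⟨rfl, subset_rfl, fun _ => subset_rfl⟩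

theorem le.trans (h : w.le u) (h' : u.le v) : w.le v :=
  ⟨h.1.trans h'.1, h.2.1.trans h'.2.1, fun i => (h.2.2 i).trans (h'.2.2 i)⟩

theorem le.antisymm (h : w.le u) (h' : u.le w) : w = u :=
  World.ext h.1 (h.2.1.antisymm h'.2.1) (funext fun i => (h.2.2 i).antisymm (h'.2.2 i))

theorem le.last (h : w.le u) (hφ : φ ∈ w.last) : φ ∈ u.last := by
  rw [World.last, ← h.1]
  exact h.2.2 _ hφ

/-- One modal step: the chain is extended by one theory. -/
def Step (w v : World A Λ) : Prop :=
  v.n = w.n + 1 ∧ (∀ c, c ∈ w.act ↔ c ∈ v.act ∧ Λ.lev c ≤ w.n) ∧ ∀ i ≤ w.n, v.th i = w.th i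

theorem Step.act_subset (h : w.Step v) : w.act ⊆ v.act := fun c hc => ((h.2.1 c).1 hc).1

theorem Step.box (h : w.Step v) (hφ : φ.box ∈ w.last) : φ ∈ v.last := by
  have hl := consts_subset hφ
  refine mem_of_cl (hl.trans h.act_subset) ?_
  rw [h.1]
  refine cl_box_elim ?_ fun c hc => w.lev_le c (hl hc)
  rw [cl_congr h.2.2]
  exact cl_mem hφ

theorem Step.dia (h : w.Step v) (hφ : φ ∈ v.last) (hl : φ.consts ⊆ w.act) : φ.dia ∈ w.last := by
  rw [World.last, ← h.2.2 _ le_rfl]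
  refine v.dia_mem _ (by rw [h.1]; exact Nat.lt_succ_self _) φ ?_
    ((inLang hl).mono h.act_subset le_rfl)
  rw [World.last, h.1] at hφ
  exact hφ

/-- The initial segment of a chain of theories. -/
def trunc (v : World A Λ) (k : ℕ) (hk : k ≤ v.n) : World A Λ where
  n := k
  act := {c | c ∈ v.act ∧ Λ.lev c ≤ k}
  th i := {φ | φ ∈ v.th i ∧ i ≤ k}
  base_mem _ := ⟨v.base_mem _, (Λ.lev_base _).trans_le (Nat.zero_le k)⟩
  lev_le _ hc := hc.2
  coinf _ := (v.coinf _).mono fun _ hc => ⟨hc.1, fun h => hc.2 h.1⟩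
  th_empty _ hi := Set.eq_empty_of_forall_notMem fun _ hφ => hi.not_ge hφ.2
  lang i φ hφ c hc :=
    have h := v.lang i φ hφ.1 c hc
    ⟨⟨h.1, h.2.trans hφ.2⟩, h.2⟩
  closed i hi φ hφ h :=
    ⟨v.closed i (hi.trans hk) φ (hφ.mono (fun _ hc => hc.1) le_rfl)
      (cl_mono (fun _ _ hψ => hψ.1) h), hi⟩
  consistent i hi h := v.consistent i (hi.trans hk) h.1
  prime i hi φ ψ h := (v.prime i (hi.trans hk) φ ψ h.1).imp (fun h => ⟨h, hi⟩) fun h => ⟨h, hi⟩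
  henkin i hi φ hφ x χ hx :=
    have ⟨e, he, hl, ψ, hψ, h'⟩ := v.henkin i (hi.trans hk) φ hφ.1 x χ hx
    ⟨e, ⟨he, hl.trans hi⟩, hl, ψ, ⟨hψ, hi⟩, h'⟩
  dia_mem i hi φ hφ hl :=
    ⟨v.dia_mem i (hi.trans_le hk) φ hφ.1 (hl.mono (fun _ hc => hc.1) le_rfl), hi.le⟩

theorem step_trunc {k : ℕ} (hk : v.n = k + 1) : (v.trunc k (by omega)).Step v :=
  ⟨hk, fun _ => Iff.rfl, fun _ hi => Set.ext fun _ => ⟨fun h => ⟨h, hi⟩, fun h => h.1⟩⟩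

theorem le_trunc_of_step (h : w.Step u) (h' : u.le v) :
    w.le (v.trunc w.n (by rw [← h'.1, h.1]; omega)) := by
  refine ⟨rfl, fun c hc => ⟨h'.2.1 (h.act_subset hc), w.lev_le c hc⟩, fun i φ hφ => ?_⟩
  have hi : i ≤ w.n := by
    by_contra hi
    rw [w.th_empty i (by omega)] at hφ
    exact hφ.elim
  refine ⟨h'.2.2 i ?_, hi⟩
  rwa [h.2.2 i hi]

/-- The required predecessor is `v` without its last theory. -/
theorem Step.fc1 (h : w.Step u) (h' : u.le v) : ∃ w', w.le w' ∧ w'.Step v :=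
  ⟨_, le_trunc_of_step h h', step_trunc (by rw [← h'.1, h.1])⟩

/-- A world has a modal successor containing `Γ` if the consequences of `Γ` are possible. -/
theorem exists_step {Γ : Set (Sent σ)} {old : Set σ.Const} (hold : u.act ⊆ old)
    (holdn : ∀ c ∈ old, Λ.lev c ≤ u.n → c ∈ u.act) (hlev : ∀ c ∈ old, Λ.lev c ≤ u.n + 1)
    (hco : ∀ i, {c | Λ.lev c = i ∧ c ∉ old}.Infinite) (hΓ : ∀ γ ∈ Γ, γ.consts ⊆ old)
    (hgood : ∀ a b θ, Meet Γ a → (∀ c ∈ b.consts, Λ.lev c ≤ u.n) → b.box ∈ Cl A Λ.lev u.th u.n →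
      θ.consts ⊆ u.act → cls A a ⊓ cls A b ≤ cls A θ → θ.dia ∈ u.last) :
    ∃ v, u.Step v ∧ Γ ⊆ v.last ∧ old ⊆ v.act := by
  have hX : ∀ i ≤ u.n, update u.th (u.n + 1) Γ i = u.th i := fun i hi => update_of_ne (by omega) ..
  have hXn : update u.th (u.n + 1) Γ (u.n + 1) = Γ := update_self ..
  have hlow : ∀ i ≤ u.n, ∀ φ, InLang old Λ.lev i φ → InLang u.act Λ.lev i φ := fun i hi φ h c hc =>
    ⟨holdn c (h c hc).1 ((h c hc).2.trans hi), (h c hc).2⟩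
  -- The chain of `u` is frozen and only the level `u.n + 1` is built. Avoiding every `θ` in the
  -- language of `u` with `◇θ` not in `u` is exactly the condition that the new theory be possible
  -- at `u`.
  obtain ⟨v, h1, h2, h3, h4, h5, -⟩ := exists_world_of_avoids (A := A) (Λ := Λ) (m := u.n + 1)
    (n := u.n + 1) (old := old) (X := update u.th (u.n + 1) Γ)
    (Δ := {θ | θ.consts ⊆ u.act ∧ θ.dia ∉ u.last}) (fun c => hold (u.base_mem c)) hlev hco
    (fun i φ hφ => by
      by_cases hi : i = u.n + 1
      · subst hi
        rw [hXn] at hφ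
        exact fun c hc => ⟨hΓ φ hφ hc, hlev c (hΓ φ hφ hc)⟩
      · rw [update_of_ne hi] at hφ
        exact (u.lang i φ hφ).mono hold le_rfl)
    (fun i hi => by rw [update_of_ne (by omega), u.th_empty i (by omega)])
    (fun θ hθ => hθ.1.trans hold)
    -- Nonemptiness of `Δ` is `¬◇⊥`; its closure under disjunction, next, is the distribution of `◇`
    -- over `∨` together with primeness of `u`.
    ⟨.bot, Set.empty_subset _, fun h => bot_notMem (up h (Set.empty_subset _)
      (by rw [cls_dia_bot]; exact bot_le))⟩
    (fun θ hθ θ' hθ' => .inl ⟨Set.union_subset hθ.1 hθ'.1, fun h => by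
      have h' : θ.dia.disj θ'.dia ∈ u.last :=
        up h (Set.union_subset hθ.1 hθ'.1) (cls_dia_disj_le θ θ')
      exact ((disj_mem_iff (φ := θ.dia) (ψ := θ'.dia) hθ.1 hθ'.1).1 h').elim hθ.2 hθ'.2⟩)
    (by
      rintro θ ⟨hθ, hθ'⟩ ⟨a, ha, b, hb, hle⟩
      rw [hXn] at ha
      have hbox := hb.2
      refine hθ' (hgood a b θ ha hb.1 ?_ hθ hle)
      rw [cl_congr fun j hj => (hX j hj).symm]
      exact hbox)
    (fun i hi φ hφ h => by
      rw [hX i (by omega)]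
      rw [cl_congr fun j hj => hX j (by omega)] at h
      exact u.closed i (by omega) φ (hlow i (by omega) φ hφ) h)
    (fun i hi => by
      rw [hX i (by omega)]
      exact u.prime i (by omega))
    (fun i hi φ hφ x χ hx => by
      rw [hX i (by omega)] at hφ ⊢
      obtain ⟨e, he, hr⟩ := u.henkin i (by omega) φ hφ x χ hx
      exact ⟨e, hold he, hr⟩)
    (fun i hi _ Y hYX hY φ hφ hl => by
      have hl' := hlow i (by omega) φ hl
      rw [hX i (by omega)]
      rcases (Nat.lt_succ_iff_lt_or_eq.1 hi) with hi' | rfl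
      · rw [hYX _ (by omega), hX _ (by omega)] at hφ
        exact u.dia_mem i hi' φ hφ hl'
      · by_contra hcon
        exact hY φ ⟨fun c hc => (hl' c hc).1, hcon⟩ (cl_mem hφ))
  refine ⟨v, ⟨h1, fun c => ⟨fun hc => ⟨h2 (hold hc), u.lev_le c hc⟩, fun hc => ?_⟩, fun i hi => ?_⟩,
    ?_, h2⟩
  · refine holdn c ((h3 c hc.1).resolve_right fun h => ?_) hc.2
    have := hc.2
    omega
  · rw [h5 i (by omega), hX i hi]
  · rw [last, h1]
    intro γ hγ
    refine h4 _ ?_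
    rwa [hXn]

theorem exists_step_of_dia (h : φ.dia ∈ w.last) : ∃ v, w.Step v ∧ φ ∈ v.last := by
  have hφ : φ.consts ⊆ w.act := consts_subset (φ := φ.dia) h
  obtain ⟨v, h1, h2, -⟩ := exists_step (u := w) (Γ := {φ}) (old := w.act) subset_rfl
    (fun c hc _ => hc)
    (fun c hc => (w.lev_le c hc).trans (Nat.le_succ _)) w.coinf (by rintro γ rfl; exact hφ)
    (fun a b θ ha _ hb hθ hle => by
      have hle' : cls A φ ≤ cls A a := by
        clear hle
        induction ha with
        | top => exact le_top
        | cons hγ _ ih =>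
          rw [cls_conj]
          exact le_inf (le_of_eq (by rw [show _ = φ from hγ])) ih
      refine mem_of_cl hθ (cl_up₂ hb (cl_mem h) (cls_box_inf_dia_le ?_))
      rw [inf_comm]
      exact (inf_le_inf_right _ hle').trans hle)
  exact ⟨v, h1, h2 rfl⟩

theorem meet_mem {a : Sent σ} (h : Meet w.last a) : a ∈ w.last := by
  refine mem_of_cl (fun c hc => ?_) (cl_meet h)
  obtain ⟨γ, hγ, h⟩ := h.exists_mem_consts hc
  exact consts_subset hγ h

/-- The theory of `v` is placed above the chain of `u` by `exists_step`. No constants clash: those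
of `v` of level at most `w.n` already belong to `w`, the others have level `w.n + 1`, which `u` does
not reach. -/
theorem Step.fc2 (hv : w.Step v) (h : w.le u) : ∃ v', v.le v' ∧ u.Step v' := by
  have hact : ∀ c ∈ v.act, Λ.lev c ≤ u.n → c ∈ u.act := fun c hc hl =>
    h.2.1 ((hv.2.1 c).2 ⟨hc, by rwa [h.1]⟩)
  obtain ⟨v', h1, h2, h3⟩ := exists_step (u := u) (Γ := v.last) (old := u.act ∪ v.act)
    Set.subset_union_left (fun c hc hl => hc.elim id fun hc => hact c hc hl)
    (fun c hc => by
      rcases hc with hc | hc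
      · exact (u.lev_le c hc).trans (Nat.le_succ _)
      · rw [← h.1, ← hv.1]
        exact v.lev_le c hc)
    (fun i => by
      rcases le_or_gt i u.n with hi | hi
      · refine (u.coinf i).mono fun c hc => ⟨hc.1, fun hcu => hcu.elim hc.2 fun hcv => ?_⟩
        exact hc.2 (hact c hcv (hc.1.trans_le hi))
      · refine (v.coinf i).mono fun c hc => ⟨hc.1, fun hcu => hcu.elim (fun hcu => ?_) hc.2⟩
        have h1 := u.lev_le c hcu
        have h2 : Λ.lev c = i := hc.1
        omega)
    (fun γ hγ => (consts_subset hγ).trans Set.subset_union_right)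
    (fun a b θ ha hb hbox hθ hle => by
      have hav := meet_mem ha
      -- Quantifying away the constants above level `u.n` leaves `a'` in the language of `w`, so
      -- `◇a'` lies in `w` and hence in `u`. Since `b → θ` has none of these constants, `a'` and `b`
      -- still entail `θ`, and `□b` with `◇a'` gives `◇θ`.
      obtain ⟨a', k1, k2, k3⟩ := exists_closure (A := A) a
        (S := {c | c ∈ a.consts ∧ u.n < Λ.lev c}) (a.1.finite_consts.subset fun c hc => hc.1)
      have ha'w : a'.consts ⊆ w.act := fun c hc => by
        obtain ⟨hc1, hc2⟩ := k1 hc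
        refine (hv.2.1 c).2 ⟨consts_subset hav hc1, ?_⟩
        rw [h.1]
        by_contra hl
        exact hc2 ⟨hc1, by omega⟩
      have hdia := h.last (hv.dia (up hav (ha'w.trans hv.act_subset) k2) ha'w)
      refine mem_of_cl hθ (cl_up₂ hbox (cl_mem hdia) (cls_box_inf_dia_le ?_))
      rw [inf_comm, ← le_himp_iff]
      refine k3 (b.imp θ) ?_ ?_
      · rw [Set.disjoint_left]
        rintro c (hc | hc) ⟨-, hc'⟩
        · exact hc'.not_ge (hb c hc)
        · exact hc'.not_ge (u.lev_le c (hθ hc))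
      · rw [cls_imp, le_himp_iff]
        exact hle)
  refine ⟨v', ⟨?_, Set.subset_union_right.trans h3, fun i φ hφ => ?_⟩, h1⟩
  · rw [h1.1, hv.1, h.1]
  · rcases le_or_gt i w.n with hi | hi
    · rw [h1.2.2 i (by rwa [← h.1])]
      rw [hv.2.2 i hi] at hφ
      exact h.2.2 i hφ
    · have hi' : i = v.n := by
        by_contra hne
        rw [v.th_empty i (by have := hv.1; omega)] at hφ
        exact hφ.elim
      subst hi'
      have := h2 hφ
      rwa [last, h1.1, ← h.1, ← hv.1] at this

theorem exists_le_of_imp (hl : (φ.imp ψ).consts ⊆ w.act) (h : φ.imp ψ ∉ w.last) :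
    ∃ u, w.le u ∧ φ ∈ u.last ∧ ψ ∉ u.last := by
  obtain ⟨u, h1, h2, h3, h4⟩ := exists_world (A := A) (Λ := Λ) (n := w.n) (old := w.act)
    (X := add w.th w.n φ) (ψ := ψ) w.base_mem w.lev_le w.coinf
    (fun i γ hγ => by
      by_cases hi : i = w.n
      · subst hi
        rw [add_self] at hγ
        rcases hγ with rfl | hγ
        exacts [inLang (Set.subset_union_left.trans hl), w.lang _ _ hγ]
      · rw [add_of_ne hi] at hγ
        exact w.lang _ _ hγ)
    (fun i hi => by rw [add_of_ne hi.ne', w.th_empty i hi])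
    (Set.subset_union_right.trans hl) fun hc => h (mem_of_cl hl (cl_of_add hc))
  refine ⟨u, ⟨h1.symm, h2, fun i => (subset_add i).trans (h3 i)⟩, ?_, h4⟩
  rw [last, h1]
  exact h3 _ mem_add_self

/-- An empty level is put on top of `w`, and by `cl_box_intro` it does not yield `φ`. Saturating all
levels together gives `v`; the lower ones may grow, so the predecessor of `v` is a truncation above
`w`. -/
theorem exists_step_of_box (hl : φ.consts ⊆ w.act) (h : φ.box ∉ w.last) :
    ∃ u v, w.le u ∧ u.Step v ∧ φ ∉ v.last := by
  obtain ⟨v, h1, h2, h3, h4⟩ := exists_world (A := A) (Λ := Λ) (n := w.n + 1) (old := w.act)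
    (X := w.th) (ψ := φ) w.base_mem (fun c hc => (w.lev_le c hc).trans (Nat.le_succ _)) w.coinf
    w.lang (fun i hi => w.th_empty i (by omega)) hl
    fun hc => h (mem_of_cl hl (cl_box_intro (w.th_empty _ (Nat.lt_succ_self _)) hc))
  refine ⟨v.trunc w.n (by omega), v, ⟨rfl, fun c hc => ⟨h2 hc, w.lev_le c hc⟩, fun i γ hγ =>
    ⟨h3 i hγ, ?_⟩⟩, step_trunc h1, h4⟩
  by_contra hi
  rw [w.th_empty i (by omega)] at hγ
  exact hγ.elim

/-- A constant of level exactly `w.n` outside `w` is generic for the last theory: deriving the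
instance at it would derive the universal sentence. -/
theorem exists_le_of_all {x : ℕ} {χ : Formula σ} (hχ : χ.IsOnePlace x) (hl : χ.consts ⊆ w.act)
    (h : ⟨.all x χ, Formula.isSentence_all.2 hχ⟩ ∉ w.last) :
    ∃ u e, w.le u ∧ e ∈ u.act ∧ ⟨χ.subst x e, hχ.subst e⟩ ∉ u.last := by
  obtain ⟨e, he, hew⟩ := (w.coinf w.n).nonempty
  have hlev : Λ.lev e = w.n := he
  obtain ⟨u, h1, h2, h3, h4⟩ := exists_world (A := A) (Λ := Λ) (n := w.n) (old := insert e w.act)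
    (X := w.th) (ψ := ⟨χ.subst x e, hχ.subst e⟩) (fun c => .inr (w.base_mem c))
    (by
      rintro c (rfl | hc)
      exacts [hlev.le, w.lev_le c hc])
    (fun i => ((w.coinf i).sdiff (Set.finite_singleton e)).mono fun c hc =>
      ⟨hc.1.1, fun h => h.elim hc.2 hc.1.2⟩)
    (fun i γ hγ => (w.lang i γ hγ).mono (Set.subset_insert _ _) le_rfl) w.th_empty
    (fun c hc => (Formula.mem_consts_subst hc).elim (fun h => .inr (hl h)) .inl)
    fun hc => h (mem_of_cl hl (cl_all hχ hlev (fun h => hew (hl h))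
      (fun γ hγ h => hew (consts_subset hγ h)) hc))
  exact ⟨u, e, ⟨h1.symm, (Set.subset_insert _ _).trans h2, h3⟩, h2 (.inl rfl), h4⟩

end World

/-! ### The canonical model and the truth lemma -/

namespace Formula

/-- Rename the constants of a formula by `f` and replace its free variables by constants. -/
def close (f : σ.Const → σ.Const) (g : ℕ → σ.Const) (φ : Formula σ) : Sent σ :=
  ⟨φ.bind f fun x => .const (g x), Set.eq_empty_iff_forall_notMem.2 fun _ hy => by
    cases (mem_freeVars_bind (safe_const g) hy).2⟩

variable {f : σ.Const → σ.Const} {g : ℕ → σ.Const} {φ : Formula σ} {x : ℕ}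

theorem isOnePlace_bind_update (f : σ.Const → σ.Const) (g : ℕ → σ.Const) (φ : Formula σ) (x : ℕ) :
    (φ.bind f (update (fun y => .const (g y)) x (.var x))).IsOnePlace x := by
  intro y hy
  by_contra hne
  have := (mem_freeVars_bind ((safe_const g).update_var x) hy).2
  rw [update_of_ne hne] at this
  cases this

theorem close_update (f : σ.Const → σ.Const) (g : ℕ → σ.Const) (φ : Formula σ) (x : ℕ)
    (c : σ.Const) : φ.close f (update g x c) =
      ⟨(φ.bind f (update (fun y => .const (g y)) x (.var x))).subst x c,
        (isOnePlace_bind_update f g φ x).subst c⟩ := by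
  refine Subtype.ext ?_
  show φ.bind f _ = Formula.subst _ _ _
  rw [subst_eq_bind, bind_bind _ ((safe_const g).update_var x)]
  refine bind_congr (fun _ _ => rfl) fun y _ => ?_
  by_cases hy : y = x
  · subst hy
    simp [Term.bind]
  · simp [Term.bind, hy]

theorem consts_close {act : Set σ.Const} (hf : ∀ c, f c ∈ act) (hg : ∀ x, g x ∈ act) :
    (φ.close f g).consts ⊆ act := by
  intro d hd
  rcases mem_consts_bind hd with ⟨c, -, rfl⟩ | ⟨x, -, h⟩
  · exact hf c
  · rw [← Term.const.inj h]
    exact hg x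

theorem close_of_isSentence (h : φ.IsSentence) (f : σ.Const → σ.Const) (g : ℕ → σ.Const) :
    (φ.close f g).1 = φ.map f := by
  refine bind_congr (fun _ _ => rfl) fun y hy => ?_
  rw [show φ.freeVars = ∅ from h] at hy
  exact hy.elim

end Formula

/-- The sentence `c ≡ d`. -/
def Sent.eq (c d : σ.Const) : Sent σ :=
  ⟨.eq (.const c) (.const d), Set.eq_empty_iff_forall_notMem.2 fun _ h => by
    rcases h with h | h <;> cases h⟩

/-- The sentence `P(d₁, …, dₙ)`. -/
def Sent.rel (P : σ.Pred) (d : Fin (σ.arity P) → σ.Const) : Sent σ :=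
  ⟨.rel P fun i => .const (d i), Set.eq_empty_iff_forall_notMem.2 fun _ h => by
    obtain ⟨i, h⟩ := h
    cases h⟩

theorem consts_eq_subset {act : Set σ.Const} {c d : σ.Const} (hc : c ∈ act) (hd : d ∈ act) :
    (Sent.eq c d).consts ⊆ act := by
  rintro e (h | h)
  · rwa [← Term.const.inj h]
  · rwa [← Term.const.inj h]

theorem consts_rel_subset {act : Set σ.Const} {P : σ.Pred} {d : Fin (σ.arity P) → σ.Const}
    (hd : ∀ i, d i ∈ act) : (Sent.rel P d).consts ⊆ act := by
  rintro e ⟨i, h⟩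
  rw [← Term.const.inj h]
  exact hd i

section Identity

variable {A : Set (Formula σ)}

theorem cls_eq_refl (c : σ.Const) : cls A (Sent.eq c c) = ⊤ := cls_eq_top.2 (.id_refl c)

theorem cls_eq_inf_le {x : ℕ} {φ : Formula σ} (h : φ.IsOnePlace x) (hm : φ.ModalFree)
    (c d : σ.Const) :
    cls A (Sent.eq c d) ⊓ cls A ⟨φ.subst x c, h.subst c⟩ ≤ cls A ⟨φ.subst x d, h.subst d⟩ :=
  le_himp_iff.1 (show Ent A (Sent.eq c d) (.imp _ _) from Thm.id_sub c d h hm)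

theorem cls_eq_symm (c d : σ.Const) : cls A (Sent.eq c d) ≤ cls A (Sent.eq d c) := by
  have h : (Formula.eq (.var 0) (.const c) : Formula σ).IsOnePlace 0 := by
    rintro x (h | h)
    · exact (Term.var.inj h).symm
    · cases h
  refine le_trans (le_inf le_rfl ?_) (cls_eq_inf_le h trivial c d)
  exact le_top.trans (cls_eq_refl c).ge

theorem cls_eq_trans (c d e : σ.Const) :
    cls A (Sent.eq c d) ⊓ cls A (Sent.eq d e) ≤ cls A (Sent.eq c e) := by
  have h : (Formula.eq (.const c) (.var 0) : Formula σ).IsOnePlace 0 := by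
    rintro x (h | h)
    · cases h
    · exact (Term.var.inj h).symm
  rw [inf_comm]
  exact cls_eq_inf_le h trivial d e

theorem cls_rel_update (P : σ.Pred) (d : Fin (σ.arity P) → σ.Const) (i : Fin (σ.arity P))
    (c : σ.Const) : cls A (Sent.eq (d i) c) ⊓ cls A (Sent.rel P d) ≤
      cls A (Sent.rel P (update d i c)) := by
  -- The variable marks position `i` only, so other occurrences of the constant `d i` are left
  -- alone.
  let φ : Formula σ := .rel P (update (fun j => .const (d j)) i (.var 0))
  have h : φ.IsOnePlace 0 := by
    rintro x ⟨j, hj⟩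
    by_cases hji : j = i
    · subst hji
      rw [update_self] at hj
      exact (Term.var.inj hj).symm
    · rw [update_of_ne hji] at hj
      cases hj
  have hsub : ∀ c, (⟨φ.subst 0 c, h.subst c⟩ : Sent σ) = Sent.rel P (update d i c) := by
    intro c
    refine Subtype.ext ?_
    simp only [φ, Formula.subst, Sent.rel, Formula.rel.injEq, heq_eq_eq, true_and]
    funext j
    by_cases hji : j = i
    · subst hji
      simp [Term.subst]
    · simp [Term.subst, hji]
  have := cls_eq_inf_le (A := A) h trivial (d i) c
  rwa [hsub, hsub, update_eq_self] at this

end Identity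

section Canonical

variable {A : Set (Formula σ)} {Λ : Levels σ}

/-- The relations between worlds that may serve as the modal relation of the canonical frame. -/
structure Admissible (M : World A Λ → World A Λ → Prop) : Prop where
  of_step : ∀ w v, w.Step v → M w v
  fc1 : ∀ w v v', M w v → v.le v' → ∃ w', w.le w' ∧ M w' v'
  fc2 : ∀ w w' v, w.le w' → M w v → ∃ v', v.le v' ∧ M w' v'
  act_subset : ∀ w v, M w v → w.act ⊆ v.act
  box : ∀ w v φ, M w v → Sent.box φ ∈ w.last → φ ∈ v.last
  dia : ∀ w v φ, M w v → φ ∈ v.last → φ.consts ⊆ w.act → φ.dia ∈ w.last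

/-- The canonical frame. -/
def canonFrame {M : World A Λ → World A Λ → Prop} (hM : Admissible M) : Frame.{u, u} where
  W := World A Λ
  D := σ.Const
  le := World.le
  M := M
  le_refl := World.le_refl
  le_trans _ _ _ := World.le.trans
  le_antisymm _ _ := World.le.antisymm
  fc1 := hM.fc1
  fc2 := hM.fc2
  dom w := w.act
  dom_le _ _ h := h.2.1
  dom_M := hM.act_subset
  eqv w c d := (c ∈ w.act ∧ d ∈ w.act) ∧ Sent.eq c d ∈ w.last
  eqv_dom _ _ _ h := h.1
  eqv_refl _ d hd := ⟨⟨hd, hd⟩, World.mem_of_eq_top (consts_eq_subset hd hd) (cls_eq_refl d)⟩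
  eqv_symm _ c d h := ⟨h.1.symm, World.up h.2 (consts_eq_subset h.1.2 h.1.1) (cls_eq_symm c d)⟩
  eqv_trans _ c d e h h' :=
    ⟨⟨h.1.1, h'.1.2⟩, World.up₂ h.2 h'.2 (consts_eq_subset h.1.1 h'.1.2) (cls_eq_trans c d e)⟩
  eqv_le _ _ _ _ h h' := ⟨⟨h.2.1 h'.1.1, h.2.1 h'.1.2⟩, h.last h'.2⟩

/-- The arguments are exchanged one position at a time, by induction on the set of positions already
exchanged. -/
theorem World.rel_mem_of_eqv {w : World A Λ} {P : σ.Pred} {d e : Fin (σ.arity P) → σ.Const}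
    (he : ∀ i, e i ∈ w.act) (hde : ∀ i, Sent.eq (d i) (e i) ∈ w.last)
    (hd : Sent.rel P d ∈ w.last) (hdw : ∀ i, d i ∈ w.act) : Sent.rel P e ∈ w.last := by
  have key : ∀ s : Finset (Fin (σ.arity P)), Sent.rel P (s.piecewise e d) ∈ w.last := by
    intro s
    induction s using Finset.induction_on with
    | empty => rwa [Finset.piecewise_empty]
    | insert i s hi ih =>
      rw [Finset.piecewise_insert]
      have hi' : Sent.eq (s.piecewise e d i) (e i) ∈ w.last := by
        rw [Finset.piecewise_eq_of_notMem _ _ _ hi]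
        exact hde i
      refine World.up₂ hi' ih (consts_rel_subset fun j => ?_) (cls_rel_update P _ i (e i))
      by_cases hji : j = i
      · subst hji
        rw [update_self]
        exact he j
      · rw [update_of_ne hji]
        by_cases hjs : j ∈ s
        · rw [Finset.piecewise_eq_of_mem _ _ _ hjs]
          exact he j
        · rw [Finset.piecewise_eq_of_notMem _ _ _ hjs]
          exact hdw j
  simpa using key Finset.univ

variable {M : World A Λ → World A Λ → Prop} (hM : Admissible M)

/-- The canonical model. -/
def canonInterp : Interp σ (canonFrame hM) where
  const c := Λ.base c
  const_mem c w := World.base_mem w c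
  pred w P := {d | (∀ i, d i ∈ World.act w) ∧ Sent.rel P d ∈ World.last w}
  pred_dom _ _ _ h := h.1
  pred_le _ _ _ h _ hd := ⟨fun i => h.2.1 (hd.1 i), h.last hd.2⟩
  pred_eqv _ _ _ _ h hd := ⟨fun i => (h i).1.2,
    World.rel_mem_of_eqv (fun i => (h i).1.2) (fun i => (h i).2) hd.2 hd.1⟩

theorem deno_canonInterp (g : ℕ → σ.Const) (t : Term σ) :
    t.bind Λ.base (fun x => .const (g x)) = .const ((canonInterp hM).deno g t) := by
  cases t <;> rfl

/-- The truth lemma. Refuting worlds for `→`, `□`, `∀` and a successor for `◇` come from the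
existence theorems, which produce genuine steps; the converse directions for `□` and `◇` need only
that `M` is admissible. -/
theorem sat_canonInterp (φ : Formula σ) (w : World A Λ) (g : ℕ → σ.Const)
    (hg : ∀ x, g x ∈ w.act) :
    (canonInterp hM).Sat w g φ ↔ φ.close Λ.base g ∈ w.last := by
  have hdeno : ∀ (w : World A Λ) (g : ℕ → σ.Const) (t : Term σ), (∀ x, g x ∈ w.act) →
      (canonInterp hM).deno g t ∈ w.act := by
    rintro w g (x | c) hg
    exacts [hg x, w.base_mem c]
  have hl : ∀ (φ : Formula σ) (w : World A Λ) (g : ℕ → σ.Const), (∀ x, g x ∈ w.act) →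
      (φ.close Λ.base g).consts ⊆ w.act :=
    fun φ w g hg => Formula.consts_close w.base_mem hg
  have hup : ∀ (w : World A Λ) (g : ℕ → σ.Const) (x : ℕ) (d : σ.Const), (∀ x, g x ∈ w.act) →
      d ∈ w.act → ∀ y, update g x d y ∈ w.act := by
    intro w g x d hg hd y
    by_cases hy : y = x
    · subst hy
      rwa [update_self]
    · rw [update_of_ne hy]
      exact hg y
  induction φ generalizing w g with
  | rel P ts =>
    have h : (Formula.rel P ts).close Λ.base g =
        Sent.rel P fun i => (canonInterp hM).deno g (ts i) := by
      refine Subtype.ext ?_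
      simp only [Formula.close, Formula.bind, deno_canonInterp hM, Sent.rel]
    rw [h]
    exact ⟨fun h => h.2, fun h => ⟨fun i => hdeno w g _ hg, h⟩⟩
  | eq s t =>
    have h : (Formula.eq s t).close Λ.base g =
        Sent.eq ((canonInterp hM).deno g s) ((canonInterp hM).deno g t) := by
      refine Subtype.ext ?_
      simp only [Formula.close, Formula.bind, deno_canonInterp hM, Sent.eq]
    rw [h]
    exact ⟨fun h => h.2, fun h => ⟨⟨hdeno w g _ hg, hdeno w g _ hg⟩, h⟩⟩
  | bot => exact ⟨fun h => h.elim, fun h => (World.bot_notMem h).elim⟩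
  | conj φ ψ ih1 ih2 =>
    exact (and_congr (ih1 w g hg) (ih2 w g hg)).trans World.conj_mem_iff.symm
  | disj φ ψ ih1 ih2 =>
    exact (or_congr (ih1 w g hg) (ih2 w g hg)).trans
      (World.disj_mem_iff (hl φ w g hg) (hl ψ w g hg)).symm
  | imp φ ψ ih1 ih2 =>
    constructor
    · intro h
      by_contra hcon
      obtain ⟨u, hu, h1, h2⟩ := World.exists_le_of_imp (φ := φ.close Λ.base g)
        (ψ := ψ.close Λ.base g) (hl (φ.imp ψ) w g hg) hcon
      have hgu : ∀ x, g x ∈ u.act := fun x => hu.2.1 (hg x)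
      exact h2 ((ih2 u g hgu).1 (h u hu ((ih1 u g hgu).2 h1)))
    · intro h u hu h1
      have hgu : ∀ x, g x ∈ u.act := fun x => hu.2.1 (hg x)
      have h' : (φ.close Λ.base g).imp (ψ.close Λ.base g) ∈ u.last := hu.last h
      refine (ih2 u g hgu).2 (World.up₂ h' ((ih1 u g hgu).1 h1) (hl ψ u g hgu) ?_)
      rw [cls_imp, himp_inf_self]
      exact inf_le_left
  | box φ ih =>
    constructor
    · intro h
      by_contra hcon
      obtain ⟨u, v, hu, hv, h1⟩ := World.exists_step_of_box (hl φ w g hg) hcon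
      exact h1 ((ih v g fun x => hv.act_subset (hu.2.1 (hg x))).1 (h u v hu (hM.of_step _ _ hv)))
    · intro h u v hu hv
      exact (ih v g fun x => hM.act_subset u v hv (hu.2.1 (hg x))).2
        (hM.box u v (φ.close Λ.base g) hv (hu.last h))
  | dia φ ih =>
    constructor
    · rintro ⟨v, hv, h⟩
      exact hM.dia w v _ hv ((ih v g fun x => hM.act_subset w v hv (hg x)).1 h) (hl φ w g hg)
    · intro h
      obtain ⟨v, hv, h1⟩ := World.exists_step_of_dia (φ := φ.close Λ.base g) h
      exact ⟨v, hM.of_step w v hv, (ih v g fun x => hv.act_subset (hg x)).2 h1⟩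
  | all x φ ih =>
    have hone := Formula.isOnePlace_bind_update Λ.base g φ x
    constructor
    · intro h
      by_contra hcon
      obtain ⟨u, e, hu, he, h1⟩ := World.exists_le_of_all hone (hl (.all x φ) w g hg) hcon
      have hgu : ∀ x, g x ∈ u.act := fun x => hu.2.1 (hg x)
      rw [← Formula.close_update] at h1
      exact h1 ((ih u _ (hup u g x e hgu he)).1 (h u hu e he))
    · intro h u hu (e : σ.Const) he
      have hgu : ∀ x, g x ∈ u.act := fun x => hu.2.1 (hg x)
      refine (ih u (update g x e) (hup u g x e hgu he)).2 ?_
      have hlu := hl φ u (update g x e) (hup u g x e hgu he)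
      rw [Formula.close_update] at hlu ⊢
      exact World.up (hu.last h) hlu (cls_all_le hone e)
  | ex x φ ih =>
    have hone := Formula.isOnePlace_bind_update Λ.base g φ x
    constructor
    · rintro ⟨(e : σ.Const), he, h⟩
      have h1 := (ih w (update g x e) (hup w g x e hg he)).1 h
      rw [Formula.close_update] at h1
      exact World.up h1 (hl (.ex x φ) w g hg) (cls_le_ex hone e)
    · intro h
      obtain ⟨e, he, -, ψ, hψ, h1⟩ := w.henkin _ le_rfl _ h x _ rfl
      refine ⟨e, he, (ih w _ (hup w g x e hg he)).2 ?_⟩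
      rw [Formula.close_update]
      rwa [show (⟨_, hone.subst e⟩ : Sent σ) = ψ from Subtype.ext h1.symm]

end Canonical

/-! ### Soundness -/

section Soundness

variable {F : Frame.{v, w}}

/-- Truth at a world, with the constants interpreted by `κ` in place of the interpretation of the
model, so that they need not lie in the domains of all worlds. -/
def Interp.Holds (I : Interp σ F) (κ : σ.Const → F.D) : F.W → (ℕ → F.D) → Formula σ → Prop
  | a, g, .rel P ts => (fun i => (ts i).rec g κ) ∈ I.pred a P
  | a, g, .eq s t => F.eqv a (s.rec g κ) (t.rec g κ)
  | _, _, .bot => False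
  | a, g, .conj φ ψ => I.Holds κ a g φ ∧ I.Holds κ a g ψ
  | a, g, .disj φ ψ => I.Holds κ a g φ ∨ I.Holds κ a g ψ
  | a, g, .imp φ ψ => ∀ b, F.le a b → I.Holds κ b g φ → I.Holds κ b g ψ
  | a, g, .box φ => ∀ b c, F.le a b → F.M b c → I.Holds κ c g φ
  | a, g, .dia φ => ∃ b, F.M a b ∧ I.Holds κ b g φ
  | a, g, .all x φ => ∀ b, F.le a b → ∀ d ∈ F.dom b, I.Holds κ b (update g x d) φ
  | a, g, .ex x φ => ∃ d ∈ F.dom a, I.Holds κ a (update g x d) φ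

namespace Interp

variable {I : Interp σ F} {κ κ' : σ.Const → F.D} {a b : F.W} {g g' : ℕ → F.D} {φ : Formula σ}

theorem holds_const : I.Holds I.const a g φ ↔ I.Sat a g φ := by
  have ht : ∀ (g : ℕ → F.D) (t : Term σ), (t.rec g I.const : F.D) = I.deno g t := by
    rintro g (x | c) <;> rfl
  induction φ generalizing a g with
  | rel P ts => simp only [Holds, Sat, ht]
  | eq s t => simp only [Holds, Sat, ht]
  | bot => rfl
  | conj φ ψ ih1 ih2 | disj φ ψ ih1 ih2 | imp φ ψ ih1 ih2 => simp only [Holds, Sat, ih1, ih2]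
  | box φ ih | dia φ ih | all x φ ih | ex x φ ih => simp only [Holds, Sat, ih]

theorem Holds.mono (hab : F.le a b) (h : I.Holds κ a g φ) : I.Holds κ b g φ := by
  induction φ generalizing a b g with
  | rel P ts => exact I.pred_le a b P hab h
  | eq s t => exact F.eqv_le a b _ _ hab h
  | bot => exact h
  | conj φ ψ ih1 ih2 => exact ⟨ih1 hab h.1, ih2 hab h.2⟩
  | disj φ ψ ih1 ih2 => exact h.imp (ih1 hab) (ih2 hab)
  | imp φ ψ ih1 ih2 => exact fun c hc => h c (F.le_trans _ _ _ hab hc)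
  | box φ ih => exact fun c d hc => h c d (F.le_trans _ _ _ hab hc)
  | dia φ ih =>
    obtain ⟨c, hc, h⟩ := h
    obtain ⟨d, hd, hbd⟩ := F.fc2 _ _ _ hab hc
    exact ⟨d, hbd, ih hd h⟩
  | all x φ ih => exact fun c hc => h c (F.le_trans _ _ _ hab hc)
  | ex x φ ih =>
    obtain ⟨d, hd, h⟩ := h
    exact ⟨d, F.dom_le _ _ hab hd, ih hab h⟩

theorem update_eq_on {α : Type*} {S : Set ℕ} {g g' : ℕ → α} {x : ℕ} (d : α)
    (h : ∀ y ∈ S \ {x}, g y = g' y) : ∀ y ∈ S, update g x d y = update g' x d y := by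
  intro y hy
  by_cases hyx : y = x
  · subst hyx
    simp
  · rw [update_of_ne hyx, update_of_ne hyx]
    exact h y ⟨hy, hyx⟩

theorem holds_congr (hκ : ∀ c ∈ φ.consts, κ c = κ' c) (hg : ∀ x ∈ φ.freeVars, g x = g' x) :
    I.Holds κ a g φ ↔ I.Holds κ' a g' φ := by
  have ht : ∀ (g g' : ℕ → F.D) (t : Term σ), (∀ c, t = .const c → κ c = κ' c) →
      (∀ x, t = .var x → g x = g' x) → (t.rec g κ : F.D) = t.rec g' κ' := by
    rintro g g' (x | c) h1 h2
    exacts [h2 x rfl, h1 c rfl]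
  induction φ generalizing a g g' with
  | rel P ts =>
    have : (fun i => ((ts i).rec g κ : F.D)) = fun i => (ts i).rec g' κ' :=
      funext fun i => ht g g' _ (fun c h => hκ c ⟨i, h⟩) fun x h => hg x ⟨i, h⟩
    simp only [Holds, this]
  | eq s t =>
    have h1 := ht g g' s (fun c h => hκ c (.inl h)) fun x h => hg x (.inl h)
    have h2 := ht g g' t (fun c h => hκ c (.inr h)) fun x h => hg x (.inr h)
    simp only [Holds, h1, h2]
  | bot => rfl
  | conj φ ψ ih1 ih2 | disj φ ψ ih1 ih2 | imp φ ψ ih1 ih2 =>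
    have h1 := fun a => ih1 (a := a) (fun c h => hκ c (.inl h)) fun x h => hg x (.inl h)
    have h2 := fun a => ih2 (a := a) (fun c h => hκ c (.inr h)) fun x h => hg x (.inr h)
    simp only [Holds, h1, h2]
  | box φ ih | dia φ ih =>
    have h1 := fun a => ih (a := a) hκ hg
    simp only [Holds, h1]
  | all x φ ih | ex x φ ih =>
    have h1 := fun a d => ih (a := a) hκ (update_eq_on d hg)
    simp only [Holds, h1]

theorem holds_sentence (h : φ.IsSentence) : I.Holds κ a g φ ↔ I.Holds κ a g' φ :=
  holds_congr (fun _ _ => rfl) fun x hx => by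
    rw [show φ.freeVars = ∅ from h] at hx
    exact hx.elim

theorem holds_subst (x : ℕ) (c : σ.Const) :
    I.Holds κ a g (φ.subst x c) ↔ I.Holds κ a (update g x (κ c)) φ := by
  have ht : ∀ (g : ℕ → F.D) (t : Term σ),
      ((t.subst x c).rec g κ : F.D) = t.rec (update g x (κ c)) κ := by
    rintro g (y | d)
    · by_cases hy : y = x
      · subst hy
        simp [Term.subst]
      · simp [Term.subst, hy]
    · rfl
  have hq : ∀ (y : ℕ) (φ : Formula σ),
      (∀ a g, I.Holds κ a g (φ.subst x c) ↔ I.Holds κ a (update g x (κ c)) φ) → ∀ a g d,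
      I.Holds κ a (update g y d) (if y = x then φ else φ.subst x c) ↔
        I.Holds κ a (update (update g x (κ c)) y d) φ := by
    intro y φ ih a g d
    split_ifs with hy
    · subst hy
      rw [update_idem]
    · rw [ih, update_comm hy]
  induction φ generalizing a g with
  | rel P ts => simp only [Formula.subst, Holds, ht]
  | eq s t => simp only [Formula.subst, Holds, ht]
  | bot => rfl
  | conj φ ψ ih1 ih2 | disj φ ψ ih1 ih2 | imp φ ψ ih1 ih2 =>
    simp only [Formula.subst, Holds, ih1, ih2]
  | box φ ih | dia φ ih => simp only [Formula.subst, Holds, ih]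
  | all y φ ih | ex y φ ih => simp only [Formula.subst, Holds, hq y φ fun _ _ => ih]

/-- Evaluating a modal-free formula moves only upwards along `≼`, where identity persists. Along `M`
identity may change, so modal formulas are excluded. -/
theorem holds_eqv (hκ : ∀ c, κ c ∈ F.dom a) (hm : φ.ModalFree)
    (hg : ∀ x ∈ φ.freeVars, F.eqv a (g x) (g' x)) : I.Holds κ a g φ ↔ I.Holds κ a g' φ := by
  have ht : ∀ (a : F.W) (g g' : ℕ → F.D) (t : Term σ), (∀ c, κ c ∈ F.dom a) →
      (∀ x, t = .var x → F.eqv a (g x) (g' x)) → F.eqv a (t.rec g κ) (t.rec g' κ) := by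
    rintro a g g' (x | c) h1 h2
    exacts [h2 x rfl, F.eqv_refl a _ (h1 c)]
  have hup : ∀ (a b : F.W) (g g' : ℕ → F.D) (S : Set ℕ) (x : ℕ) (d : F.D), F.le a b →
      d ∈ F.dom b → (∀ y ∈ S \ {x}, F.eqv a (g y) (g' y)) →
      ∀ y ∈ S, F.eqv b (update g x d y) (update g' x d y) := by
    intro a b g g' S x d hab hd h y hy
    by_cases hyx : y = x
    · subst hyx
      simpa using F.eqv_refl b d hd
    · rw [update_of_ne hyx, update_of_ne hyx]
      exact F.eqv_le a b _ _ hab (h y ⟨hy, hyx⟩)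
  have hle : ∀ (a b : F.W) (g g' : ℕ → F.D) (S : Set ℕ), F.le a b →
      (∀ y ∈ S, F.eqv a (g y) (g' y)) → ∀ y ∈ S, F.eqv b (g y) (g' y) :=
    fun a b g g' S hab h y hy => F.eqv_le a b _ _ hab (h y hy)
  induction φ generalizing a g g' with
  | rel P ts =>
    have h1 := fun i => ht a g g' (ts i) hκ fun x h => hg x ⟨i, h⟩
    exact ⟨I.pred_eqv a P _ _ h1, I.pred_eqv a P _ _ fun i => F.eqv_symm _ _ _ (h1 i)⟩
  | eq s t =>
    have h1 := ht a g g' s hκ fun x h => hg x (.inl h)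
    have h2 := ht a g g' t hκ fun x h => hg x (.inr h)
    exact ⟨fun h => F.eqv_trans _ _ _ _ (F.eqv_symm _ _ _ h1) (F.eqv_trans _ _ _ _ h h2),
      fun h => F.eqv_trans _ _ _ _ h1 (F.eqv_trans _ _ _ _ h (F.eqv_symm _ _ _ h2))⟩
  | bot => rfl
  | conj φ ψ ih1 ih2 =>
    exact and_congr (ih1 hκ hm.1 fun x h => hg x (.inl h)) (ih2 hκ hm.2 fun x h => hg x (.inr h))
  | disj φ ψ ih1 ih2 =>
    exact or_congr (ih1 hκ hm.1 fun x h => hg x (.inl h)) (ih2 hκ hm.2 fun x h => hg x (.inr h))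
  | imp φ ψ ih1 ih2 =>
    refine forall_congr' fun b => forall_congr' fun hab => ?_
    have hκ' := fun c => F.dom_le a b hab (hκ c)
    have hg' := hle a b g g' _ hab hg
    exact imp_congr (ih1 hκ' hm.1 fun x h => hg' x (.inl h))
      (ih2 hκ' hm.2 fun x h => hg' x (.inr h))
  | box φ ih | dia φ ih => exact hm.elim
  | all x φ ih =>
    refine forall_congr' fun b => forall_congr' fun hab => forall_congr' fun d =>
      forall_congr' fun hd => ?_
    exact ih (fun c => F.dom_le a b hab (hκ c)) hm (hup a b g g' _ x d hab hd hg)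
  | ex x φ ih =>
    refine exists_congr fun d => and_congr_right fun hd => ?_
    exact ih hκ hm (hup a a g g' _ x d (F.le_refl a) hd hg)

end Interp

/-- Truth at all worlds of a frame, for all interpretations of the constants by elements of the
domain of the world. -/
def Valid (F : Frame.{v, w}) (φ : Formula σ) : Prop :=
  ∀ (I : Interp σ F) (κ : σ.Const → F.D) (a : F.W) (g : ℕ → F.D), (∀ c, κ c ∈ F.dom a) →
    I.Holds κ a g φ

theorem holds_inst (I : Interp σ F) (κ : σ.Const → F.D) (g : ℕ → F.D) (s : ℕ → Formula σ)
    {p : PropForm} (hp : IPC p) (a : F.W) : I.Holds κ a g (p.inst s) := by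
  induction hp generalizing a with
  | k p q => exact fun b _ h c hc _ => h.mono hc
  | s p q r =>
    exact fun b _ h c hc h' d hd h'' =>
      h d (F.le_trans _ _ _ hc hd) h'' d (F.le_refl d) (h' d hd h'')
  | conj_left p q => exact fun b _ h => h.1
  | conj_right p q => exact fun b _ h => h.2
  | conj_intro p q => exact fun b _ h c hc h' => ⟨h.mono hc, h'⟩
  | disj_left p q => exact fun b _ h => .inl h
  | disj_right p q => exact fun b _ h => .inr h
  | disj_elim p q r =>
    exact fun b _ h c hc h' d hd h'' => h''.elim (h d (F.le_trans _ _ _ hc hd)) (h' d hd)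
  | exfalso p => exact fun b _ h => h.elim
  | mp _ _ ih1 ih2 => exact ih1 a a (F.le_refl a) (ih2 a)

theorem valid_of_thm {A : Set (Formula σ)} (hA : ∀ φ ∈ A, Valid F φ) {φ : Formula σ}
    (h : Thm A φ) : Valid F φ := by
  induction h with
  | extra h => exact hA _ h
  | int s _ hp => exact fun I κ a g _ => holds_inst I κ g s hp a
  | box_conj _ _ =>
    refine fun I κ a g _ => ⟨fun b _ h => ⟨fun c d hc hd => (h c d hc hd).1,
      fun c d hc hd => (h c d hc hd).2⟩, fun b _ h c d hc hd => ⟨h.1 c d hc hd, h.2 c d hc hd⟩⟩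
  | box_top => exact fun I κ a g _ b c _ _ d _ h => h
  | dia_disj _ _ =>
    refine fun I κ a g _ => ⟨?_, ?_⟩
    · rintro b _ ⟨c, hc, h | h⟩
      exacts [.inl ⟨c, hc, h⟩, .inr ⟨c, hc, h⟩]
    · rintro b _ (⟨c, hc, h⟩ | ⟨c, hc, h⟩)
      exacts [⟨c, hc, .inl h⟩, ⟨c, hc, .inr h⟩]
  | dia_bot =>
    rintro I κ a g _ b _ ⟨c, _, h⟩
    exact h
  | fs1 _ _ =>
    intro I κ a g _ b _ h c d hc hcd e hde h'
    -- The antecedent holds only at `e` above the modal successor `d`; (FC1) makes `e` itself a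
    -- modal successor of some `c'` above `c`.
    obtain ⟨c', hcc', hM⟩ := F.fc1 _ _ _ hcd hde
    exact h c' (F.le_trans _ _ _ hc hcc') ⟨e, hM, h'⟩ c' e (F.le_refl c') hM
  | fs2 _ _ =>
    rintro I κ a g _ b _ h c hc h'
    obtain ⟨d, hd, h⟩ := h.mono hc
    exact ⟨d, hd, h d (F.le_refl d) (h' c d (F.le_refl c) hd)⟩
  | univ c _ =>
    intro I κ a g hκ b hb h
    exact (Interp.holds_subst _ _).2 (h b (F.le_refl b) _ (F.dom_le _ _ hb (hκ c)))
  | exist c _ =>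
    intro I κ a g hκ b hb h
    exact ⟨κ c, F.dom_le _ _ hb (hκ c), (Interp.holds_subst _ _).1 h⟩
  | all_ant _ hψ =>
    rintro I κ a g _ b _ h c hc ⟨d, hd, h'⟩
    exact (Interp.holds_sentence hψ).1 (h c hc d hd c (F.le_refl c) h')
  | all_con hφ _ =>
    intro I κ a g _ b _ h c hc h' d hd e he
    exact h d (F.le_trans _ _ _ hc hd) e he d (F.le_refl d)
      ((Interp.holds_sentence hφ).1 (h'.mono hd))
  | id_refl c => exact fun I κ a g hκ => F.eqv_refl a _ (hκ c)
  | @id_sub x φ c₁ c₂ hφ hm =>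
    intro I κ a g hκ b hb h c hc h'
    rw [Interp.holds_subst] at h' ⊢
    refine (Interp.holds_eqv (fun e => F.dom_le _ _ hc (F.dom_le _ _ hb (hκ e))) hm ?_).1 h'
    intro y hy
    rw [show y = x from hφ hy, update_self, update_self]
    exact F.eqv_le _ _ _ _ hc h
  | mp _ _ ih1 ih2 => exact fun I κ a g hκ => ih1 I κ a g hκ a (F.le_refl a) (ih2 I κ a g hκ)
  | @gen x φ c _ hc _ ih =>
    classical
    intro I κ a g hκ b hb d hd
    -- Here `c` must denote an arbitrary `d` in the domain of `b`, which need not lie in other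
    -- domains; this is why validity quantifies over `κ`.
    have h := ih I (update κ c d) b g fun e => by
      by_cases he : e = c
      · subst he
        rwa [update_self]
      · rw [update_of_ne he]
        exact F.dom_le _ _ hb (hκ e)
    rw [Interp.holds_subst, update_self] at h
    refine (Interp.holds_congr (fun e he => ?_) fun _ _ => rfl).1 h
    exact update_of_ne (by rintro rfl; exact hc he) ..
  | reg_box _ ih =>
    intro I κ a g hκ b hb h c d hc hd
    exact ih I κ d g (fun e => F.dom_M _ _ hd (F.dom_le _ _ hc (F.dom_le _ _ hb (hκ e)))) d
      (F.le_refl d) (h c d hc hd)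
  | reg_dia _ ih =>
    rintro I κ a g hκ b hb ⟨c, hc, h⟩
    exact ⟨c, hc, ih I κ c g (fun e => F.dom_M _ _ hc (F.dom_le _ _ hb (hκ e))) c (F.le_refl c) h⟩

theorem isSound_of_valid {A : Set (Formula σ)} {C : Set Frame.{v, w}}
    (h : ∀ F ∈ C, ∀ φ ∈ A, Valid F φ) : IsSound A C := by
  rintro Γ φ - - ⟨l, hl, hthm⟩ F hF I a hΓ g hg
  have hv := valid_of_thm (h F hF) hthm I I.const a g (fun c => I.const_mem c a) a (F.le_refl a)
  rw [← Interp.holds_const]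
  refine hv ?_
  clear hv hthm
  induction l with
  | nil => exact fun b _ h => h
  | cons γ l ih =>
    exact ⟨Interp.holds_const.2 (hΓ γ (hl γ (by simp)) g hg), ih fun δ hδ => hl δ (by simp [hδ])⟩

theorem valid_axD (hF : ∀ a, ∃ b, F.M a b) : ∀ φ ∈ axD σ, Valid F φ := by
  rintro _ ⟨φ, -, rfl⟩ I κ a g _ b _ h
  obtain ⟨c, hc⟩ := hF b
  exact ⟨c, hc, h b c (F.le_refl b) hc⟩

theorem valid_axTBox (hF : ∀ a, F.M a a) : ∀ φ ∈ axTBox σ, Valid F φ := by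
  rintro _ ⟨φ, -, rfl⟩ I κ a g _ b _ h
  exact h b b (F.le_refl b) (hF b)

theorem valid_axTDia (hF : ∀ a, F.M a a) : ∀ φ ∈ axTDia σ, Valid F φ := by
  rintro _ ⟨φ, -, rfl⟩ I κ a g _ b _ h
  exact ⟨b, hF b, h⟩

theorem valid_ax4Box (hF : ∀ a b c, F.M a b → F.M b c → F.M a c) :
    ∀ φ ∈ ax4Box σ, Valid F φ := by
  rintro _ ⟨φ, -, rfl⟩ I κ a g _ b _ h c d hc hd e f hde hef
  obtain ⟨c', hcc', hM⟩ := F.fc1 _ _ _ hd hde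
  exact h c' f (F.le_trans _ _ _ hc hcc') (hF _ _ _ hM hef)

theorem valid_ax4Dia (hF : ∀ a b c, F.M a b → F.M b c → F.M a c) :
    ∀ φ ∈ ax4Dia σ, Valid F φ := by
  rintro _ ⟨φ, -, rfl⟩ I κ a g _ b _ ⟨c, hc, d, hd, h⟩
  exact ⟨d, hF _ _ _ hc hd, h⟩

theorem valid_axNI (hF : F ∈ idPreserving) : ∀ φ ∈ axNI σ, Valid F φ := by
  rintro _ ⟨c₁, c₂, rfl⟩ I κ a g _ b _ h c d hc hd
  exact hF _ _ hd _ _ (F.eqv_le _ _ _ _ hc h)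

theorem valid_axND (hF : F ∈ idReflecting) : ∀ φ ∈ axND σ, Valid F φ := by
  rintro _ ⟨c₁, c₂, rfl⟩ I κ a g hκ b hb ⟨c, hc, h⟩
  exact hF _ _ hc _ (F.dom_le _ _ hb (hκ c₁)) _ (F.dom_le _ _ hb (hκ c₂)) h

theorem Logic.valid_axioms (L : Logic) (hF : F ∈ L.frames) : ∀ φ ∈ L.axioms σ, Valid F φ := by
  cases L with
  | FOFS => exact fun φ h => h.elim
  | FOFSD => exact valid_axD hF
  | FOFS4 => exact fun φ h => h.elim (valid_ax4Box hF φ) (valid_ax4Dia hF φ)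
  | FOFSD4 =>
    rintro φ ((h | h) | h)
    exacts [valid_axD hF.1 φ h, valid_ax4Box hF.2 φ h, valid_ax4Dia hF.2 φ h]
  | FOFST => exact fun φ h => h.elim (valid_axTBox hF φ) (valid_axTDia hF φ)
  | FOFSS4 =>
    rintro φ (((h | h) | h) | h)
    exacts [valid_axTBox hF.1 φ h, valid_axTDia hF.1 φ h, valid_ax4Box hF.2 φ h,
      valid_ax4Dia hF.2 φ h]

end Soundness

/-! ### Renaming of constants in derivations -/

section Renaming

namespace Formula

theorem map_subst (f : σ.Const → σ.Const) (x : ℕ) (c : σ.Const) (φ : Formula σ) :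
    (φ.subst x c).map f = (φ.map f).subst x (f c) := by
  rw [map, map, subst_eq_bind, subst_eq_bind, bind_bind _ (safe_update_const x c),
    bind_bind _ safe_var]
  refine bind_congr (fun _ _ => rfl) fun y _ => ?_
  by_cases hy : y = x
  · subst hy
    simp [Term.bind]
  · simp [Term.bind, hy]

theorem map_all (f : σ.Const → σ.Const) (x : ℕ) (φ : Formula σ) :
    (all x φ).map f = all x (φ.map f) := by
  simp only [map, bind, update_eq_self]

theorem map_ex (f : σ.Const → σ.Const) (x : ℕ) (φ : Formula σ) :
    (ex x φ).map f = ex x (φ.map f) := by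
  simp only [map, bind, update_eq_self]

theorem map_map (f f' : σ.Const → σ.Const) (φ : Formula σ) :
    (φ.map f).map f' = φ.map (f' ∘ f) := bind_bind φ safe_var

theorem freeVars_map_subset (f : σ.Const → σ.Const) (φ : Formula σ) :
    (φ.map f).freeVars ⊆ φ.freeVars := fun _ h => (mem_freeVars_bind safe_var h).1

theorem IsOnePlace.map {x : ℕ} {φ : Formula σ} (h : φ.IsOnePlace x) (f : σ.Const → σ.Const) :
    (φ.map f).IsOnePlace x := (freeVars_map_subset f φ).trans h

theorem IsSentence.map {φ : Formula σ} (h : φ.IsSentence) (f : σ.Const → σ.Const) :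
    (φ.map f).IsSentence :=
  Set.subset_eq_empty (freeVars_map_subset f φ) h

theorem ModalFree.bind {φ : Formula σ} (h : φ.ModalFree) (f : σ.Const → σ.Const)
    (g : ℕ → Term σ) : (φ.bind f g).ModalFree := by
  induction φ generalizing g with
  | rel | eq | bot => trivial
  | conj φ ψ ih1 ih2 | disj φ ψ ih1 ih2 | imp φ ψ ih1 ih2 => exact ⟨ih1 h.1 g, ih2 h.2 g⟩
  | box φ ih | dia φ ih => exact h.elim
  | all x φ ih | ex x φ ih => exact ih h _

theorem consts_map {f : σ.Const → σ.Const} {φ : Formula σ} {d : σ.Const}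
    (hd : d ∈ (φ.map f).consts) : ∃ c ∈ φ.consts, f c = d := by
  rcases mem_consts_bind hd with h | ⟨x, -, h⟩
  · exact h
  · cases h

theorem map_inst (f : σ.Const → σ.Const) (s : ℕ → Formula σ) (p : PropForm) :
    (p.inst s).map f = p.inst fun n => (s n).map f := by
  induction p with
  | atom n => rfl
  | bot => rfl
  | conj p q ih1 ih2 | disj p q ih1 ih2 | imp p q ih1 ih2 =>
    simp only [PropForm.inst, ← ih1, ← ih2]
    rfl

theorem map_bigConj (f : σ.Const → σ.Const) (l : List (Formula σ)) :
    (bigConj l).map f = bigConj (l.map (Formula.map f)) := by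
  induction l with
  | nil => rfl
  | cons φ l ih =>
    rw [List.map_cons, bigConj, bigConj, ← ih]
    rfl

end Formula

/-- A set of axioms closed under renaming of constants. -/
def MapClosed (A : Set (Formula σ)) : Prop :=
  ∀ φ ∈ A, ∀ f : σ.Const → σ.Const, φ.map f ∈ A

theorem Thm.map {A : Set (Formula σ)} (hA : MapClosed A) {φ : Formula σ} (h : Thm A φ)
    (f : σ.Const → σ.Const) : Thm A (φ.map f) := by
  induction h generalizing f with
  | extra h => exact .extra (hA _ h f)
  | int s hs hp =>
    rw [Formula.map_inst]
    exact .int _ (fun n => (hs n).map f) hp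
  | box_conj hφ hψ => exact .box_conj (hφ.map f) (hψ.map f)
  | box_top => exact .box_top
  | dia_disj hφ hψ => exact .dia_disj (hφ.map f) (hψ.map f)
  | dia_bot => exact .dia_bot
  | fs1 hφ hψ => exact .fs1 (hφ.map f) (hψ.map f)
  | fs2 hφ hψ => exact .fs2 (hφ.map f) (hψ.map f)
  | @univ x φ c h =>
    show Thm A (.imp ((Formula.all x φ).map f) ((φ.subst x c).map f))
    rw [Formula.map_all, Formula.map_subst]
    exact .univ (f c) (h.map f)
  | @exist x φ c h =>
    show Thm A (.imp ((φ.subst x c).map f) ((Formula.ex x φ).map f))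
    rw [Formula.map_ex, Formula.map_subst]
    exact .exist (f c) (h.map f)
  | @all_ant x φ ψ h hψ =>
    show Thm A (.imp ((Formula.all x (.imp φ ψ)).map f) (.imp ((Formula.ex x φ).map f) (ψ.map f)))
    rw [Formula.map_all, Formula.map_ex]
    exact .all_ant (h.map f) (hψ.map f)
  | @all_con x φ ψ hφ h =>
    show Thm A (.imp ((Formula.all x (.imp φ ψ)).map f) (.imp (φ.map f) ((Formula.all x ψ).map f)))
    rw [Formula.map_all, Formula.map_all]
    exact .all_con (hφ.map f) (h.map f)
  | id_refl c => exact .id_refl (f c)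
  | @id_sub x φ c₁ c₂ h hm =>
    show Thm A (.imp (.eq (.const (f c₁)) (.const (f c₂)))
      (.imp ((φ.subst x c₁).map f) ((φ.subst x c₂).map f)))
    rw [Formula.map_subst, Formula.map_subst]
    exact .id_sub _ _ (h.map f) (hm.bind f _)
  | mp _ _ ih1 ih2 => exact .mp (ih1 f) (ih2 f)
  | @gen x φ c h hc _ ih =>
    classical
    -- As `f` need not be injective, `f c` may occur in the renamed formula; the generalized
    -- constant is therefore sent to a fresh `d`.
    obtain ⟨d, hd⟩ := (φ.map f).exists_const_notMem
    have h1 := ih (update f c d)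
    have h2 : φ.map (update f c d) = φ.map f :=
      Formula.bind_congr (fun e he => update_of_ne (by rintro rfl; exact hc he) ..) fun _ _ => rfl
    rw [Formula.map_subst, update_self, h2] at h1
    rw [Formula.map_all]
    exact .gen d (h.map f) hd h1
  | reg_box _ ih => exact .reg_box (ih f)
  | reg_dia _ ih => exact .reg_dia (ih f)

theorem MapClosed.union {A B : Set (Formula σ)} (hA : MapClosed A) (hB : MapClosed B) :
    MapClosed (A ∪ B) := fun φ h f => h.imp (fun h => hA φ h f) fun h => hB φ h f

theorem mapClosed_axD : MapClosed (axD σ) := by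
  rintro _ ⟨φ, h, rfl⟩ f
  exact ⟨φ.map f, h.map f, rfl⟩

theorem mapClosed_axTBox : MapClosed (axTBox σ) := by
  rintro _ ⟨φ, h, rfl⟩ f
  exact ⟨φ.map f, h.map f, rfl⟩

theorem mapClosed_axTDia : MapClosed (axTDia σ) := by
  rintro _ ⟨φ, h, rfl⟩ f
  exact ⟨φ.map f, h.map f, rfl⟩

theorem mapClosed_ax4Box : MapClosed (ax4Box σ) := by
  rintro _ ⟨φ, h, rfl⟩ f
  exact ⟨φ.map f, h.map f, rfl⟩

theorem mapClosed_ax4Dia : MapClosed (ax4Dia σ) := by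
  rintro _ ⟨φ, h, rfl⟩ f
  exact ⟨φ.map f, h.map f, rfl⟩

theorem mapClosed_axNI : MapClosed (axNI σ) := by
  rintro _ ⟨c₁, c₂, rfl⟩ f
  exact ⟨f c₁, f c₂, rfl⟩

theorem mapClosed_axND : MapClosed (axND σ) := by
  rintro _ ⟨c₁, c₂, rfl⟩ f
  exact ⟨f c₁, f c₂, rfl⟩

theorem Logic.mapClosed_axioms (L : Logic) : MapClosed (L.axioms σ) := by
  cases L with
  | FOFS => exact fun φ h => h.elim
  | FOFSD => exact mapClosed_axD
  | FOFS4 => exact mapClosed_ax4Box.union mapClosed_ax4Dia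
  | FOFSD4 => exact (mapClosed_axD.union mapClosed_ax4Box).union mapClosed_ax4Dia
  | FOFST => exact mapClosed_axTBox.union mapClosed_axTDia
  | FOFSS4 =>
    exact ((mapClosed_axTBox.union mapClosed_axTDia).union mapClosed_ax4Box).union mapClosed_ax4Dia

end Renaming

/-- The set of constants is equinumerous with itself plus `ℕ × ℕ`: the first summand is the copy
inside level `0`, and the row `{i} × ℕ` supplies level `i`. -/
theorem exists_levels (σ : Signature.{u}) : Nonempty (Levels σ) := by
  have := σ.countable_const
  have := σ.infinite_const
  obtain ⟨e⟩ : Nonempty (σ.Const ≃ σ.Const ⊕ ℕ × ℕ) := nonempty_equiv_of_countable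
  refine ⟨⟨fun c => (e c).elim (fun _ => 0) Prod.fst, fun c => e.symm (.inl c),
    e.symm.injective.comp Sum.inl_injective, fun c => by simp, fun i => ?_⟩⟩
  have hinj : Injective fun k : ℕ => e.symm (.inr (i, k)) := fun k l h => by simpa using h
  refine (Set.infinite_range_of_injective hinj).mono ?_
  rintro _ ⟨k, rfl⟩
  refine ⟨by simp, ?_⟩
  rintro ⟨c, hc⟩
  simp at hc

/-! ### Transport of frames between universes -/

section Transport

variable {W' : Type v} {D' : Type w} (F : Frame.{u, u}) (p : W' ≃ F.W) (q : D' ≃ F.D)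

/-- Transport of a frame along bijections. -/
def Frame.transport : Frame.{v, w} where
  W := W'
  D := D'
  le a b := F.le (p a) (p b)
  M a b := F.M (p a) (p b)
  le_refl _ := F.le_refl _
  le_trans _ _ _ := F.le_trans _ _ _
  le_antisymm _ _ h h' := p.injective (F.le_antisymm _ _ h h')
  fc1 a b b' h h' := by
    obtain ⟨a', h1, h2⟩ := F.fc1 _ _ _ h h'
    exact ⟨p.symm a', by rwa [p.apply_symm_apply], by rwa [p.apply_symm_apply]⟩
  fc2 a a' b h h' := by
    obtain ⟨b', h1, h2⟩ := F.fc2 _ _ _ h h'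
    exact ⟨p.symm b', by rwa [p.apply_symm_apply], by rwa [p.apply_symm_apply]⟩
  dom a := {d | q d ∈ F.dom (p a)}
  dom_le _ _ h _ hd := F.dom_le _ _ h hd
  dom_M _ _ h _ hd := F.dom_M _ _ h hd
  eqv a d e := F.eqv (p a) (q d) (q e)
  eqv_dom _ _ _ h := F.eqv_dom _ _ _ h
  eqv_refl _ _ h := F.eqv_refl _ _ h
  eqv_symm _ _ _ h := F.eqv_symm _ _ _ h
  eqv_trans _ _ _ _ h h' := F.eqv_trans _ _ _ _ h h'
  eqv_le _ _ _ _ h h' := F.eqv_le _ _ _ _ h h'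

/-- Transport of an interpretation along bijections. -/
def Interp.transport (I : Interp σ F) : Interp σ (F.transport p q) where
  const c := q.symm (I.const c)
  const_mem c a := by
    show q (q.symm _) ∈ F.dom (p a)
    rw [q.apply_symm_apply]
    exact I.const_mem c _
  pred a P := {d | (fun i => q (d i)) ∈ I.pred (p a) P}
  pred_dom _ _ _ h := I.pred_dom _ _ _ h
  pred_le _ _ _ h _ hd := I.pred_le _ _ _ h hd
  pred_eqv _ _ _ _ h hd := I.pred_eqv _ _ _ _ h hd

variable {F}

theorem Interp.sat_transport (I : Interp σ F) (φ : Formula σ) (a : W') (g : ℕ → D') :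
    (I.transport F p q).Sat a g φ ↔ I.Sat (p a) (fun x => q (g x)) φ := by
  have ht : ∀ (g : ℕ → D') (t : Term σ),
      q ((I.transport F p q).deno g t) = I.deno (fun x => q (g x)) t := by
    rintro g (x | c)
    · rfl
    · exact q.apply_symm_apply _
  have hup : ∀ (g : ℕ → D') (x : ℕ) (d : D'),
      (fun y => q (update g x d y)) = update (fun y => q (g y)) x (q d) := fun g x d =>
    funext fun y => apply_update (fun _ => q) g x d y
  induction φ generalizing a g with
  | rel P ts =>
    show (fun i => q ((I.transport F p q).deno g (ts i))) ∈ I.pred (p a) P ↔ _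
    simp only [ht]
    rfl
  | eq s t =>
    show F.eqv (p a) (q _) (q _) ↔ _
    rw [ht, ht]
    rfl
  | bot => rfl
  | conj φ ψ ih1 ih2 => exact and_congr (ih1 a g) (ih2 a g)
  | disj φ ψ ih1 ih2 => exact or_congr (ih1 a g) (ih2 a g)
  | imp φ ψ ih1 ih2 =>
    refine Iff.trans ?_ p.surjective.forall.symm
    exact forall_congr' fun b => imp_congr_right fun _ => imp_congr (ih1 b g) (ih2 b g)
  | box φ ih =>
    refine Iff.trans ?_ p.surjective.forall.symm
    refine forall_congr' fun b => Iff.trans ?_ p.surjective.forall.symm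
    exact forall_congr' fun c => imp_congr_right fun _ => imp_congr_right fun _ => ih c g
  | dia φ ih =>
    refine Iff.trans ?_ p.surjective.exists.symm
    exact exists_congr fun b => and_congr_right fun _ => ih b g
  | all x φ ih =>
    refine Iff.trans ?_ p.surjective.forall.symm
    refine forall_congr' fun b => imp_congr_right fun _ => Iff.trans ?_ q.surjective.forall.symm
    refine forall_congr' fun (d : D') => imp_congr_right fun _ => ?_
    have h := ih b (update g x d)
    rwa [hup g x d] at h
  | ex x φ ih =>
    refine Iff.trans ?_ q.surjective.exists.symm
    refine exists_congr fun (d : D') => and_congr_right fun _ => ?_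
    have h := ih a (update g x d)
    rwa [hup g x d] at h

theorem Logic.transport_mem_frames (L : Logic) (h : F ∈ L.frames) : F.transport p q ∈ L.frames := by
  have hser : (∀ a, ∃ b, F.M a b) → ∀ a, ∃ b, (F.transport p q).M a b := fun h a =>
    p.surjective.exists.1 (h (p a))
  have htr : (∀ a b c, F.M a b → F.M b c → F.M a c) → ∀ a b c, (F.transport p q).M a b →
      (F.transport p q).M b c → (F.transport p q).M a c := fun h _ _ _ => h _ _ _
  have hre : (∀ a, F.M a a) → ∀ a, (F.transport p q).M a a := fun h _ => h _
  cases L with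
  | FOFS => trivial
  | FOFSD => exact hser h
  | FOFS4 => exact htr h
  | FOFSD4 => exact ⟨hser h.1, htr h.2⟩
  | FOFST => exact hre h
  | FOFSS4 => exact ⟨hre h.1, htr h.2⟩

theorem transport_mem_idPreserving (h : F ∈ idPreserving) : F.transport p q ∈ idPreserving :=
  fun _ _ hM _ _ => h _ _ hM _ _

theorem transport_mem_idReflecting (h : F ∈ idReflecting) : F.transport p q ∈ idReflecting :=
  fun _ _ hM _ hd _ he => h _ _ hM _ hd _ he

end Transport

/-! ### Completeness from a canonical frame -/

section Completeness

variable {A : Set (Formula σ)} {Λ : Levels σ}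

/-- Constants and sentences are countable, so the data of a world range over a type with a copy in
every universe; the canonical model can be moved to the universes of the frames considered. -/
instance : Small.{v} (World A Λ) := by
  have := σ.countable_const
  have : Small.{v} (ℕ × Set σ.Const × (ℕ → Set (Sent σ))) := inferInstance
  refine small_of_injective (f := fun w : World A Λ => (w.n, w.act, w.th)) fun w u h => ?_
  simp only [Prod.mk.injEq] at h
  exact World.ext h.1 h.2.1 h.2.2

theorem exists_list_of_meet {Γ : Set (Sent σ)} {a : Sent σ} (h : Meet Γ a) :
    ∃ l : List (Formula σ), (∀ γ ∈ l, ∃ δ ∈ Γ, δ.1 = γ) ∧ a.1 = .bigConj l := by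
  induction h with
  | top => exact ⟨[], by simp, rfl⟩
  | @cons γ a hγ _ ih =>
    obtain ⟨l, hl, ha⟩ := ih
    refine ⟨γ.1 :: l, ?_, by rw [Formula.bigConj, ← ha]; rfl⟩
    intro δ hδ
    rcases List.mem_cons.1 hδ with rfl | hδ
    exacts [⟨γ, hγ, rfl⟩, hl δ hδ]

theorem isComplete_of_canonical {C : Set Frame.{v, w}} (hA : MapClosed A)
    (hC : ∀ Λ : Levels σ, ∃ (M : World A Λ → World A Λ → Prop) (hM : Admissible M),
      ∀ (W' : Type v) (D' : Type w) (p : W' ≃ World A Λ) (q : D' ≃ σ.Const),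
        (canonFrame hM).transport p q ∈ C) : IsComplete A C := by
  intro Γ φ hΓ hφ hcons
  by_contra hder
  obtain ⟨Λ⟩ := exists_levels σ
  obtain ⟨M, hM, hmem⟩ := hC Λ
  have := σ.countable_const
  have := σ.infinite_const
  obtain ⟨c₀⟩ : Nonempty σ.Const := inferInstance
  let p := (equivShrink.{v} (World A Λ)).symm
  let q := (equivShrink.{w} σ.Const).symm
  let X : ℕ → Set (Sent σ) := update (fun _ => ∅) 0 {δ | ∃ γ ∈ Γ, δ.1 = γ.map Λ.base}
  have hX0 : X 0 = {δ | ∃ γ ∈ Γ, δ.1 = γ.map Λ.base} := update_self ..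
  have hXpos : ∀ i, 0 < i → X i = ∅ := fun i hi => update_of_ne hi.ne' ..
  have hmap : ∀ ψ : Formula σ, (ψ.map Λ.base).consts ⊆ Set.range Λ.base := by
    intro ψ d hd
    obtain ⟨c, -, rfl⟩ := Formula.consts_map hd
    exact ⟨c, rfl⟩
  obtain ⟨w, h1, h2, h3, h4⟩ := exists_world (A := A) (Λ := Λ) (n := 0) (X := X)
    (old := Set.range Λ.base) (ψ := ⟨φ.map Λ.base, hφ.map _⟩) (fun c => ⟨c, rfl⟩)
    (by
      rintro _ ⟨c, rfl⟩
      exact (Λ.lev_base c).le)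
    Λ.infinite
    (fun i δ hδ c hc => by
      rcases Nat.eq_zero_or_pos i with rfl | hi
      · rw [hX0] at hδ
        obtain ⟨γ, -, hγ⟩ := hδ
        have hc' : c ∈ Set.range Λ.base := hmap γ (by rw [← hγ]; exact hc)
        obtain ⟨d, rfl⟩ := hc'
        exact ⟨⟨d, rfl⟩, (Λ.lev_base d).le⟩
      · rw [hXpos i hi] at hδ
        exact hδ.elim)
    hXpos (hmap φ)
    (by
      rintro ⟨a, ha, b, hb, hle⟩
      -- Nothing is transmitted to level `0`, so being a consequence there is plain derivability. A
      -- left inverse of `Λ.base` then renames the derivation back.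
      rw [show b = .top from hb, cls_top, inf_top_eq] at hle
      obtain ⟨l, hl, hal⟩ := exists_list_of_meet ha
      have hthm : Thm A (.imp a.1 (φ.map Λ.base)) := hle
      rw [hal] at hthm
      have hthm' := hthm.map hA (invFun Λ.base)
      have hinv : ∀ ψ : Formula σ, (ψ.map Λ.base).map (invFun Λ.base) = ψ := fun ψ => by
        rw [Formula.map_map, invFun_comp Λ.base_injective]
        exact Formula.bind_id ψ
      refine hder ⟨l.map (Formula.map (invFun Λ.base)), ?_, ?_⟩
      · intro γ hγ
        obtain ⟨δ, hδ, rfl⟩ := List.mem_map.1 hγ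
        obtain ⟨ε, hε, rfl⟩ := hl δ hδ
        rw [hX0] at hε
        obtain ⟨γ, hγ', hεγ⟩ := hε
        rwa [hεγ, hinv]
      · have : Thm A (.imp ((Formula.bigConj l).map (invFun Λ.base))
          ((φ.map Λ.base).map (invFun Λ.base))) := hthm'
        rwa [Formula.map_bigConj, hinv] at this)
  have hsat : ∀ (ψ : Formula σ) (hψ : ψ.IsSentence) (g : ℕ → Shrink.{w} σ.Const),
      (∀ x, q (g x) ∈ w.act) →
      (((canonInterp hM).transport _ p q).Sat (p.symm w) g ψ ↔
        (⟨ψ.map Λ.base, hψ.map _⟩ : Sent σ) ∈ w.last) := by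
    intro ψ hψ g hg
    have key : ∀ w' : World A Λ, w' = w → ((canonInterp hM).Sat w' (fun x => q (g x)) ψ ↔
        (⟨ψ.map Λ.base, hψ.map _⟩ : Sent σ) ∈ w.last) := by
      rintro _ rfl
      rw [sat_canonInterp hM ψ _ _ hg, show ψ.close Λ.base (fun x => q (g x)) =
        ⟨ψ.map Λ.base, hψ.map _⟩ from Subtype.ext (Formula.close_of_isSentence hψ _ _)]
    exact (Interp.sat_transport (F := canonFrame hM) p q (canonInterp hM) ψ (p.symm w) g).trans
      (key _ (p.apply_symm_apply w))
  have hdom : ∀ g : ℕ → Shrink.{w} σ.Const,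
      (∀ x, g x ∈ ((canonFrame hM).transport p q).dom (p.symm w)) → ∀ x, q (g x) ∈ w.act := by
    intro g hg x
    have : q (g x) ∈ World.act (p (p.symm w)) := hg x
    rwa [p.apply_symm_apply] at this
  have hg₀ : ∀ _ : ℕ, q (q.symm (Λ.base c₀)) ∈ w.act := fun _ => by
    rw [q.apply_symm_apply]
    exact w.base_mem c₀
  have htrue := hcons _ (hmem _ _ p q) ((canonInterp hM).transport _ p q) (p.symm w)
    (fun γ hγ g hg => (hsat γ (hΓ γ hγ) g (hdom g hg)).2 (by
      rw [World.last, h1]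
      refine h3 0 ?_
      rw [hX0]
      exact ⟨γ, hγ, rfl⟩))
    (fun _ => q.symm (Λ.base c₀)) (fun x => by
      show q _ ∈ World.act (p (p.symm w))
      rw [p.apply_symm_apply]
      exact hg₀ x)
  exact h4 ((hsat φ hφ _ hg₀).1 htrue)

end Completeness

/-! ### Modal relations for the six logics -/

section Admissible

variable {A : Set (Formula σ)} {Λ : Levels σ} {M : World A Λ → World A Λ → Prop}

theorem admissible_step : Admissible (World.Step (A := A) (Λ := Λ)) where
  of_step _ _ h := h
  fc1 _ _ _ := World.Step.fc1
  fc2 _ _ _ h h' := h'.fc2 h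
  act_subset _ _ h := h.act_subset
  box _ _ _ h := h.box
  dia _ _ _ h := h.dia

theorem World.imp_mem {w : World A Λ} {φ ψ : Sent σ} (h : Thm A (φ.imp ψ).1) (hφ : φ ∈ w.last)
    (hψ : ψ.consts ⊆ w.act) : ψ ∈ w.last := World.up hφ hψ h

theorem Admissible.act_subset_of_transGen (hM : Admissible M) {w v : World A Λ}
    (h : Relation.TransGen M w v) : w.act ⊆ v.act := by
  induction h with
  | single h => exact hM.act_subset _ _ h
  | tail _ h ih => exact ih.trans (hM.act_subset _ _ h)

/-- Both frame conditions propagate link by link. The axiom `□φ → □□φ` carries `□φ` itself along the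
path, and `◇◇φ → ◇φ` collapses the diamonds collected on the way back. -/
theorem Admissible.transGen (hM : Admissible M) (h4b : ax4Box σ ⊆ A) (h4d : ax4Dia σ ⊆ A) :
    Admissible (Relation.TransGen M) where
  of_step w v h := .single (hM.of_step w v h)
  fc1 w v v' h := by
    induction h generalizing v' with
    | single h =>
      intro hle
      obtain ⟨w', h1, h2⟩ := hM.fc1 _ _ _ h hle
      exact ⟨w', h1, .single h2⟩
    | tail _ h ih =>
      intro hle
      obtain ⟨u, h1, h2⟩ := hM.fc1 _ _ _ h hle
      obtain ⟨w', h3, h4⟩ := ih u h1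
      exact ⟨w', h3, h4.tail h2⟩
  fc2 w w' v hle h := by
    induction h with
    | single h =>
      obtain ⟨v', h1, h2⟩ := hM.fc2 _ _ _ hle h
      exact ⟨v', h1, .single h2⟩
    | tail _ h ih =>
      obtain ⟨u, h1, h2⟩ := ih
      obtain ⟨v', h3, h4⟩ := hM.fc2 _ _ _ h1 h
      exact ⟨v', h3, h2.tail h4⟩
  act_subset _ _ := hM.act_subset_of_transGen
  box w v φ h hφ := by
    have hstep : ∀ u u' : World A Λ, M u u' → φ.box ∈ u.last → φ ∈ u'.last ∧ φ.box ∈ u'.last := by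
      intro u u' hu hφ
      refine ⟨hM.box _ _ _ hu hφ, hM.box _ _ φ.box hu ?_⟩
      exact World.imp_mem (ψ := φ.box.box) (.extra (h4b ⟨φ, φ.2, rfl⟩)) hφ
        (World.consts_subset (φ := φ.box) hφ)
    have : φ ∈ v.last ∧ φ.box ∈ v.last := by
      induction h with
      | single h => exact hstep _ _ h hφ
      | tail _ h ih => exact hstep _ _ h ih.2
    exact this.1
  dia w v φ h := by
    induction h generalizing φ with
    | single h => exact hM.dia _ _ _ h
    | @tail u v hwu h ih =>
      intro hφ hl
      have h1 := ih φ.dia (hM.dia _ _ _ h hφ (hl.trans (hM.act_subset_of_transGen hwu))) hl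
      exact World.imp_mem (.extra (h4d ⟨φ, φ.2, rfl⟩)) h1 hl

theorem Admissible.reflGen (hM : Admissible M) (hTb : axTBox σ ⊆ A) (hTd : axTDia σ ⊆ A) :
    Admissible (Relation.ReflGen M) where
  of_step w v h := .single (hM.of_step w v h)
  fc1 w v v' h hle := by
    cases h with
    | refl => exact ⟨v', hle, .refl⟩
    | single h =>
      obtain ⟨w', h1, h2⟩ := hM.fc1 _ _ _ h hle
      exact ⟨w', h1, .single h2⟩
  fc2 w w' v hle h := by
    cases h with
    | refl => exact ⟨w', hle, .refl⟩
    | single h =>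
      obtain ⟨v', h1, h2⟩ := hM.fc2 _ _ _ hle h
      exact ⟨v', h1, .single h2⟩
  act_subset w v h := by
    cases h with
    | refl => exact subset_rfl
    | single h => exact hM.act_subset _ _ h
  box w v φ h hφ := by
    cases h with
    | refl =>
      exact World.imp_mem (.extra (hTb ⟨φ, φ.2, rfl⟩)) hφ (World.consts_subset (φ := φ.box) hφ)
    | single h => exact hM.box _ _ _ h hφ
  dia w v φ h hφ hl := by
    cases h with
    | refl => exact World.imp_mem (ψ := φ.dia) (.extra (hTd ⟨φ, φ.2, rfl⟩)) hφ hl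
    | single h => exact hM.dia _ _ _ h hφ hl

/-- From `□⊤` the axiom D gives `◇⊤`, which has a witnessing step. -/
theorem Admissible.serial (hM : Admissible M) (hD : axD σ ⊆ A) (w : World A Λ) : ∃ v, M w v := by
  have htop : ∀ c ∈ (Sent.top : Sent σ).consts, c ∈ w.act := by
    rw [consts_top]
    exact fun c hc => hc.elim
  have h1 : Sent.top.box ∈ w.last := World.mem_of_eq_top htop cls_box_top
  have h2 : Sent.top.dia ∈ w.last :=
    World.imp_mem (.extra (hD ⟨.top, Sent.top.2, rfl⟩)) h1 htop
  obtain ⟨v, hv, -⟩ := World.exists_step_of_dia h2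
  exact ⟨v, hM.of_step _ _ hv⟩

theorem canonFrame_mem_idPreserving (hM : Admissible M) (hA : axNI σ ⊆ A) :
    canonFrame hM ∈ idPreserving := by
  rintro w v h c d ⟨⟨hc, hd⟩, h'⟩
  refine ⟨⟨hM.act_subset w v h hc, hM.act_subset w v h hd⟩, hM.box w v _ h ?_⟩
  exact World.imp_mem (ψ := (Sent.eq c d).box) (.extra (hA ⟨c, d, rfl⟩)) h' (consts_eq_subset hc hd)

theorem canonFrame_mem_idReflecting (hM : Admissible M) (hA : axND σ ⊆ A) :
    canonFrame hM ∈ idReflecting := by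
  rintro w v h c hc d hd ⟨-, h'⟩
  have hl := consts_eq_subset (act := World.act w) hc hd
  exact ⟨⟨hc, hd⟩, World.imp_mem (.extra (hA ⟨c, d, rfl⟩)) (hM.dia w v _ h h' hl) hl⟩

theorem Logic.exists_admissible (L : Logic) (hA : L.axioms σ ⊆ A) (Λ : Levels σ) :
    ∃ (M : World A Λ → World A Λ → Prop) (hM : Admissible M), canonFrame hM ∈ L.frames := by
  cases L with
  | FOFS => exact ⟨_, admissible_step, trivial⟩
  | FOFSD => exact ⟨_, admissible_step, admissible_step.serial hA⟩
  | FOFS4 =>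
    have h := Set.union_subset_iff.1 hA
    exact ⟨_, admissible_step.transGen h.1 h.2, fun _ _ _ => Relation.TransGen.trans⟩
  | FOFSD4 =>
    have h := Set.union_subset_iff.1 hA
    have h' := Set.union_subset_iff.1 h.1
    have hM := (admissible_step (Λ := Λ)).transGen h'.2 h.2
    exact ⟨_, hM, hM.serial h'.1, fun _ _ _ => Relation.TransGen.trans⟩
  | FOFST =>
    have h := Set.union_subset_iff.1 hA
    exact ⟨_, admissible_step.reflGen h.1 h.2, fun _ => .refl⟩
  | FOFSS4 =>
    have h := Set.union_subset_iff.1 hA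
    have h' := Set.union_subset_iff.1 h.1
    have h'' := Set.union_subset_iff.1 h'.1
    refine ⟨_, (admissible_step.transGen h'.2 h.2).reflGen h''.1 h''.2, fun _ => .refl, ?_⟩
    rintro a b c (_ | hab) (_ | hbc)
    exacts [.refl, .single hbc, .single hab, .single (hab.trans hbc)]

end Admissible

/-! ### Assembling the theorem -/

theorem Logic.isSound_isComplete (L : Logic) {B : Set (Formula σ)}
    {C : Set Frame.{v, w}} {C' : Set Frame.{u, u}} (hB : MapClosed B)
    (hvalid : ∀ F ∈ C, ∀ φ ∈ B, Valid F φ)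
    (hcanon : ∀ (A : Set (Formula σ)) (Λ : Levels σ) (M : World A Λ → World A Λ → Prop)
      (hM : Admissible M), B ⊆ A → canonFrame hM ∈ C')
    (htrans : ∀ F ∈ C', ∀ (W' : Type v) (D' : Type w) (p : W' ≃ F.W) (q : D' ≃ F.D),
      F.transport p q ∈ C) :
    IsSound (L.axioms σ ∪ B) (L.frames ∩ C) ∧ IsComplete (L.axioms σ ∪ B) (L.frames ∩ C) := by
  refine ⟨isSound_of_valid fun F hF φ hφ => hφ.elim (L.valid_axioms hF.1 φ) (hvalid F hF.2 φ),
    isComplete_of_canonical (L.mapClosed_axioms.union hB) fun Λ => ?_⟩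
  obtain ⟨M, hM, hL⟩ := L.exists_admissible (A := L.axioms σ ∪ B) Set.subset_union_left Λ
  exact ⟨M, hM, fun W' D' p q => ⟨L.transport_mem_frames p q hL,
    htrans _ (hcanon _ Λ M hM Set.subset_union_right) W' D' p q⟩⟩

end FischerServi

theorem mainTheorem10 (σ : Signature.{u}) (L : FischerServi.Logic) :
    (FischerServi.IsSound (L.axioms σ ∪ FischerServi.axNI σ) (L.frames ∩ FischerServi.idPreserving.{v, w}) ∧
      FischerServi.IsComplete (L.axioms σ ∪ FischerServi.axNI σ) (L.frames ∩ FischerServi.idPreserving.{v, w})) ∧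
    (FischerServi.IsSound (L.axioms σ ∪ FischerServi.axND σ) (L.frames ∩ FischerServi.idReflecting.{v, w}) ∧
      FischerServi.IsComplete (L.axioms σ ∪ FischerServi.axND σ) (L.frames ∩ FischerServi.idReflecting.{v, w})) ∧
    (FischerServi.IsSound (L.axioms σ ∪ (FischerServi.axNI σ ∪ FischerServi.axND σ))
        (L.frames ∩ (FischerServi.idPreserving.{v, w} ∩ FischerServi.idReflecting.{v, w})) ∧
      FischerServi.IsComplete (L.axioms σ ∪ (FischerServi.axNI σ ∪ FischerServi.axND σ))
        (L.frames ∩ (FischerServi.idPreserving.{v, w} ∩ FischerServi.idReflecting.{v, w}))) := by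
  refine ⟨?_, ?_, ?_⟩
  · exact L.isSound_isComplete (C' := FischerServi.idPreserving) FischerServi.mapClosed_axNI
      (fun F hF => FischerServi.valid_axNI hF)
      (fun A Λ M hM hA => FischerServi.canonFrame_mem_idPreserving hM hA)
      fun F hF W' D' p q => FischerServi.transport_mem_idPreserving p q hF
  · exact L.isSound_isComplete (C' := FischerServi.idReflecting) FischerServi.mapClosed_axND
      (fun F hF => FischerServi.valid_axND hF)
      (fun A Λ M hM hA => FischerServi.canonFrame_mem_idReflecting hM hA)
      fun F hF W' D' p q => FischerServi.transport_mem_idReflecting p q hF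
  · exact L.isSound_isComplete
      (C' := FischerServi.idPreserving ∩ FischerServi.idReflecting)
      (FischerServi.mapClosed_axNI.union FischerServi.mapClosed_axND)
      (fun F hF φ hφ => hφ.elim (FischerServi.valid_axNI hF.1 φ) (FischerServi.valid_axND hF.2 φ))
      (fun A Λ M hM hA => ⟨FischerServi.canonFrame_mem_idPreserving hM
          (Set.subset_union_left.trans hA),
        FischerServi.canonFrame_mem_idReflecting hM (Set.subset_union_right.trans hA)⟩)
      fun F hF W' D' p q => ⟨FischerServi.transport_mem_idPreserving p q hF.1,
        FischerServi.transport_mem_idReflecting p q hF.2⟩
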